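/- Conventions. A $k$-graph $H$ is a $k$-uniform hypergraph on a finite vertex set; $\delta(H)$ is its minimum vertex degree, i.e. the minimum over all vertices $v$ of the number of edges containing $v$. A perfect matching of $H$ is a set of edges such that every vertex lies in exactly one of them. For $k\mid n$ let $m(k,n)$ be the smallest integer $m$ such that every $n$-vertex $k$-graph $H$ with $\delta(H)\ge m$ has a perfect matching, and let $$f(k)=\limsup_{n\to\infty,\ k\mid n}\frac{m(k,n)}{\binom{n-1}{k-1}}.$$ Let $\mathbb N^r_{k-1}$ be the set of vectors $\mathbf a=(a_1,\dots,a_r)$ of non-negative integers with $a_1\le\dots\le a_r$ and $a_1+\dots+a_r=k-1$. For $rk\mid n$ let $H(n,\mathbf a)$ be the $k$-graph on a disjoint union $V_1\cup\dots\cup V_r$ with $|V_i|=\frac{ra_i+1}{rk}n$, whose edges are all sets $e$ of vertices for which there is an $i$ with $|e\cap V_i|=a_i+1$ and $|e\cap V_j|=a_j$ for all $j\ne i$. Let $$g_r(k)=\max_{\mathbf a\in\mathbb N^r_{k-1}}\ \lim_{n\to\infty,\ rk\mid n}\frac{\delta(H(n,\mathbf a))}{\binom{n-1}{k-1}}.$$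 Let $h_r(k)$ be the infimum of all $h>0$ with the following property: for every $\varepsilon>0$ there is $\delta>0$ such that for all sufficiently large $n\equiv0\pmod k$, every $n$-vertex $k$-graph $H$ with $\delta(H)\ge(h+\varepsilon)\binom{n-1}{k-1}$ and every $r$-colouring of $E(H)$ admit a perfect matching of $H$ with at least $\frac{n}{rk}+\delta n$ edges of one colour. Theorem. Let $k\ge3$ and $r\ge2$ be integers. There is a real number $\gamma=\gamma(k,r)>0$ such that for every $\eta>0$ there is $n_0=n_0(k,r,\eta)$ with the following property. If $n\ge n_0$, $n\equiv0\pmod k$, and $H$ is an $n$-vertex $k$-graph with $$\delta(H)>\bigl(\max\{f(k),g_r(k)\}+\eta\bigr)\binom{n-1}{k-1},$$ then for every $r$-colouring of $E(H)$ there is a perfect matching of $H$ with at least $\frac{n}{rk}(1+\gamma\eta)$ edges of one colour. In particular, $h_r(k)\le\max\{f(k),g_r(k)\}$. -/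

import Mathlib

open Filter Topology

/-- A `k`-graph (`k`-uniform hypergraph) whose vertex set is the whole of `V`: a family of
`k`-element subsets of `V`. -/
structure KGraph (V : Type*) (k : ℕ) where
  /-- the edge set -/
  edges : Finset (Finset V)
  /-- every edge has exactly `k` vertices -/
  uniform : ∀ e ∈ edges, e.card = k

namespace KGraph

variable {V : Type*} {k : ℕ}

/-- The degree of a vertex: the number of edges containing it. -/
def degree [DecidableEq V] (H : KGraph V k) (v : V) : ℕ :=
  (H.edges.filter (fun e => v ∈ e)).card

/-- The minimum vertex degree `δ(H)`. -/
noncomputable def minDegree [DecidableEq V] (H : KGraph V k) : ℕ :=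
  ⨅ v : V, H.degree v

/-- `M` is a perfect matching of `H`: a set of edges of `H` such that every vertex lies in exactly
one of them. -/
def IsPerfectMatching (H : KGraph V k) (M : Finset (Finset V)) : Prop :=
  M ⊆ H.edges ∧ ∀ v : V, ∃! e : Finset V, e ∈ M ∧ v ∈ e

end KGraph

/-- The filter "`n → ∞` along the multiples of `d`". -/
def atTopMultiples (d : ℕ) : Filter ℕ :=
  atTop ⊓ 𝓟 {n : ℕ | d ∣ n}

/-- `m(k, n)`: the smallest integer `m` such that every `n`-vertex `k`-graph `H` with `δ(H) ≥ m`
has a perfect matching. -/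
noncomputable def matchingThreshold (k n : ℕ) : ℕ :=
  sInf {m : ℕ | ∀ H : KGraph (Fin n) k, m ≤ H.minDegree → ∃ M, H.IsPerfectMatching M}

/-- `f(k) = limsup m(k, n) / C(n-1, k-1)`, as `n → ∞` with `n ≡ 0 (mod k)`. -/
noncomputable def existenceThreshold (k : ℕ) : ℝ :=
  limsup (fun n : ℕ => (matchingThreshold k n : ℝ) / ((n - 1).choose (k - 1) : ℝ))
    (atTopMultiples k)

/-- The vectors `a = (a₁, …, a_r)` of natural numbers with `a₁ ≤ ⋯ ≤ a_r` and sum `k - 1`. -/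
def typeVectors (r k : ℕ) : Set (Fin r → ℕ) :=
  {a | ∑ i, a i = k - 1 ∧ Monotone a}

/-- The vertex set `V₁ ∪ ⋯ ∪ V_r` of `H(n, a)`, a disjoint union with
`|V_i| = (r a_i + 1) n / (r k)`; for `a ∈ typeVectors r k` and `r k ∣ n` it has `n` elements. -/
abbrev extremalVertex (r k n : ℕ) (a : Fin r → ℕ) : Type :=
  Σ i : Fin r, Fin ((r * a i + 1) * (n / (r * k)))

/-- The `k`-graph `H(n, a)`: its edges are the sets `e` for which there is an `i` with
`|e ∩ V_i| = a_i + 1` and `|e ∩ V_j| = a_j` for all `j ≠ i`. (Requiring `|e| = k` is redundant for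
`k ≥ 1` and `a ∈ typeVectors r k`.) -/
def extremalGraph (r k n : ℕ) (a : Fin r → ℕ) : KGraph (extremalVertex r k n a) k where
  edges := Finset.univ.filter (fun e : Finset (extremalVertex r k n a) =>
    e.card = k ∧ ∃ i : Fin r, ∀ j : Fin r,
      (e.filter (fun v => v.1 = j)).card = if j = i then a j + 1 else a j)
  uniform := fun _ he => (Finset.mem_filter.mp he).2.1

/-- `g_r(k)`: the maximum, over the finitely many vectors `a`, of the limit of
`δ(H(n, a)) / C(n-1, k-1)` as `n → ∞` along the multiples of `r k`. -/
noncomputable def extremalThreshold (r k : ℕ) : ℝ :=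
  ⨆ a : typeVectors r k,
    limUnder (atTopMultiples (r * k))
      (fun n : ℕ => ((extremalGraph r k n a.1).minDegree : ℝ) / ((n - 1).choose (k - 1) : ℝ))

/-- `h_r(k)`: the smallest constant `h > 0` such that for every `ε > 0` there is a `δ > 0` for which
every `r`-edge-coloured `k`-graph `H` on `n` vertices, with `k ∣ n` sufficiently large and
`δ(H) ≥ (h + ε) C(n-1, k-1)`, has a perfect matching with at least `n / (r k) + δ n` edges of one
colour. A colouring is given on all finite vertex sets; only its values on edges matter. -/
noncomputable def discrepancyThreshold (r k : ℕ) : ℝ :=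
  sInf {h : ℝ | 0 < h ∧ ∀ ε : ℝ, 0 < ε → ∃ δ : ℝ, 0 < δ ∧ ∃ n₀ : ℕ,
    ∀ n : ℕ, n₀ ≤ n → k ∣ n → ∀ H : KGraph (Fin n) k,
      (h + ε) * ((n - 1).choose (k - 1) : ℝ) ≤ (H.minDegree : ℝ) →
      ∀ c : Finset (Fin n) → Fin r, ∃ M : Finset (Finset (Fin n)), H.IsPerfectMatching M ∧
        ∃ i : Fin r, (n : ℝ) / ((r : ℝ) * k) + δ * n ≤ ((M.filter (fun e => c e = i)).card : ℝ)}

/-! Call two matchings on the same vertex set a switch if they have different numbers of edges of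
some colour. Greedily collect vertex-disjoint switches with at most $k+1$ edges per side, up to a
small constant times $\eta n$ of them.

If the target number is reached, the rest of $H$ still exceeds $f(k)$ and has a perfect matching. By
pigeonhole a $1/r$ fraction of the switches gain in one colour, so flipping these gives two perfect
matchings whose numbers of edges of that colour differ linearly in $\eta n$; one of the two is
unbalanced (`exists_two_isPerfectMatching`, `le_card_colour`).

Otherwise deleting a few vertices leaves a graph without switches. The space barrier gives $f(k)\ge
1/2$, so any two vertices $x,y$ have common link sets $S$ avoiding any bounded set. Without switches
the colour change $\delta_{c(x\cup S)}-\delta_{c(y\cup S)}$ does not depend on $S$ and is additive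
in $(x,y)$, hence equals $w(x)-w(y)$ for a potential $w$. Pairwise differences of $w$ are
differences of unit vectors, so $w=u\pm\delta_\varphi$ for a partition $\varphi$ into $r$ classes,
and exchanging whole edges shows that every edge $e$ has type $A\pm\delta_{c(e)}$
(`NoSwitch.exists_structure`).

Take any perfect matching and suppose it is nearly balanced; it then determines the class sizes. For
the sign $+$ these are nearly those of $H(n,\mathbf a)$, so $\delta(H)$ is at most about $g_r(k)$.
For the sign $-$: if $r=2$, swapping the classes gives the sign $+$; if $r\ge4$, each $(k-1)$-set is
in the links of at most two classes, whence $\delta(H)\lesssim\frac12$; if $r=3$, either some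
$A_i=1$ and $H(n,(0,0,k-1))$ has at least as large a degree, or a trinomial estimate bounds the
density by $\frac12$ (`minDegree_le_of_three_classes`). Each bound contradicts the degree
hypothesis. -/

theorem Finset.card_filter_mem_powersetCard_le {α : Type*} [DecidableEq α] (s : Finset α) (m : ℕ)
    (u : α) :
    ((s.powersetCard m).filter (fun S => u ∈ S)).card ≤ (s.card - 1).choose (m - 1) := by
  by_cases hu : u ∈ s
  · rw [← Finset.card_erase_of_mem hu, ← Finset.card_powersetCard]
    refine Finset.card_le_card_of_injOn (fun S => S.erase u) ?_ ?_
    · intro S hS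
      simp only [Finset.coe_filter, Finset.mem_powersetCard, Set.mem_ofPred_eq] at hS
      simp only [Finset.mem_coe, Finset.mem_powersetCard]
      exact ⟨Finset.erase_subset_erase _ hS.1.1, by rw [Finset.card_erase_of_mem hS.2, hS.1.2]⟩
    · intro S hS T hT h
      simp only [Finset.coe_filter, Set.mem_ofPred_eq] at hS hT
      rw [← Finset.insert_erase hS.2, ← Finset.insert_erase hT.2]
      exact congrArg _ h
  · rw [Finset.filter_eq_empty_iff.2]
    · simp
    · intro S hS h
      exact hu ((Finset.mem_powersetCard.1 hS).1 h)

/-! ### Links, common links, vertex deletion and perfect matchings. -/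

namespace KGraph

variable {V : Type*} {k : ℕ}

theorem minDegree_le_degree [DecidableEq V] (H : KGraph V k) (v : V) :
    H.minDegree ≤ H.degree v :=
  ciInf_le (OrderBot.bddBelow _) v

theorem exists_degree_eq_minDegree [DecidableEq V] [Nonempty V] (H : KGraph V k) :
    ∃ v, H.degree v = H.minDegree :=
  Nat.sInf_mem (Set.range_nonempty _)

theorem le_minDegree [DecidableEq V] [Nonempty V] (H : KGraph V k) {m : ℕ}
    (h : ∀ v, m ≤ H.degree v) : m ≤ H.minDegree :=
  le_ciInf h

section Fintype

variable [Fintype V] [DecidableEq V]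

/-- The `(k-1)`-sets that form an edge together with `v`. -/
def link (H : KGraph V k) (v : V) : Finset (Finset V) :=
  ((Finset.univ.erase v).powersetCard (k - 1)).filter (fun S => insert v S ∈ H.edges)

theorem mem_link {H : KGraph V k} {v : V} {S : Finset V} :
    S ∈ H.link v ↔ (v ∉ S ∧ S.card = k - 1) ∧ insert v S ∈ H.edges := by
  simp [link, Finset.mem_powersetCard, Finset.subset_erase]

theorem card_link (H : KGraph V k) (v : V) : (H.link v).card = H.degree v := by
  refine Finset.card_nbij' (fun S => insert v S) (fun e => e.erase v) ?_ ?_ ?_ ?_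
  · intro S hS
    have := mem_link.1 hS
    simp [this.2]
  · intro e he
    simp only [Finset.coe_filter, Set.mem_ofPred_eq] at he
    refine mem_link.2 ⟨⟨by simp, ?_⟩, ?_⟩
    · rw [Finset.card_erase_of_mem he.2, H.uniform e he.1]
    · rw [Finset.insert_erase he.2]; exact he.1
  · intro S hS
    exact Finset.erase_insert (mem_link.1 hS).1.1
  · intro e he
    simp only [Finset.coe_filter, Set.mem_ofPred_eq] at he
    exact Finset.insert_erase he.2

theorem degree_le_choose (H : KGraph V k) (v : V) :
    H.degree v ≤ (Fintype.card V - 1).choose (k - 1) := by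
  rw [← card_link]
  refine (Finset.card_filter_le _ _).trans ?_
  simp [Finset.card_powersetCard]

theorem minDegree_le_choose [Nonempty V] (H : KGraph V k) :
    H.minDegree ≤ (Fintype.card V - 1).choose (k - 1) :=
  (H.minDegree_le_degree (Classical.arbitrary V)).trans (H.degree_le_choose _)

/-- Union bound: each vertex of `F` lies in at most $\binom{n-2}{k-2}$ of the $(k-1)$-sets that
avoid `v`. -/
theorem degree_le_card_link_disjoint_add (H : KGraph V k) (v : V) (F : Finset V) :
    H.degree v ≤ ((H.link v).filter (fun S => Disjoint S F)).card +
      F.card * (Fintype.card V - 2).choose (k - 2) := by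
  rw [← card_link, ← Finset.card_filter_add_card_filter_not (s := H.link v)
    (fun S => Disjoint S F)]
  gcongr
  calc _ ≤ (F.biUnion fun u => ((Finset.univ.erase v).powersetCard (k - 1)).filter
          (fun S => u ∈ S)).card := by
        refine Finset.card_le_card ?_
        intro S hS
        simp only [Finset.mem_filter, Finset.not_disjoint_iff] at hS
        obtain ⟨hS, u, huS, huF⟩ := hS
        simp only [Finset.mem_biUnion, Finset.mem_filter]
        exact ⟨u, huF, (Finset.mem_filter.1 hS).1, huS⟩
    _ ≤ _ := by
        refine Finset.card_biUnion_le_card_mul _ _ _ ?_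
        intro u _
        refine (Finset.card_filter_mem_powersetCard_le _ _ _).trans ?_
        simp [Nat.sub_sub]

/-- Discard from each link the sets that meet `F` or contain the other vertex. Both remaining
families consist of $(k-1)$-sets avoiding `x`, and together they are too large to be disjoint. -/
theorem exists_common_link (H : KGraph V k) (x y : V) (F : Finset V)
    (h : (Fintype.card V - 1).choose (k - 1) +
      2 * (F.card + 1) * (Fintype.card V - 2).choose (k - 2) < 2 * H.minDegree) :
    ∃ S, Disjoint S F ∧ S ∈ H.link x ∧ S ∈ H.link y := by
  by_contra hcon
  push Not at hcon
  set A := (H.link x).filter (fun S => Disjoint S (insert y F))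
  set B := (H.link y).filter (fun S => Disjoint S (insert x F))
  have hA := H.degree_le_card_link_disjoint_add x (insert y F)
  have hB := H.degree_le_card_link_disjoint_add y (insert x F)
  have hAB : Disjoint A B := by
    rw [Finset.disjoint_left]
    intro S hSA hSB
    have h1 := Finset.mem_filter.1 hSA
    have h2 := Finset.mem_filter.1 hSB
    exact hcon S (h1.2.mono_right (Finset.subset_insert _ _)) h1.1 h2.1
  have hU : A ∪ B ⊆ (Finset.univ.erase x).powersetCard (k - 1) := by
    intro S hS
    rcases Finset.mem_union.1 hS with h1 | h1
    · exact (Finset.mem_filter.1 (Finset.mem_filter.1 h1).1).1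
    · have h2 := Finset.mem_filter.1 h1
      have h3 := mem_link.1 h2.1
      rw [Finset.mem_powersetCard, Finset.subset_erase]
      exact ⟨⟨Finset.subset_univ _, fun hx =>
        Finset.disjoint_left.1 h2.2 hx (Finset.mem_insert_self _ _)⟩, h3.1.2⟩
  have hc := Finset.card_le_card hU
  rw [Finset.card_union_of_disjoint hAB, Finset.card_powersetCard,
    Finset.card_erase_of_mem (Finset.mem_univ _), Finset.card_univ] at hc
  have h1 := H.minDegree_le_degree x
  have h2 := H.minDegree_le_degree y
  have h3 := Nat.mul_le_mul_right ((Fintype.card V - 2).choose (k - 2)) (Finset.card_insert_le y F)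
  have h4 := Nat.mul_le_mul_right ((Fintype.card V - 2).choose (k - 2)) (Finset.card_insert_le x F)
  have h5 : 2 * (F.card + 1) * (Fintype.card V - 2).choose (k - 2) =
    2 * ((F.card + 1) * (Fintype.card V - 2).choose (k - 2)) := by ring
  change _ ≤ A.card + _ at hA
  change _ ≤ B.card + _ at hB
  omega

/-- The edges of `H` that avoid `U`, as a `k`-graph on the complement of `U`. -/
def avoiding (H : KGraph V k) (U : Finset V) : KGraph {v // v ∉ U} k where
  edges := Finset.univ.filter (fun e => e.map (Function.Embedding.subtype _) ∈ H.edges)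
  uniform := fun e he => by
    rw [← Finset.card_map (Function.Embedding.subtype _)]
    exact H.uniform _ (Finset.mem_filter.1 he).2

theorem mem_avoiding {H : KGraph V k} {U : Finset V} {e : Finset {v // v ∉ U}} :
    e ∈ (H.avoiding U).edges ↔ e.map (Function.Embedding.subtype _) ∈ H.edges := by
  simp [avoiding]

theorem minDegree_le_minDegree_avoiding_add (H : KGraph V k) (U : Finset V)
    (hU : Nonempty {v // v ∉ U}) :
    H.minDegree ≤ (H.avoiding U).minDegree + U.card * (Fintype.card V - 2).choose (k - 2) := by
  obtain ⟨v, hv⟩ := (H.avoiding U).exists_degree_eq_minDegree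
  refine (H.minDegree_le_degree v.1).trans ((H.degree_le_card_link_disjoint_add v.1 U).trans ?_)
  rw [← hv]
  gcongr
  have key : ∀ S ∈ (H.link v.1).filter (fun S => Disjoint S U),
      ((insert v.1 S).subtype (fun v => v ∉ U)).map (Function.Embedding.subtype _) =
        insert v.1 S := by
    intro S hS
    refine Finset.subtype_map_of_mem ?_
    intro x hx
    rcases Finset.mem_insert.1 hx with rfl | hx
    · exact v.2
    · exact Finset.disjoint_left.1 (Finset.mem_filter.1 hS).2 hx
  refine Finset.card_le_card_of_injOn (fun S => (insert v.1 S).subtype (fun v => v ∉ U)) ?_ ?_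
  · intro S hS
    simp only [Finset.coe_filter, Set.mem_ofPred_eq, mem_avoiding]
    rw [key S hS]
    refine ⟨(mem_link.1 (Finset.mem_filter.1 hS).1).2, by simp⟩
  · intro S hS T hT h
    have h' : insert v.1 S = insert v.1 T := by
      rw [← key S hS, ← key T hT]
      exact congrArg _ h
    rw [← Finset.erase_insert (mem_link.1 (Finset.mem_filter.1 hS).1).1.1, h',
      Finset.erase_insert (mem_link.1 (Finset.mem_filter.1 hT).1).1.1]

theorem sum_degree (H : KGraph V k) : ∑ v, H.degree v = k * H.edges.card := by
  have := Finset.sum_card_bipartiteAbove_eq_sum_card_bipartiteBelow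
    (s := (Finset.univ : Finset V)) (t := H.edges) (fun v e => v ∈ e)
  simp only [Finset.bipartiteAbove, Finset.bipartiteBelow] at this
  unfold degree
  rw [this, Finset.sum_congr rfl (g := fun _ => k), Finset.sum_const, smul_eq_mul, mul_comm]
  intro e he
  simpa using H.uniform e he

end Fintype

/-- A sum over all vertices can be taken edge by edge along a perfect matching. -/
theorem IsPerfectMatching.sum_sum [Fintype V] [DecidableEq V] {H : KGraph V k}
    {M : Finset (Finset V)} (h : H.IsPerfectMatching M) {A : Type*} [AddCommMonoid A] (g : V → A) :
    ∑ e ∈ M, ∑ v ∈ e, g v = ∑ v, g v := by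
  have hU : M.biUnion id = Finset.univ := by
    ext v
    obtain ⟨e, he, -⟩ := h.2 v
    simpa using ⟨e, he⟩
  rw [← hU, Finset.sum_biUnion]
  · rfl
  · intro e he f hf hef
    rw [Function.onFun, Finset.disjoint_left]
    intro v hv hv'
    exact hef ((h.2 v).unique ⟨he, hv⟩ ⟨hf, hv'⟩)

theorem IsPerfectMatching.mul_card [Fintype V] [DecidableEq V] {H : KGraph V k}
    {M : Finset (Finset V)} (h : H.IsPerfectMatching M) : k * M.card = Fintype.card V := by
  have := h.sum_sum (fun _ => (1 : ℕ))
  rw [Finset.sum_congr rfl (g := fun _ => k)] at this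
  · simpa [mul_comm] using this
  · intro e he
    simpa using H.uniform e (h.1 he)

theorem exists_isPerfectMatching_of_matchingThreshold_le [Fintype V] [DecidableEq V] {n : ℕ}
    (hn : 0 < n) (hV : Fintype.card V = n) (H : KGraph V k)
    (h : matchingThreshold k n ≤ H.minDegree) : ∃ M, H.IsPerfectMatching M := by
  have hmem : matchingThreshold k n ∈ {m : ℕ | ∀ H : KGraph (Fin n) k, m ≤ H.minDegree →
      ∃ M, H.IsPerfectMatching M} := by
    -- The infimum is attained because its set is nonempty: no graph has minimum degree above
    -- $\binom{n-1}{k-1}$, so this value qualifies vacuously.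
    refine Nat.sInf_mem ⟨(n - 1).choose (k - 1) + 1, fun G hG => ?_⟩
    have : Nonempty (Fin n) := ⟨⟨0, hn⟩⟩
    have := G.minDegree_le_choose
    simp only [Fintype.card_fin] at this
    omega
  have φ : V ≃ Fin n := Fintype.equivFinOfCardEq hV
  have : Nonempty (Fin n) := ⟨⟨0, hn⟩⟩
  let G : KGraph (Fin n) k :=
    { edges := H.edges.map (Finset.mapEmbedding φ.toEmbedding).toEmbedding
      uniform := by
        intro e he
        obtain ⟨e', he', rfl⟩ := Finset.mem_map.1 he
        simpa using H.uniform e' he' }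
  have hG : ∀ v, G.degree v = H.degree (φ.symm v) := by
    intro v
    unfold degree
    rw [Finset.filter_map, Finset.card_map]
    congr 1
    ext e
    simp [Finset.mem_map_equiv]
  obtain ⟨M, hM, hM'⟩ := hmem G (G.le_minDegree fun v => by
    rw [hG]; exact h.trans (H.minDegree_le_degree _))
  refine ⟨M.map (Finset.mapEmbedding φ.symm.toEmbedding).toEmbedding, ?_, ?_⟩
  · intro e he
    obtain ⟨e', he', rfl⟩ := Finset.mem_map.1 he
    obtain ⟨e, he, rfl⟩ := Finset.mem_map.1 (hM he')
    have h1 : (e.map φ.toEmbedding).map φ.symm.toEmbedding = e := by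
      ext; simp [Finset.mem_map_equiv]
    change (e.map φ.toEmbedding).map φ.symm.toEmbedding ∈ H.edges
    rwa [h1]
  · intro v
    obtain ⟨e, ⟨he, hv⟩, huniq⟩ := hM' (φ v)
    refine ⟨e.map φ.symm.toEmbedding, ⟨Finset.mem_map.2 ⟨e, he, rfl⟩, ?_⟩, ?_⟩
    · simpa [Finset.mem_map_equiv] using hv
    · rintro f ⟨hf, hvf⟩
      obtain ⟨f', hf', rfl⟩ := Finset.mem_map.1 hf
      have : f' = e := huniq f' ⟨hf', by simpa [Finset.mem_map_equiv] using hvf⟩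
      rw [this]; rfl

end KGraph

/-! ### Asymptotics of binomial coefficients and limits along multiples. -/

theorem tendsto_choose_div_pow {u : ℕ → ℕ} {c : ℝ} (t : ℕ) (hu : Tendsto u atTop atTop)
    (huc : Tendsto (fun q : ℕ => (u q : ℝ) / q) atTop (𝓝 c)) :
    Tendsto (fun q : ℕ => ((u q).choose t : ℝ) / (q : ℝ) ^ t) atTop
      (𝓝 (c ^ t / (t.factorial : ℝ))) := by
  have h1 : Tendsto (fun m : ℕ => (m.choose t : ℝ) / ((m : ℝ) ^ t / (t.factorial : ℝ))) atTop
      (𝓝 1) := by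
    refine (Asymptotics.isEquivalent_iff_tendsto_one ?_).1 (isEquivalent_choose t)
    filter_upwards [eventually_gt_atTop 0] with m hm
    have : (0 : ℝ) < m := by exact_mod_cast hm
    positivity
  have h2 := ((h1.comp hu).mul (huc.pow t)).div_const (t.factorial : ℝ)
  rw [one_mul] at h2
  refine h2.congr' ?_
  filter_upwards [hu.eventually_gt_atTop 0] with q hq
  have h3 : (u q : ℝ) ≠ 0 := by exact_mod_cast hq.ne'
  have h4 : (t.factorial : ℝ) ≠ 0 := by exact_mod_cast t.factorial_ne_zero
  simp only [Function.comp, div_pow]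
  field_simp

theorem tendsto_mul_sub_atTop {c : ℕ} (hc : 0 < c) (d : ℕ) :
    Tendsto (fun q : ℕ => c * q - d) atTop atTop :=
  (tendsto_sub_atTop_nat d).comp (tendsto_id.const_mul_atTop' hc)

theorem tendsto_mul_sub_div {c : ℕ} (hc : 0 < c) (d : ℕ) :
    Tendsto (fun q : ℕ => ((c * q - d : ℕ) : ℝ) / q) atTop (𝓝 c) := by
  have h : Tendsto (fun q : ℕ => (c : ℝ) - (d : ℝ) / q) atTop (𝓝 (c - 0)) :=
    tendsto_const_nhds.sub (tendsto_const_div_atTop_nhds_zero_nat _)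
  rw [sub_zero] at h
  refine h.congr' ?_
  filter_upwards [eventually_gt_atTop 0, eventually_ge_atTop d] with q hq hd
  have h0 : (q : ℝ) ≠ 0 := by exact_mod_cast hq.ne'
  rw [Nat.cast_sub (hd.trans (Nat.le_mul_of_pos_left _ hc))]
  push_cast
  field_simp

theorem tendsto_choose_mul_sub_div_pow {c : ℕ} (hc : 0 < c) (d t : ℕ) :
    Tendsto (fun q : ℕ => ((c * q - d).choose t : ℝ) / (q : ℝ) ^ t) atTop
      (𝓝 ((c : ℝ) ^ t / (t.factorial : ℝ))) :=
  tendsto_choose_div_pow t (tendsto_mul_sub_atTop hc d) (tendsto_mul_sub_div hc d)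

theorem eventually_pow_div_factorial_le (t : ℕ) {ζ : ℝ} (hζ : 0 < ζ) :
    ∀ᶠ n : ℕ in atTop, (n : ℝ) ^ t / (t.factorial : ℝ) ≤ (1 + ζ) * ((n - 1).choose t : ℝ) := by
  have h := tendsto_choose_mul_sub_div_pow one_pos 1 t
  have hf : (0 : ℝ) < t.factorial := by exact_mod_cast t.factorial_pos
  have hlt : (1 + ζ)⁻¹ * (1 / (t.factorial : ℝ)) < ((1 : ℕ) : ℝ) ^ t / (t.factorial : ℝ) := by
    rw [Nat.cast_one, one_pow]
    exact mul_lt_of_lt_one_left (by positivity) (inv_lt_one_of_one_lt₀ (by linarith))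
  filter_upwards [h.eventually (lt_mem_nhds hlt), eventually_gt_atTop 0] with n hn h0
  have h1 : (0 : ℝ) < n := by exact_mod_cast h0
  have h2 : 0 < (n : ℝ) ^ t := by positivity
  rw [one_mul] at hn
  rw [lt_div_iff₀ h2] at hn
  have h3 := mul_le_mul_of_nonneg_left hn.le (by positivity : 0 ≤ 1 + ζ)
  calc _ = (1 + ζ) * ((1 + ζ)⁻¹ * (1 / (t.factorial : ℝ)) * (n : ℝ) ^ t) := by
        field_simp
    _ ≤ _ := h3

theorem eventually_atTopMultiples {d : ℕ} {p : ℕ → Prop} :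
    (∀ᶠ n in atTopMultiples d, p n) ↔ ∃ N, ∀ n, N ≤ n → d ∣ n → p n := by
  simp [atTopMultiples, eventually_inf_principal]

theorem atTopMultiples_eq_map {d : ℕ} (hd : 0 < d) :
    atTopMultiples d = map (fun q => d * q) atTop := by
  ext s
  change (∀ᶠ n in atTopMultiples d, n ∈ s) ↔ ∀ᶠ q in atTop, d * q ∈ s
  rw [eventually_atTopMultiples, eventually_atTop]
  constructor
  · rintro ⟨N, hN⟩
    exact ⟨N, fun q hq => hN _ (hq.trans (Nat.le_mul_of_pos_left _ hd)) (dvd_mul_right _ _)⟩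
  · rintro ⟨N, hN⟩
    refine ⟨d * N, ?_⟩
    rintro _ hn ⟨q, rfl⟩
    exact hN q (Nat.le_of_mul_le_mul_left hn hd)

theorem atTopMultiples_neBot {d : ℕ} (hd : 0 < d) : (atTopMultiples d).NeBot := by
  rw [atTopMultiples_eq_map hd]; infer_instance

/-! ### The existence threshold $f(k)$ and its lower bound $1/2$. -/

theorem matchingThreshold_le {k n : ℕ} (hn : 0 < n) :
    matchingThreshold k n ≤ (n - 1).choose (k - 1) + 1 := by
  refine Nat.sInf_le fun G hG => ?_
  have : Nonempty (Fin n) := ⟨⟨0, hn⟩⟩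
  have := G.minDegree_le_choose
  simp only [Fintype.card_fin] at this
  omega

/-- A real `limsup` has its usual order properties only for bounded functions; here
$m(k,n)\le\binom{n-1}{k-1}+1\le2\binom{n-1}{k-1}$. -/
theorem isBoundedUnder_matchingThreshold {k : ℕ} (hk : 0 < k) :
    (atTopMultiples k).IsBoundedUnder (· ≤ ·)
      (fun n : ℕ => (matchingThreshold k n : ℝ) / ((n - 1).choose (k - 1) : ℝ)) := by
  refine ⟨2, ?_⟩
  rw [eventually_map, eventually_atTopMultiples]
  refine ⟨k, fun n hn _ => ?_⟩
  have h1 : 0 < (n - 1).choose (k - 1) := Nat.choose_pos (by omega)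
  have h2 : (1 : ℝ) ≤ ((n - 1).choose (k - 1) : ℝ) := by exact_mod_cast h1
  change _ / _ ≤ (2 : ℝ)
  rw [div_le_iff₀ (by linarith)]
  have h3 : (matchingThreshold k n : ℝ) ≤ ((n - 1).choose (k - 1) : ℝ) + 1 := by
    exact_mod_cast matchingThreshold_le (by omega)
  linarith

/-- Beyond the existence threshold, large `k`-graphs have perfect matchings. -/
theorem exists_forall_isPerfectMatching {k : ℕ} (hk : 0 < k) {ε : ℝ} (hε : 0 < ε) :
    ∃ N : ℕ, ∀ (V : Type*) [Fintype V] [DecidableEq V], N ≤ Fintype.card V →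
      k ∣ Fintype.card V → ∀ H : KGraph V k,
      (existenceThreshold k + ε) * ((Fintype.card V - 1).choose (k - 1) : ℝ) ≤ H.minDegree →
      ∃ M, H.IsPerfectMatching M := by
  have h := eventually_lt_of_limsup_lt (b := existenceThreshold k + ε)
    (show existenceThreshold k < _ by linarith) (isBoundedUnder_matchingThreshold hk)
  obtain ⟨N, hN⟩ := eventually_atTopMultiples.1 h
  refine ⟨max N k, fun V _ _ hV hd H hH => ?_⟩
  have h1 := hN _ ((le_max_left _ _).trans hV) hd
  have hkV : k ≤ Fintype.card V := (le_max_right _ _).trans hV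
  have h2 : (0 : ℝ) < ((Fintype.card V - 1).choose (k - 1) : ℝ) := by
    exact_mod_cast Nat.choose_pos (by omega)
  rw [div_lt_iff₀ h2] at h1
  exact H.exists_isPerfectMatching_of_matchingThreshold_le (by omega) rfl
    (by exact_mod_cast h1.le.trans hH)

/-- The space barrier: all `k`-sets meeting a fixed set of `m - 1` out of `k m` vertices. -/
theorem choose_sub_choose_le_matchingThreshold {k m : ℕ} (hk : 0 < k) (hm : 0 < m) :
    (k * m - 1).choose (k - 1) ≤
      matchingThreshold k (k * m) + (k * m - (m - 1)).choose (k - 1) := by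
  set A : Finset (Fin (k * m)) := Finset.univ.filter (fun v => v.val < m - 1) with hA
  have hkm : m ≤ k * m := Nat.le_mul_of_pos_left _ hk
  have hAc : A.card = m - 1 := by
    rw [hA, Fin.card_filter_val_lt, min_eq_right (by omega)]
  let G : KGraph (Fin (k * m)) k :=
    { edges := (Finset.univ.powersetCard k).filter (fun e => ¬ Disjoint e A)
      uniform := fun e he => (Finset.mem_powersetCard.1 (Finset.mem_filter.1 he).1).2 }
  have hne : Nonempty (Fin (k * m)) := ⟨⟨0, Nat.mul_pos hk hm⟩⟩
  have hdeg : (k * m - 1).choose (k - 1) ≤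
      G.minDegree + (k * m - (m - 1)).choose (k - 1) := by
    obtain ⟨v, hv⟩ := G.exists_degree_eq_minDegree
    rw [← hv, ← G.card_link]
    calc (k * m - 1).choose (k - 1)
        = ((Finset.univ.erase v).powersetCard (k - 1)).card := by
          rw [Finset.card_powersetCard, Finset.card_erase_of_mem (Finset.mem_univ _)]; simp
      _ ≤ (G.link v ∪ (Finset.univ \ A).powersetCard (k - 1)).card := by
          refine Finset.card_le_card fun S hS => ?_
          obtain ⟨h1, h2⟩ := Finset.mem_powersetCard.1 hS
          by_cases hd : Disjoint S A
          · refine Finset.mem_union_right _ (Finset.mem_powersetCard.2 ⟨?_, h2⟩)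
            exact Finset.subset_sdiff.2 ⟨Finset.subset_univ _, hd⟩
          · refine Finset.mem_union_left _ (KGraph.mem_link.2 ?_)
            have hvS : v ∉ S := fun h => by simpa using h1 h
            refine ⟨⟨hvS, h2⟩, Finset.mem_filter.2 ⟨Finset.mem_powersetCard.2
              ⟨Finset.subset_univ _, ?_⟩, ?_⟩⟩
            · rw [Finset.card_insert_of_notMem hvS, h2]; omega
            · exact fun h => hd (h.mono_left (Finset.subset_insert _ _))
      _ ≤ _ := by
          refine (Finset.card_union_le _ _).trans ?_
          rw [Finset.card_powersetCard, Finset.card_sdiff_of_subset (Finset.subset_univ _), hAc]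
          simp
  have hnoPM : ¬ ∃ M, G.IsPerfectMatching M := by
    rintro ⟨M, hM⟩
    have h1 := hM.mul_card
    rw [Fintype.card_fin] at h1
    have h2 : M.card = m := Nat.eq_of_mul_eq_mul_left hk h1
    -- Each of the `m` matching edges would need its own vertex of `A`, which has only `m - 1`.
    have h3 : M.card ≤ A.card := by
      have h4 : ∀ e ∈ M, ∃ v, v ∈ e ∧ v ∈ A := fun e he =>
        Finset.not_disjoint_iff.1 (Finset.mem_filter.1 (hM.1 he)).2
      choose! w hw hw' using h4
      refine Finset.card_le_card_of_injOn w (fun e he => hw' e he) ?_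
      intro e he f hf hef
      exact (hM.2 (w e)).unique ⟨he, hw e he⟩ ⟨hf, hef ▸ hw f hf⟩
    omega
  refine hdeg.trans (Nat.add_le_add_right ?_ _)
  refine le_csInf ⟨_, Nat.sInf_mem (s := {m' : ℕ | ∀ H : KGraph (Fin (k * m)) k,
    m' ≤ H.minDegree → ∃ M, H.IsPerfectMatching M}) ⟨(k * m - 1).choose (k - 1) + 1, ?_⟩⟩ ?_
  · intro H hH
    have := H.minDegree_le_choose
    simp only [Fintype.card_fin] at this
    omega
  · intro b hb
    by_contra hlt
    exact hnoPM (hb G (by omega))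

/-- The space barrier gives $f(k)\ge1-(1-\frac1k)^{k-1}$, and with $j=k-1$ Bernoulli's inequality
gives $(1+\frac1j)^j\ge2$. This is why any two links intersect above the threshold. -/
theorem one_half_le_existenceThreshold {k : ℕ} (hk : 2 ≤ k) : 1 / 2 ≤ existenceThreshold k := by
  have hk0 : 0 < k := by omega
  have hkR : (0 : ℝ) < k := by exact_mod_cast hk0
  have hlim : Tendsto (fun m : ℕ => 1 - ((k * m - (m - 1)).choose (k - 1) : ℝ) /
      ((k * m - 1).choose (k - 1) : ℝ)) atTop (𝓝 (1 - (((k - 1 : ℕ) : ℝ) / k) ^ (k - 1))) := by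
    refine tendsto_const_nhds.sub ?_
    have hu : Tendsto (fun m : ℕ => ((k * m - (m - 1) : ℕ) : ℝ) / m) atTop
        (𝓝 ((k - 1 : ℕ) : ℝ)) := by
      have h : Tendsto (fun m : ℕ => ((k - 1 : ℕ) : ℝ) + (1 : ℝ) / m) atTop
          (𝓝 (((k - 1 : ℕ) : ℝ) + 0)) :=
        tendsto_const_nhds.add (tendsto_const_div_atTop_nhds_zero_nat _)
      rw [add_zero] at h
      refine h.congr' ?_
      filter_upwards [eventually_gt_atTop 0] with m hm
      have h0 : (m : ℝ) ≠ 0 := by exact_mod_cast hm.ne'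
      have h1 : k * m - (m - 1) = (k - 1) * m + 1 := by
        have : k * m = (k - 1) * m + m := by
          rw [← Nat.succ_mul]; congr 1; omega
        omega
      rw [h1]
      push_cast
      field_simp
    have hu' : Tendsto (fun m : ℕ => k * m - (m - 1)) atTop atTop := by
      refine tendsto_atTop_mono (fun m => ?_) tendsto_id
      have : 2 * m ≤ k * m := Nat.mul_le_mul_right _ hk
      simp only [id]; omega
    have h1 := tendsto_choose_div_pow (k - 1) hu' hu
    have h2 := tendsto_choose_mul_sub_div_pow hk0 1 (k - 1)
    have hf : ((k - 1).factorial : ℝ) ≠ 0 := by exact_mod_cast (k - 1).factorial_ne_zero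
    have h3 := h1.div h2 (by positivity)
    rw [div_div_div_cancel_right₀ hf, ← div_pow] at h3
    refine h3.congr' ?_
    filter_upwards [eventually_gt_atTop 0] with m hm
    have h0 : (m : ℝ) ≠ 0 := by exact_mod_cast hm.ne'
    exact div_div_div_cancel_right₀ (by positivity) _ _
  have hbern : (((k - 1 : ℕ) : ℝ) / k) ^ (k - 1) ≤ 1 / 2 := by
    obtain ⟨j, rfl⟩ : ∃ j, k = j + 1 := ⟨k - 1, by omega⟩
    have hj : (0 : ℝ) < j := by exact_mod_cast (by omega : 0 < j)
    have h := one_add_mul_le_pow (a := 1 / (j : ℝ)) (by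
      have : 0 ≤ 1 / (j : ℝ) := by positivity
      linarith) j
    have h' : (j : ℝ) * (1 / j) = 1 := by field_simp
    rw [h'] at h
    rw [Nat.add_sub_cancel]
    have h1 : (j : ℝ) / ((j + 1 : ℕ) : ℝ) = (1 + 1 / (j : ℝ))⁻¹ := by
      push_cast; field_simp
    rw [h1, inv_pow, show (1 / 2 : ℝ) = 2⁻¹ by norm_num]
    exact inv_anti₀ two_pos (by linarith)
  refine le_of_forall_lt fun b hb => ?_
  obtain ⟨b', hb1, hb2⟩ := exists_between hb
  refine hb1.trans_le ?_
  have hev := hlim.eventually (lt_mem_nhds (show b' < _ by linarith))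
  have hneBot := atTopMultiples_neBot hk0
  refine le_limsup_of_frequently_le (Eventually.frequently ?_)
    (isBoundedUnder_matchingThreshold hk0)
  rw [atTopMultiples_eq_map hk0, eventually_map]
  filter_upwards [hev, eventually_gt_atTop 0] with m hm hm0
  refine hm.le.trans ?_
  have h1 : (0 : ℝ) < ((k * m - 1).choose (k - 1) : ℝ) := by
    have : k ≤ k * m := Nat.le_mul_of_pos_right _ hm0
    exact_mod_cast Nat.choose_pos (by omega)
  have h2 : ((k * m - 1).choose (k - 1) : ℝ) ≤
      matchingThreshold k (k * m) + ((k * m - (m - 1)).choose (k - 1) : ℝ) := by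
    exact_mod_cast choose_sub_choose_le_matchingThreshold hk0 hm0
  rw [le_div_iff₀ h1, sub_mul, div_mul_cancel₀ _ h1.ne']
  linarith

/-! ### Sets with prescribed intersections with the classes of a partition. -/

section Types

variable {V ι : Type*} [Fintype V] [Fintype ι] [DecidableEq ι]

/-- The sets of vertices that meet the class `φ ⁻¹ j` in exactly `t j` vertices, for all `j`. -/
def setsOfType (φ : V → ι) (t : ι → ℕ) : Finset (Finset V) :=
  Finset.univ.filter (fun e => ∀ j, (e.filter (fun v => φ v = j)).card = t j)

theorem mem_setsOfType {φ : V → ι} {t : ι → ℕ} {e : Finset V} :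
    e ∈ setsOfType φ t ↔ ∀ j, (e.filter (fun v => φ v = j)).card = t j := by
  simp [setsOfType]

theorem card_eq_sum_of_mem_setsOfType {φ : V → ι} {t : ι → ℕ} {e : Finset V}
    (he : e ∈ setsOfType φ t) : e.card = ∑ j, t j := by
  rw [Finset.card_eq_sum_card_fiberwise (f := φ) (t := Finset.univ) (fun _ _ => by simp)]
  exact Finset.sum_congr rfl fun j _ => mem_setsOfType.1 he j

theorem card_setsOfType [DecidableEq V] (φ : V → ι) (t : ι → ℕ) :
    (setsOfType φ t).card =
      ∏ j, ((Finset.univ.filter (fun v => φ v = j)).card).choose (t j) := by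
  have hfil : ∀ s ∈ Fintype.piFinset
      (fun j => (Finset.univ.filter (fun v => φ v = j)).powersetCard (t j)), ∀ j,
      (Finset.univ.biUnion s).filter (fun v => φ v = j) = s j := by
    intro s hs j
    have h1 : ∀ i, ∀ v ∈ s i, φ v = i := fun i v hv =>
      (Finset.mem_filter.1 ((Finset.mem_powersetCard.1 (Fintype.mem_piFinset.1 hs i)).1 hv)).2
    ext v
    simp only [Finset.mem_filter, Finset.mem_biUnion, Finset.mem_univ, true_and]
    constructor
    · rintro ⟨⟨i, hi⟩, hv⟩
      rwa [← hv, h1 i v hi]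
    · exact fun hv => ⟨⟨j, hv⟩, h1 j v hv⟩
  simp_rw [← Finset.card_powersetCard, ← Fintype.card_piFinset]
  refine Finset.card_nbij' (fun e j => e.filter (fun v => φ v = j))
    (fun s => Finset.univ.biUnion s) ?_ ?_ ?_ ?_
  · intro e he
    refine Finset.mem_coe.2 (Fintype.mem_piFinset.2 fun j => Finset.mem_powersetCard.2
      ⟨Finset.filter_subset_filter _ (Finset.subset_univ _), mem_setsOfType.1 he j⟩)
  · intro s hs
    refine Finset.mem_coe.2 (mem_setsOfType.2 fun j => ?_)
    rw [hfil s hs j]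
    exact (Finset.mem_powersetCard.1 (Fintype.mem_piFinset.1 hs j)).2
  · intro e he
    ext v
    simp
  · intro s hs
    funext j
    exact hfil s hs j

end Types

theorem KGraph.degree_le_degree_of_map {V W : Type*} [DecidableEq V] [DecidableEq W] {k : ℕ}
    (H : KGraph V k) (G : KGraph W k) (ι : V ↪ W) (h : ∀ e ∈ H.edges, e.map ι ∈ G.edges) (v : V) :
    H.degree v ≤ G.degree (ι v) := by
  refine Finset.card_le_card_of_injOn (fun e => e.map ι) ?_ ?_
  · intro e he
    simp only [Finset.coe_filter, Set.mem_ofPred_eq] at he ⊢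
    exact ⟨h e he.1, by simpa using he.2⟩
  · exact fun e _ f _ hef => Finset.map_injective ι hef

/-- The vector `a + δ_i`. -/
def bump {r : ℕ} (a : Fin r → ℕ) (i : Fin r) : Fin r → ℕ :=
  fun j => if j = i then a j + 1 else a j

theorem sum_bump {r : ℕ} (a : Fin r → ℕ) (i : Fin r) : ∑ j, bump a i j = ∑ j, a j + 1 := by
  have : ∀ j, bump a i j = a j + if j = i then 1 else 0 := by
    intro j; unfold bump; split_ifs <;> rfl
  simp [this, Finset.sum_add_distrib]

theorem bump_injective {r : ℕ} (a : Fin r → ℕ) : Function.Injective (bump a) := by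
  intro i j h
  have := congrFun h i
  unfold bump at this
  by_contra hij
  simp [hij] at this

/-! ### The graphs $H(n,\mathbf a)$ and the threshold $g_r(k)$. -/

section Extremal

variable {r k : ℕ} {a : Fin r → ℕ}

theorem mem_extremalGraph_edges {n : ℕ} (hk : 0 < k) (ha : ∑ i, a i = k - 1)
    {e : Finset (extremalVertex r k n a)} :
    e ∈ (extremalGraph r k n a).edges ↔
      ∃ i, e ∈ setsOfType (fun v : extremalVertex r k n a => v.1) (bump a i) := by
  have h : e ∈ (extremalGraph r k n a).edges ↔ e.card = k ∧
      ∃ i, e ∈ setsOfType (fun v : extremalVertex r k n a => v.1) (bump a i) := by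
    unfold extremalGraph
    rw [Finset.mem_filter, and_iff_right (Finset.mem_univ _)]
    simp only [mem_setsOfType]
    rfl
  rw [h, and_iff_right_iff_imp]
  rintro ⟨i, hi⟩
  rw [card_eq_sum_of_mem_setsOfType hi, sum_bump]
  omega

theorem card_extremalVertex_class {n : ℕ} (i : Fin r) :
    (Finset.univ.filter (fun v : extremalVertex r k n a => v.1 = i)).card =
      (r * a i + 1) * (n / (r * k)) := by
  rw [← Fintype.card_subtype, Fintype.card_congr (Equiv.sigmaSubtype i), Fintype.card_fin]

theorem card_extremalVertex_class_mul {q : ℕ} (hr : 0 < r) (hk : 0 < k) (i : Fin r) :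
    (Finset.univ.filter (fun v : extremalVertex r k (r * k * q) a => v.1 = i)).card =
      (r * a i + 1) * q := by
  rw [card_extremalVertex_class, Nat.mul_div_cancel_left _ (by positivity)]

theorem map_mem_setsOfType {V W ι : Type*} [Fintype V] [DecidableEq V] [Fintype W] [DecidableEq W]
    [Fintype ι] [DecidableEq ι] {φ : V → ι} {ψ : W → ι} {t : ι → ℕ} (f : V ↪ W)
    (hf : ∀ v, ψ (f v) = φ v) {e : Finset V} (he : e ∈ setsOfType φ t) :
    e.map f ∈ setsOfType ψ t := by
  refine mem_setsOfType.2 fun j => ?_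
  rw [Finset.filter_map, Finset.card_map, ← mem_setsOfType.1 he j]
  simp [hf]

/-- A graph with edge types `a + δ_i` whose non-empty classes are at most as large as those of
`H(n, a)` has at most the minimum degree of `H(n, a)`. -/
theorem KGraph.minDegree_le_minDegree_extremalGraph {V : Type*} [Fintype V] [DecidableEq V]
    (H : KGraph V k) (φ : V → Fin r) {q : ℕ} (hr : 0 < r) (hk : 0 < k) (hq : 0 < q)
    (ha : ∑ i, a i = k - 1) (hH : ∀ e ∈ H.edges, ∃ i, e ∈ setsOfType φ (bump a i))
    (hpos : ∀ j, ∃ v, φ v = j)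
    (hle : ∀ j, (Finset.univ.filter (fun v => φ v = j)).card ≤ (r * a j + 1) * q) :
    H.minDegree ≤ (extremalGraph r k (r * k * q) a).minDegree := by
  have hq' : r * k * q / (r * k) = q := Nat.mul_div_cancel_left _ (by positivity)
  have hne : Nonempty (extremalVertex r k (r * k * q) a) :=
    ⟨⟨⟨0, hr⟩, ⟨0, by rw [hq']; positivity⟩⟩⟩
  obtain ⟨u, hu⟩ := (extremalGraph r k (r * k * q) a).exists_degree_eq_minDegree
  rw [← hu]
  have hemb : ∀ j, Nonempty ({v // φ v = j} ↪ Fin ((r * a j + 1) * (r * k * q / (r * k)))) := by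
    intro j
    refine Function.Embedding.nonempty_of_card_le ?_
    rw [Fintype.card_fin, hq', Fintype.card_subtype]
    exact hle j
  let f := fun j => (hemb j).some
  let ι : V ↪ extremalVertex r k (r * k * q) a :=
    ⟨fun v => ⟨φ v, f (φ v) ⟨v, rfl⟩⟩, by
      intro v w h
      have h1 : φ v = φ w := congrArg Sigma.fst h
      have key : ∀ j (hv : φ v = j) (hw : φ w = j), f j ⟨v, hv⟩ = f j ⟨w, hw⟩ → v = w := by
        intro j hv hw h
        simpa using (f j).injective h
      refine key (φ w) h1 rfl ?_
      have key2 : ∀ j (hv : φ v = j),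
          (⟨φ v, f (φ v) ⟨v, rfl⟩⟩ : extremalVertex r k (r * k * q) a) = ⟨j, f j ⟨v, hv⟩⟩ := by
        rintro _ rfl; rfl
      have h2 := h
      simp only [key2 (φ w) h1] at h2
      simpa using h2⟩
  obtain ⟨v, hv⟩ := hpos u.1
  -- The vertex `u` attains the minimum degree. A swap inside its class makes the embedding hit it,
  -- so the degree of `v` bounds the degree of `u` from below.
  let σ : Equiv.Perm (extremalVertex r k (r * k * q) a) := Equiv.swap (ι v) u
  have hσ : ∀ w, (σ w).1 = w.1 := by
    intro w
    have h0 : (ι v).1 = u.1 := hv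
    by_cases h1 : w = ι v
    · subst h1; rw [show σ (ι v) = u from Equiv.swap_apply_left _ _, h0]
    · by_cases h2 : w = u
      · subst h2; rw [show σ w = ι v from Equiv.swap_apply_right _ _, h0]
      · rw [show σ w = w from Equiv.swap_apply_of_ne_of_ne h1 h2]
  have hv' : (ι.trans σ.toEmbedding) v = u := Equiv.swap_apply_left _ _
  refine (H.minDegree_le_degree v).trans ?_
  rw [← hv']
  refine H.degree_le_degree_of_map _ _ ?_ v
  intro e he
  obtain ⟨i, hi⟩ := hH e he
  exact (mem_extremalGraph_edges hk ha).2 ⟨i, map_mem_setsOfType _ (fun w => hσ (ι w)) hi⟩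

/-- Swapping two vertices of one class is an automorphism. -/
theorem extremalGraph_degree_le_degree {n : ℕ} (hk : 0 < k) (ha : ∑ i, a i = k - 1)
    {u v : extremalVertex r k n a} (huv : u.1 = v.1) :
    (extremalGraph r k n a).degree u ≤ (extremalGraph r k n a).degree v := by
  have hσ : ∀ w, (Equiv.swap u v w).1 = w.1 := by
    intro w
    by_cases h1 : w = u
    · rw [h1, Equiv.swap_apply_left, huv]
    · by_cases h2 : w = v
      · rw [h2, Equiv.swap_apply_right, huv]
      · rw [Equiv.swap_apply_of_ne_of_ne h1 h2]
  have h := KGraph.degree_le_degree_of_map (extremalGraph r k n a) (extremalGraph r k n a)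
    (Equiv.swap u v).toEmbedding (fun e he => by
      obtain ⟨i, hi⟩ := (mem_extremalGraph_edges hk ha).1 he
      exact (mem_extremalGraph_edges hk ha).2 ⟨i, map_mem_setsOfType _ hσ hi⟩) u
  simpa using h

/-- Double counting of incidences between edges and the class of `u`, with the edges sorted by type.
It gives the explicit degrees from which the limit is computed. -/
theorem class_mul_degree_extremalGraph {q : ℕ} (hr : 0 < r) (hk : 0 < k)
    (ha : ∑ i, a i = k - 1) (u : extremalVertex r k (r * k * q) a) :
    (r * a u.1 + 1) * q * (extremalGraph r k (r * k * q) a).degree u =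
      ∑ j, bump a j u.1 * ∏ l, ((r * a l + 1) * q).choose (bump a j l) := by
  set G := extremalGraph r k (r * k * q) a
  have hedges : G.edges = Finset.univ.biUnion (fun j =>
      setsOfType (fun v : extremalVertex r k (r * k * q) a => v.1) (bump a j)) := by
    ext e
    rw [mem_extremalGraph_edges hk ha]
    simp
  calc (r * a u.1 + 1) * q * G.degree u
      = ∑ v ∈ Finset.univ.filter (fun v : extremalVertex r k (r * k * q) a => v.1 = u.1),
          G.degree v := by
        rw [Finset.sum_congr rfl (g := fun _ => G.degree u), Finset.sum_const,
          card_extremalVertex_class_mul hr hk, smul_eq_mul]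
        intro v hv
        have hv' := (Finset.mem_filter.1 hv).2
        exact le_antisymm (extremalGraph_degree_le_degree hk ha hv')
          (extremalGraph_degree_le_degree hk ha hv'.symm)
    _ = ∑ e ∈ G.edges, (e.filter (fun v => v.1 = u.1)).card := by
        have := Finset.sum_card_bipartiteAbove_eq_sum_card_bipartiteBelow
          (s := Finset.univ.filter (fun v : extremalVertex r k (r * k * q) a => v.1 = u.1))
          (t := G.edges) (fun v e => v ∈ e)
        simp only [Finset.bipartiteAbove, Finset.bipartiteBelow] at this
        refine this.trans (Finset.sum_congr rfl fun e _ => congrArg _ ?_)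
        ext v
        simp [and_comm]
    _ = ∑ j, ∑ e ∈ setsOfType (fun v : extremalVertex r k (r * k * q) a => v.1) (bump a j),
          (e.filter (fun v => v.1 = u.1)).card := by
        rw [hedges, Finset.sum_biUnion]
        intro i _ j _ hij
        rw [Function.onFun, Finset.disjoint_left]
        intro e hi hj
        refine hij (bump_injective a (funext fun l => ?_))
        rw [← mem_setsOfType.1 hi l, ← mem_setsOfType.1 hj l]
    _ = _ := by
        refine Finset.sum_congr rfl fun j _ => ?_
        rw [Finset.sum_congr rfl (g := fun _ => bump a j u.1)
          (fun e he => mem_setsOfType.1 he u.1), Finset.sum_const, card_setsOfType, smul_eq_mul,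
          mul_comm]
        congr 1
        refine Finset.prod_congr rfl fun l _ => ?_
        rw [card_extremalVertex_class_mul hr hk]

/-- Without convergence the `limUnder` in `extremalThreshold` would be an arbitrary value. The
degree in each class is of order $q^{k-1}$ with an explicit limit, and a minimum over finitely many
classes preserves convergence. -/
theorem exists_tendsto_minDegree_extremalGraph (hr : 0 < r) (hk : 0 < k)
    (ha : ∑ i, a i = k - 1) :
    ∃ L : ℝ, Tendsto (fun q : ℕ => ((extremalGraph r k (r * k * q) a).minDegree : ℝ) /
      ((r * k * q - 1).choose (k - 1) : ℝ)) atTop (𝓝 L) := by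
  have hne : (Finset.univ : Finset (Fin r)).Nonempty := ⟨⟨0, hr⟩, Finset.mem_univ _⟩
  -- The degree of the vertices in class `i`, once `q` is positive.
  set D : Fin r → ℕ → ℝ := fun i q =>
    (∑ j, (bump a j i : ℝ) * ∏ l, (((r * a l + 1) * q).choose (bump a j l) : ℝ)) /
      ((r * a i + 1 : ℕ) * q) with hD
  have hDlim : ∀ i, ∃ L : ℝ, Tendsto (fun q : ℕ => D i q / (q : ℝ) ^ (k - 1)) atTop (𝓝 L) := by
    intro i
    refine ⟨(∑ j, (bump a j i : ℝ) * ∏ l, (((r * a l + 1 : ℕ) : ℝ) ^ (bump a j l) /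
      ((bump a j l).factorial : ℝ))) / (r * a i + 1 : ℕ), ?_⟩
    have h : Tendsto (fun q : ℕ => (∑ j, (bump a j i : ℝ) *
        ∏ l, ((((r * a l + 1) * q).choose (bump a j l) : ℝ) / (q : ℝ) ^ (bump a j l))) /
        (r * a i + 1 : ℕ)) atTop (𝓝 ((∑ j, (bump a j i : ℝ) *
          ∏ l, (((r * a l + 1 : ℕ) : ℝ) ^ (bump a j l) /
            ((bump a j l).factorial : ℝ))) / (r * a i + 1 : ℕ))) := by
      refine Tendsto.div_const (tendsto_finsetSum _ fun j _ => Tendsto.const_mul _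
        (tendsto_finsetProd _ fun l _ => ?_)) _
      simpa using tendsto_choose_mul_sub_div_pow (Nat.succ_pos (r * a l)) 0 (bump a j l)
    refine h.congr' ?_
    filter_upwards [eventually_gt_atTop 0] with q hq
    have hq0 : (q : ℝ) ≠ 0 := by exact_mod_cast hq.ne'
    have hk1 : (q : ℝ) ^ k = q ^ (k - 1) * q := by rw [← pow_succ]; congr 1; omega
    have hprod : ∀ j, ∏ l, ((((r * a l + 1) * q).choose (bump a j l) : ℝ) /
        (q : ℝ) ^ (bump a j l)) =
        (∏ l, (((r * a l + 1) * q).choose (bump a j l) : ℝ)) / (q : ℝ) ^ k := by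
      intro j
      rw [Finset.prod_div_distrib, Finset.prod_pow_eq_pow_sum, sum_bump, ha,
        Nat.sub_add_cancel hk]
    simp only [hD, hprod, hk1, ← mul_div_assoc, ← Finset.sum_div]
    field_simp
  choose L hL using hDlim
  have hmin : ∀ᶠ q : ℕ in atTop, ((extremalGraph r k (r * k * q) a).minDegree : ℝ) =
      Finset.univ.inf' hne (fun i => D i q) := by
    filter_upwards [eventually_gt_atTop 0] with q hq
    have hq' : r * k * q / (r * k) = q := Nat.mul_div_cancel_left _ (by positivity)
    have hdeg : ∀ u : extremalVertex r k (r * k * q) a,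
        ((extremalGraph r k (r * k * q) a).degree u : ℝ) = D u.1 q := by
      intro u
      have h := class_mul_degree_extremalGraph hr hk ha u
      have hq0 : (0 : ℝ) < q := by exact_mod_cast hq
      rw [hD, eq_div_iff (by positivity), mul_comm]
      exact_mod_cast h
    have hvert : ∀ i : Fin r, ∃ u : extremalVertex r k (r * k * q) a, u.1 = i :=
      fun i => ⟨⟨i, ⟨0, by rw [hq']; positivity⟩⟩, rfl⟩
    have : Nonempty (extremalVertex r k (r * k * q) a) := ⟨(hvert ⟨0, hr⟩).choose⟩
    obtain ⟨u, hu⟩ := (extremalGraph r k (r * k * q) a).exists_degree_eq_minDegree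
    refine le_antisymm (Finset.le_inf' _ _ fun i _ => ?_) ?_
    · obtain ⟨v, rfl⟩ := hvert i
      rw [← hdeg]
      exact_mod_cast KGraph.minDegree_le_degree _ v
    · rw [← hu, hdeg]
      exact Finset.inf'_le _ (Finset.mem_univ _)
  have h1 : Tendsto (fun q : ℕ => Finset.univ.inf' hne (fun i => D i q / (q : ℝ) ^ (k - 1))) atTop
      (𝓝 (Finset.univ.inf' hne L)) :=
    Tendsto.finset_inf'_nhds_apply hne fun i _ => hL i
  have hf : (0 : ℝ) < (k - 1).factorial := by exact_mod_cast (k - 1).factorial_pos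
  have hrk : 0 < r * k := by positivity
  have h2 := h1.div (tendsto_choose_mul_sub_div_pow hrk 1 (k - 1)) (by positivity)
  refine ⟨_, h2.congr' ?_⟩
  filter_upwards [hmin, eventually_gt_atTop 0] with q hq hq0
  have hq1 : (0 : ℝ) < (q : ℝ) ^ (k - 1) := by
    have : (0 : ℝ) < q := by exact_mod_cast hq0
    positivity
  rw [hq]
  have h3 : Finset.univ.inf' hne (fun i => D i q / (q : ℝ) ^ (k - 1)) =
      Finset.univ.inf' hne (fun i => D i q) / (q : ℝ) ^ (k - 1) := by
    refine le_antisymm ?_ (Finset.le_inf' _ _ fun i hi =>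
      div_le_div_of_nonneg_right (Finset.inf'_le _ hi) hq1.le)
    rw [le_div_iff₀ hq1]
    refine Finset.le_inf' _ _ fun i hi => ?_
    rw [← le_div_iff₀ hq1]
    exact Finset.inf'_le (fun i => D i q / (q : ℝ) ^ (k - 1)) hi
  rw [Pi.div_apply, h3, div_div_div_cancel_right₀ hq1.ne']

theorem finite_typeVectors (r k : ℕ) : (typeVectors r k).Finite := by
  refine (Set.finite_Iic (fun _ : Fin r => k - 1)).subset fun a ha i => ?_
  rw [← ha.1]
  exact Finset.single_le_sum (fun _ _ => Nat.zero_le _) (Finset.mem_univ i)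

/-- Up to `ε`, the graphs `H(n, a)` with large `n` have relative minimum degree at most `g_r(k)`. -/
theorem exists_forall_minDegree_extremalGraph_le (hr : 0 < r) (hk : 0 < k) {ε : ℝ} (hε : 0 < ε) :
    ∃ Q : ℕ, ∀ q, Q ≤ q → ∀ a ∈ typeVectors r k,
      ((extremalGraph r k (r * k * q) a).minDegree : ℝ) ≤
        (extremalThreshold r k + ε) * ((r * k * q - 1).choose (k - 1) : ℝ) := by
  have hrk : 0 < r * k := by positivity
  have : Finite (typeVectors r k) := finite_typeVectors r k
  have := atTopMultiples_neBot hrk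
  have hev : ∀ a : typeVectors r k, ∀ᶠ q : ℕ in atTop,
      ((extremalGraph r k (r * k * q) a.1).minDegree : ℝ) ≤
        (extremalThreshold r k + ε) * ((r * k * q - 1).choose (k - 1) : ℝ) := by
    intro a
    obtain ⟨L, hL⟩ := exists_tendsto_minDegree_extremalGraph hr hk a.2.1
    have hL' : Tendsto (fun n : ℕ => ((extremalGraph r k n a.1).minDegree : ℝ) /
        ((n - 1).choose (k - 1) : ℝ)) (atTopMultiples (r * k)) (𝓝 L) := by
      rw [atTopMultiples_eq_map hrk, tendsto_map'_iff]
      exact hL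
    have hle : L ≤ extremalThreshold r k := by
      rw [← hL'.limUnder_eq]
      exact le_ciSup (f := fun a : typeVectors r k => limUnder (atTopMultiples (r * k))
        (fun n : ℕ => ((extremalGraph r k n a.1).minDegree : ℝ) /
          ((n - 1).choose (k - 1) : ℝ))) (Set.finite_range _).bddAbove a
    filter_upwards [hL.eventually (gt_mem_nhds (show L < extremalThreshold r k + ε by linarith)),
      eventually_gt_atTop 0] with q hq hq0
    have : k ≤ r * k * q :=
      (Nat.le_mul_of_pos_left _ hr).trans (Nat.le_mul_of_pos_right _ hq0)
    rw [div_lt_iff₀ (by exact_mod_cast Nat.choose_pos (by omega))] at hq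
    exact hq.le
  obtain ⟨Q, hQ⟩ := eventually_atTop.1 (eventually_all.2 hev)
  exact ⟨Q, fun q hq a ha => hQ q hq ⟨a, ha⟩⟩

/-- A graph all of whose edges have one of the types `a + δ_i`, with classes not much larger than
those of `H(n, a)`, has relative minimum degree at most about `g_r(k)`. -/
theorem exists_forall_minDegree_le_of_types (hr : 0 < r) (hk : 0 < k) {ε : ℝ} (hε : 0 < ε) :
    ∃ Q : ℕ, ∀ q, Q ≤ q → ∀ (V : Type*) [Fintype V] [DecidableEq V] (H : KGraph V k)
      (φ : V → Fin r) (a : Fin r → ℕ), ∑ i, a i = k - 1 →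
      (∀ e ∈ H.edges, ∃ i, e ∈ setsOfType φ (bump a i)) → (∀ j, ∃ v, φ v = j) →
      (∀ j, (Finset.univ.filter (fun v => φ v = j)).card ≤ (r * a j + 1) * q) →
      (H.minDegree : ℝ) ≤
        (extremalThreshold r k + ε) * ((r * k * q - 1).choose (k - 1) : ℝ) := by
  obtain ⟨Q, hQ⟩ := exists_forall_minDegree_extremalGraph_le hr hk hε
  refine ⟨max Q 1, fun q hq V _ _ H φ a ha hH hpos hle => ?_⟩
  -- `typeVectors` admits only non-decreasing vectors, so the classes are relabelled by a sorting
  -- permutation.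
  set σ := Tuple.sort a
  have hsum : ∑ i, (a ∘ σ) i = k - 1 := by rw [← ha]; exact Equiv.sum_comp σ a
  refine le_trans ?_ (hQ q (by omega) (a ∘ σ) ⟨hsum, Tuple.monotone_sort a⟩)
  have hcls : ∀ (e : Finset V) j, e.filter (fun v => (σ.symm ∘ φ) v = j) =
      e.filter (fun v => φ v = σ j) := by
    intro e j
    refine Finset.filter_congr fun v _ => ?_
    simp [Equiv.symm_apply_eq]
  refine Nat.cast_le.2 (H.minDegree_le_minDegree_extremalGraph (σ.symm ∘ φ) hr hk (by omega) hsum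
    ?_ ?_ ?_)
  · intro e he
    obtain ⟨i, hi⟩ := hH e he
    refine ⟨σ.symm i, mem_setsOfType.2 fun j => ?_⟩
    rw [hcls, mem_setsOfType.1 hi]
    simp [bump, Equiv.eq_symm_apply]
  · intro j
    obtain ⟨v, hv⟩ := hpos (σ j)
    exact ⟨v, by simp [hv]⟩
  · intro j
    rw [hcls]
    exact hle _

/-- Any $(k-1)$-subset of the large class forms an edge with any further vertex. Needed for three
classes with edge types $A-\delta_c$ and some $A_i=1$. -/
theorem choose_le_minDegree_extremalGraph_three {q : ℕ} (hk : 2 ≤ k) (hq : 0 < q) :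
    ((3 * (k - 1) + 1) * q).choose (k - 1) ≤
      (extremalGraph 3 k (3 * k * q) ![0, 0, k - 1]).minDegree := by
  have hq' : 3 * k * q / (3 * k) = q := Nat.mul_div_cancel_left _ (by positivity)
  have ha : ∑ i, (![0, 0, k - 1] : Fin 3 → ℕ) i = k - 1 := by simp [Fin.sum_univ_three]
  set G := extremalGraph 3 k (3 * k * q) ![0, 0, k - 1] with hG
  let w : extremalVertex 3 k (3 * k * q) ![0, 0, k - 1] := ⟨0, ⟨0, by rw [hq']; positivity⟩⟩
  have : Nonempty (extremalVertex 3 k (3 * k * q) ![0, 0, k - 1]) := ⟨w⟩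
  refine G.le_minDegree fun u => ?_
  set A := Finset.univ.filter
    (fun v : extremalVertex 3 k (3 * k * q) ![0, 0, k - 1] => v.1 = 2) with hA
  have hAc : A.card = (3 * (k - 1) + 1) * q := by
    rw [hA, card_extremalVertex_class_mul (by norm_num) (by omega)]; simp
  rw [← hAc, ← Finset.card_powersetCard]
  have hedge : ∀ S ∈ A.powersetCard (k - 1), ∀ x, x ∉ S → insert x S ∈ G.edges := by
    intro S hS x hx
    obtain ⟨h1, h2⟩ := Finset.mem_powersetCard.1 hS
    refine (mem_extremalGraph_edges (by omega) ha).2 ⟨x.1, mem_setsOfType.2 fun j => ?_⟩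
    have hS2 : (S.filter (fun v => v.1 = j)).card = (![0, 0, k - 1] : Fin 3 → ℕ) j := by
      by_cases hj : j = 2
      · subst hj
        rw [Finset.filter_true_of_mem fun v hv => (Finset.mem_filter.1 (h1 hv)).2, h2]
        simp
      · rw [Finset.filter_false_of_mem fun v hv h => hj (by
          rw [← h]; exact (Finset.mem_filter.1 (h1 hv)).2)]
        fin_cases j <;> simp at hj ⊢
    rw [Finset.filter_insert]
    unfold bump
    by_cases hj : x.1 = j
    · rw [if_pos hj, if_pos hj.symm, Finset.card_insert_of_notMem (by simp [hx]), hS2]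
    · rw [if_neg hj, if_neg (Ne.symm hj), hS2]
  have hw : w ∉ A := by simp [hA, w]
  -- If `S` already contains `u`, it is completed by the fixed vertex `w` outside the large class;
  -- the presence of `w` keeps the map injective.
  refine Finset.card_le_card_of_injOn (fun S => if u ∈ S then insert w S else insert u S) ?_ ?_
  · intro S hS
    have hwS : w ∉ S := fun h => hw ((Finset.mem_powersetCard.1 hS).1 h)
    simp only [Finset.coe_filter, Set.mem_ofPred_eq]
    split_ifs with h
    · exact ⟨hedge S hS w hwS, Finset.mem_insert_of_mem h⟩
    · exact ⟨hedge S hS u h, Finset.mem_insert_self _ _⟩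
  · intro S hS T hT h
    have hwS : w ∉ S := fun h => hw ((Finset.mem_powersetCard.1 hS).1 h)
    have hwT : w ∉ T := fun h => hw ((Finset.mem_powersetCard.1 hT).1 h)
    simp only at h
    split_ifs at h with h1 h2 h2
    · rw [← Finset.erase_insert hwS, h, Finset.erase_insert hwT]
    · have : w = u ∨ w ∈ T := Finset.mem_insert.1 (h ▸ Finset.mem_insert_self w S)
      rcases this with h3 | h3
      · exact absurd (h3 ▸ h1) hwS
      · exact absurd h3 hwT
    · have : w = u ∨ w ∈ S := Finset.mem_insert.1 (h ▸ Finset.mem_insert_self w T)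
      rcases this with h3 | h3
      · exact absurd (h3 ▸ h2) hwT
      · exact absurd h3 hwS
    · rw [← Finset.erase_insert h1, h, Finset.erase_insert h2]

end Extremal

/-! ### Integer vectors that differ pairwise by differences of unit vectors. -/

section Cliques

variable {r : ℕ}

/-- The unit vector `δ_i` of `ℤ^r`. -/
def unitVec (i : Fin r) : Fin r → ℤ := Pi.single i 1

theorem unitVec_apply (i j : Fin r) : unitVec i j = if j = i then 1 else 0 := by
  simp [unitVec, Pi.single_apply]

/-- Otherwise nothing cancels in $\delta_p+\delta_j-\delta_q-\delta_i$, which has $\ell^1$-norm 4,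
while the right-hand side has norm at most 2. -/
theorem eq_or_eq_of_sub_unitVec {i j p q s t : Fin r} (hij : i ≠ j)
    (h : unitVec p - unitVec q - (unitVec i - unitVec j) = unitVec s - unitVec t) :
    p = i ∨ q = j ∨ p = q := by
  by_contra hcon
  push Not at hcon
  obtain ⟨h1, h2, h3⟩ := hcon
  have hi := congrFun h i
  have hj := congrFun h j
  have hp := congrFun h p
  have hq := congrFun h q
  simp only [Pi.sub_apply, unitVec_apply, if_true] at hi hj hp hq
  grind

/-- Again the left-hand side, $\delta_i+\delta_j-\delta_l-\delta_m$, has norm 4. -/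
theorem not_sub_unitVec {i j l m s t : Fin r} (hij : i ≠ j) (hl : l ≠ i) (hl' : l ≠ j)
    (hm : m ≠ i) (hm' : m ≠ j) :
    unitVec i - unitVec l - (unitVec m - unitVec j) ≠ unitVec s - unitVec t := by
  intro h
  have hi := congrFun h i
  have hj := congrFun h j
  simp only [Pi.sub_apply, unitVec_apply, if_true] at hi hj
  grind

/-- Vectors whose pairwise differences are differences of two unit vectors are all of the form
`u + δ_i`, or all of the form `u - δ_i`. -/
theorem exists_unitVec_of_sub {X : Type*} (hr : 0 < r) (w : X → Fin r → ℤ)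
    (h : ∀ x y, ∃ p q, w x - w y = unitVec p - unitVec q) :
    ∃ (u : Fin r → ℤ) (φ : X → Fin r),
      (∀ x, w x = u + unitVec (φ x)) ∨ (∀ x, w x = u - unitVec (φ x)) := by
  by_cases hall : ∀ x y, w x = w y
  · by_cases hX : Nonempty X
    · obtain ⟨x0⟩ := hX
      refine ⟨w x0 - unitVec ⟨0, hr⟩, fun _ => ⟨0, hr⟩, Or.inl fun x => ?_⟩
      rw [hall x x0]; abel
    · exact ⟨0, fun _ => ⟨0, hr⟩, Or.inl fun x => (hX ⟨x⟩).elim⟩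
  push Not at hall
  obtain ⟨x1, x0, h10⟩ := hall
  obtain ⟨i, j, hij⟩ := h x1 x0
  have hne : i ≠ j := by
    rintro rfl
    exact h10 (sub_eq_zero.1 (by rw [hij, sub_self]))
  -- With $w(x_1)-w(x_0)=\delta_i-\delta_j$ fixed, comparing `x` with both points forces the
  -- difference from `x0` to start at `i` or to end at `j`.
  have hform : ∀ x, (∃ q, w x - w x0 = unitVec i - unitVec q) ∨
      (∃ p, w x - w x0 = unitVec p - unitVec j) := by
    intro x
    obtain ⟨p, q, hpq⟩ := h x x0
    obtain ⟨s, t, hst⟩ := h x x1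
    have h1 : w x - w x1 = unitVec p - unitVec q - (unitVec i - unitVec j) := by
      rw [← hpq, ← hij]; abel
    rcases eq_or_eq_of_sub_unitVec hne (h1 ▸ hst) with rfl | rfl | rfl
    · exact Or.inl ⟨q, hpq⟩
    · exact Or.inr ⟨p, hpq⟩
    · exact Or.inl ⟨i, by rw [hpq, sub_self, sub_self]⟩
  by_cases hm : ∀ x, ∃ q, w x - w x0 = unitVec i - unitVec q
  · choose φ hφ using hm
    refine ⟨w x0 + unitVec i, φ, Or.inr fun x => ?_⟩
    rw [add_sub_assoc, ← hφ x]; abel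
  · push Not at hm
    obtain ⟨y, hy⟩ := hm
    -- The point `y` differs from `x0` by $\delta_m-\delta_j$ with $m\ne i,j$, which excludes every
    -- $\delta_i-\delta_l$ with $l\ne i,j$; the two remaining values of `l` fit the second form as
    -- well.
    have hp : ∀ x, ∃ p, w x - w x0 = unitVec p - unitVec j := by
      intro x
      rcases hform x with ⟨l, hl⟩ | hp
      · by_cases hlj : l = j
        · exact ⟨i, by rw [hl, hlj]⟩
        by_cases hli : l = i
        · exact ⟨j, by rw [hl, hli, sub_self, sub_self]⟩
        obtain ⟨m, hm⟩ := (hform y).resolve_left (fun ⟨q, hq⟩ => hy q hq)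
        have hmi : m ≠ i := by
          rintro rfl; exact hy j hm
        have hmj : m ≠ j := by
          rintro rfl; exact hy i (by rw [hm, sub_self, sub_self])
        obtain ⟨s, t, hst⟩ := h x y
        refine absurd ?_ (not_sub_unitVec (s := s) (t := t) hne hli hlj hmi hmj)
        rw [← hst, ← hl, ← hm]; abel
      · exact hp
    choose φ hφ using hp
    refine ⟨w x0 - unitVec j, φ, Or.inl fun x => ?_⟩
    have := hφ x
    rw [sub_eq_iff_eq_add] at this
    rw [this]; abel

end Cliques

/-! ### Graphs without switches: from colour changes to a vertex partition. -/

namespace KGraph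

variable {V : Type*} {k r : ℕ}

/-- A list of pairwise disjoint edges. -/
def IsMatchingList (H : KGraph V k) (L : List (Finset V)) : Prop :=
  (∀ e ∈ L, e ∈ H.edges) ∧ L.Pairwise Disjoint

theorem isMatchingList_nil (H : KGraph V k) : H.IsMatchingList [] := ⟨by simp, by simp⟩

/-- How often each colour occurs on a list of sets. -/
def listProfile (c : Finset V → Fin r) (L : List (Finset V)) : Fin r → ℤ :=
  (L.map (fun e => unitVec (c e))).sum

@[simp] theorem listProfile_nil (c : Finset V → Fin r) : listProfile c [] = 0 := rfl

@[simp] theorem listProfile_cons (c : Finset V → Fin r) (e : Finset V) (L : List (Finset V)) :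
    listProfile c (e :: L) = unitVec (c e) + listProfile c L := by simp [listProfile]

theorem sum_unitVec_eq (φ : V → Fin r) (e : Finset V) (j : Fin r) :
    (∑ x ∈ e, unitVec (φ x)) j = ((e.filter (fun x => φ x = j)).card : ℤ) := by
  rw [Finset.sum_apply, Finset.card_filter]
  push_cast
  exact Finset.sum_congr rfl fun x _ => by simp only [unitVec_apply, eq_comm]

variable [DecidableEq V]

/-- The vertices covered by a list of sets. -/
def listSupport (L : List (Finset V)) : Finset V := L.foldr (· ∪ ·) ∅

@[simp] theorem listSupport_nil : listSupport ([] : List (Finset V)) = ∅ := rfl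

@[simp] theorem listSupport_cons (e : Finset V) (L : List (Finset V)) :
    listSupport (e :: L) = e ∪ listSupport L := rfl

theorem subset_listSupport {L : List (Finset V)} {e : Finset V} (he : e ∈ L) :
    e ⊆ listSupport L := by
  induction L with
  | nil => simp at he
  | cons f L ih =>
    rcases List.mem_cons.1 he with rfl | h
    · exact Finset.subset_union_left
    · exact (ih h).trans Finset.subset_union_right

theorem IsMatchingList.cons {H : KGraph V k} {L : List (Finset V)} (hL : H.IsMatchingList L)
    {e : Finset V} (he : e ∈ H.edges) (hd : Disjoint e (listSupport L)) :
    H.IsMatchingList (e :: L) :=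
  ⟨List.forall_mem_cons.2 ⟨he, hL.1⟩,
    List.pairwise_cons.2 ⟨fun _ hf => hd.mono_right (subset_listSupport hf), hL.2⟩⟩

/-- Any two matchings with at most `m` edges on the same vertex set have the same colours. -/
def NoSwitch (H : KGraph V k) (c : Finset V → Fin r) (m : ℕ) : Prop :=
  ∀ L L', H.IsMatchingList L → H.IsMatchingList L' → listSupport L = listSupport L' →
    L.length ≤ m → listProfile c L = listProfile c L'

section

variable [Fintype V]

/-- Any two vertices have a common neighbour `(k-1)`-set outside any set of at most `m` vertices. -/
def WellLinked (H : KGraph V k) (m : ℕ) : Prop :=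
  ∀ x y, ∀ F : Finset V, F.card ≤ m → ∃ S, Disjoint S F ∧ S ∈ H.link x ∧ S ∈ H.link y

theorem insert_mem_edges {H : KGraph V k} {x : V} {S : Finset V} (h : S ∈ H.link x) :
    insert x S ∈ H.edges := (mem_link.1 h).2

theorem notMem_of_mem_link {H : KGraph V k} {x : V} {S : Finset V} (h : S ∈ H.link x) : x ∉ S :=
  (mem_link.1 h).1.1

theorem card_of_mem_link {H : KGraph V k} {x : V} {S : Finset V} (h : S ∈ H.link x) :
    S.card = k - 1 := (mem_link.1 h).1.2

variable {H : KGraph V k} {c : Finset V → Fin r} {m : ℕ}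

/-- The matchings $\{x\cup S,\,y\cup T\}$ and $\{y\cup S,\,x\cup T\}$ cover the same vertices. -/
theorem NoSwitch.sub_eq_of_disjoint (hN : H.NoSwitch c m) (hm : 2 ≤ m) {x y : V}
    {S T : Finset V} (hST : Disjoint S T) (hSx : S ∈ H.link x) (hSy : S ∈ H.link y)
    (hTx : T ∈ H.link x) (hTy : T ∈ H.link y) :
    unitVec (c (insert x S)) - unitVec (c (insert y S)) =
      unitVec (c (insert x T)) - unitVec (c (insert y T)) := by
  by_cases hxy : x = y
  · subst hxy; simp
  have n1 := notMem_of_mem_link hSx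
  have n2 := notMem_of_mem_link hSy
  have n3 := notMem_of_mem_link hTx
  have n4 := notMem_of_mem_link hTy
  have := hN [insert x S, insert y T] [insert y S, insert x T]
    (((isMatchingList_nil H).cons (insert_mem_edges hTy) (by simp)).cons (insert_mem_edges hSx)
      (by simp [n2, n3, hST, Ne.symm hxy]))
    (((isMatchingList_nil H).cons (insert_mem_edges hTx) (by simp)).cons (insert_mem_edges hSy)
      (by simp [hxy, n1, n4, hST]))
    (by simp only [listSupport_cons, listSupport_nil, Finset.insert_eq]; ac_rfl)
    (by simpa using hm)
  simp only [listProfile_cons, listProfile_nil, add_zero] at this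
  rw [sub_eq_sub_iff_add_eq_add, this, add_comm]

/-- Overlapping `S` and `T` are compared through a third common link set disjoint from both. -/
theorem NoSwitch.sub_eq (hN : H.NoSwitch c m) (hm : 2 ≤ m) {l : ℕ} (hW : H.WellLinked l)
    (hl : 2 * k ≤ l) {x y : V} {S T : Finset V} (hSx : S ∈ H.link x) (hSy : S ∈ H.link y)
    (hTx : T ∈ H.link x) (hTy : T ∈ H.link y) :
    unitVec (c (insert x S)) - unitVec (c (insert y S)) =
      unitVec (c (insert x T)) - unitVec (c (insert y T)) := by
  obtain ⟨R, hR, hRx, hRy⟩ := hW x y (S ∪ T) (by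
    have h1 := Finset.card_union_le S T
    have h2 := card_of_mem_link hSx
    have h3 := card_of_mem_link hTx
    omega)
  rw [Finset.disjoint_union_right] at hR
  rw [← hN.sub_eq_of_disjoint hm hR.1 hRx hRy hSx hSy,
    ← hN.sub_eq_of_disjoint hm hR.2 hRx hRy hTx hTy]

/-- Choose `S`, `T`, `R` so that $\{x\cup S,\,y\cup T,\,z\cup R\}$ and $\{y\cup S,\,z\cup T,\,x\cup
R\}$ are matchings; they cover the same vertices. -/
theorem NoSwitch.cocycle (hN : H.NoSwitch c m) (hm : 3 ≤ m) {l : ℕ} (hW : H.WellLinked l)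
    (hl : 2 * k ≤ l) (hl' : 1 ≤ l) {x y z : V} (hxy : x ≠ y) (hyz : y ≠ z) (hxz : x ≠ z) :
    ∃ S T R, (S ∈ H.link x ∧ S ∈ H.link y) ∧ (T ∈ H.link y ∧ T ∈ H.link z) ∧
      (R ∈ H.link x ∧ R ∈ H.link z) ∧
      (unitVec (c (insert x S)) - unitVec (c (insert y S))) +
        (unitVec (c (insert y T)) - unitVec (c (insert z T))) =
      unitVec (c (insert x R)) - unitVec (c (insert z R)) := by
  obtain ⟨S, hS, hSx, hSy⟩ := hW x y {z} (by simpa using hl')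
  have hSc := card_of_mem_link hSx
  obtain ⟨T, hT, hTy, hTz⟩ := hW y z (insert x S) (by
    have := Finset.card_insert_le x S
    omega)
  have hTc := card_of_mem_link hTy
  obtain ⟨R, hR, hRx, hRz⟩ := hW x z (insert y (S ∪ T)) (by
    have h1 := Finset.card_insert_le y (S ∪ T)
    have h2 := Finset.card_union_le S T
    by_cases hk : k = 0
    · subst hk
      simp only [zero_le, Nat.sub_eq_zero_of_le] at hSc hTc
      omega
    · omega)
  have n1 := notMem_of_mem_link hSx
  have n2 := notMem_of_mem_link hSy
  have n3 := notMem_of_mem_link hTy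
  have n4 := notMem_of_mem_link hTz
  have n5 := notMem_of_mem_link hRx
  have n6 := notMem_of_mem_link hRz
  simp only [Finset.disjoint_insert_right, Finset.disjoint_union_right,
    Finset.disjoint_singleton_right] at hS hT hR
  refine ⟨S, T, R, ⟨hSx, hSy⟩, ⟨hTy, hTz⟩, ⟨hRx, hRz⟩, ?_⟩
  have := hN [insert x S, insert y T, insert z R] [insert y S, insert z T, insert x R]
    ((((isMatchingList_nil H).cons (insert_mem_edges hRz) (by simp)).cons (insert_mem_edges hTy)
      (by simp [Ne.symm hyz, n4, hR.1, hR.2.2.symm])).cons (insert_mem_edges hSx)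
      (by simp [Ne.symm hxy, Ne.symm hxz, n2, hS, hT.1, hT.2.symm, n5, hR.2.1.symm]))
    ((((isMatchingList_nil H).cons (insert_mem_edges hRx) (by simp)).cons (insert_mem_edges hTz)
      (by simp [hxz, hT.1, n6, hR.2.2.symm])).cons (insert_mem_edges hSy)
      (by simp [hxy, Ne.symm hyz, n1, n3, hS, hT.2.symm, hR.1, hR.2.1.symm]))
    (by simp only [listSupport_cons, listSupport_nil, Finset.insert_eq]; ac_rfl)
    (by simpa using hm)
  simp only [listProfile_cons, listProfile_nil, add_zero] at this
  have h' : unitVec (c (insert x S)) + unitVec (c (insert y T)) + unitVec (c (insert z R)) =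
    unitVec (c (insert y S)) + unitVec (c (insert z T)) + unitVec (c (insert x R)) := by
    rw [add_assoc, this, add_assoc]
  funext i
  have := congrFun h' i
  simp only [Pi.add_apply, Pi.sub_apply] at this ⊢
  linarith

/-- The colour change caused by exchanging two vertices is the difference of a potential. -/
theorem NoSwitch.exists_potential (hN : H.NoSwitch c m) (hm : 3 ≤ m) {l : ℕ}
    (hW : H.WellLinked l) (hl : 2 * k ≤ l) (hl' : 1 ≤ l) :
    ∃ w : V → Fin r → ℤ, ∀ x y S, S ∈ H.link x → S ∈ H.link y →
      unitVec (c (insert x S)) - unitVec (c (insert y S)) = w x - w y := by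
  by_cases hV : Nonempty V
  swap
  · exact ⟨fun _ _ => 0, fun x => (hV ⟨x⟩).elim⟩
  obtain ⟨x0⟩ := hV
  choose S0 _ hS0x hS0y using fun x => hW x x0 ∅ (by simp)
  -- The potential of `x` is the colour change of an exchange with a base vertex `x0`; additivity
  -- does the rest.
  refine ⟨fun x => unitVec (c (insert x (S0 x))) - unitVec (c (insert x0 (S0 x))), ?_⟩
  intro x y S hSx hSy
  by_cases hxy : x = y
  · subst hxy; simp
  by_cases hx : x = x0
  · subst hx
    have := hN.sub_eq (by omega) hW hl (hS0x y) (hS0y y) hSy hSx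
    dsimp only
    rw [this]; abel
  by_cases hy : y = x0
  · subst hy
    have := hN.sub_eq (by omega) hW hl (hS0x x) (hS0y x) hSx hSy
    dsimp only
    rw [this]; abel
  obtain ⟨A, B, R, ⟨hA1, hA2⟩, ⟨hB1, hB2⟩, ⟨hR1, hR2⟩, h⟩ :=
    hN.cocycle hm hW hl hl' hxy hy hx
  dsimp only
  rw [hN.sub_eq (by omega) hW hl (hS0x x) (hS0y x) hR1 hR2,
    hN.sub_eq (by omega) hW hl (hS0x y) (hS0y y) hB1 hB2,
    hN.sub_eq (by omega) hW hl hSx hSy hA1 hA2, ← h]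
  abel

/-- Pair the two lists entry by entry and give each pair a fresh common link set; `R` is the union
of these sets. Each pair adds $k+1$ vertices to the forbidden set, which the allowance of $k+3$ per
pair covers. -/
theorem WellLinked.exists_transport {w : V → Fin r → ℤ} {l : ℕ} (hW : H.WellLinked l)
    (hk : 0 < k)
    (hw : ∀ x y S, S ∈ H.link x → S ∈ H.link y →
      unitVec (c (insert x S)) - unitVec (c (insert y S)) = w x - w y) :
    ∀ (xs ys : List V) (F : Finset V), xs.length = ys.length → (xs ++ ys).Nodup →
      F.card + (k + 3) * xs.length ≤ l →
      ∃ L L' R, H.IsMatchingList L ∧ H.IsMatchingList L' ∧ L.length = xs.length ∧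
        L'.length = xs.length ∧ listSupport L = xs.toFinset ∪ R ∧
        listSupport L' = ys.toFinset ∪ R ∧ Disjoint R (xs.toFinset ∪ ys.toFinset ∪ F) ∧
        listProfile c L - listProfile c L' = (xs.map w).sum - (ys.map w).sum := by
  intro xs
  induction xs with
  | nil =>
    intro ys F hlen _ _
    obtain rfl : ys = [] := List.length_eq_zero_iff.1 hlen.symm
    exact ⟨[], [], ∅, isMatchingList_nil H, isMatchingList_nil H, rfl, rfl, by simp, by simp,
      by simp, by simp⟩
  | cons x xs ih =>
    intro ys F hlen hnd hF
    cases ys with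
    | nil => simp at hlen
    | cons y ys =>
      have hlen' : xs.length = ys.length := by simpa using hlen
      have hnd' : (xs ++ ys).Nodup ∧ x ∉ xs ∧ x ∉ ys ∧ x ≠ y ∧ y ∉ xs ∧ y ∉ ys := by
        simp only [List.cons_append, List.nodup_cons, List.mem_append, List.mem_cons,
          List.nodup_append] at hnd ⊢
        grind
      obtain ⟨hnd1, hx1, hx2, hxy, hy1, hy2⟩ := hnd'
      simp only [List.length_cons] at hF
      have hmul : (k + 3) * (xs.length + 1) = (k + 3) * xs.length + k + 3 := by ring
      have hmul2 : 3 * xs.length ≤ (k + 3) * xs.length := Nat.mul_le_mul_right _ (by omega)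
      obtain ⟨S, hS, hSx, hSy⟩ := hW x y (F ∪ (xs.toFinset ∪ ys.toFinset)) (by
        have h1 := Finset.card_union_le F (xs.toFinset ∪ ys.toFinset)
        have h2 := Finset.card_union_le xs.toFinset ys.toFinset
        have h3 := xs.toFinset_card_le
        have h4 := ys.toFinset_card_le
        omega)
      have hSc := card_of_mem_link hSx
      obtain ⟨L, L', R, hL, hL', hLl, hLl', hLs, hLs', hR, hprof⟩ :=
        ih ys (insert x (insert y (F ∪ S))) hlen' hnd1 (by
          have h1 := Finset.card_insert_le x (insert y (F ∪ S))
          have h2 := Finset.card_insert_le y (F ∪ S)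
          have h3 := Finset.card_union_le F S
          omega)
      have n1 := notMem_of_mem_link hSx
      have n2 := notMem_of_mem_link hSy
      simp only [Finset.disjoint_insert_right, Finset.disjoint_union_right] at hS hR
      refine ⟨insert x S :: L, insert y S :: L', R ∪ S,
        hL.cons (insert_mem_edges hSx) ?_, hL'.cons (insert_mem_edges hSy) ?_, by simp [hLl],
        by simp [hLl'], ?_, ?_, ?_, ?_⟩
      · simp [hLs, hx1, hR.2.1, hS.2.1, hR.2.2.2.2.symm]
      · simp [hLs', hy2, hR.2.2.1, hS.2.2, hR.2.2.2.2.symm]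
      · ext v; simp [hLs]; tauto
      · ext v; simp [hLs']; tauto
      · simp [hR.1.1, hR.1.2, hR.2.1, hR.2.2.1, hR.2.2.2.1, hS.1, hS.2.1, hS.2.2, n1, n2]
      · have := hw x y S hSx hSy
        simp only [listProfile_cons, List.map_cons, List.sum_cons]
        rw [add_sub_add_comm, hprof, this, add_sub_add_comm]

/-- Let `L`, `L'` transport the vertices of `e` to those of `f`. Then `e :: L'` and `f :: L` are
matchings of $k+1$ edges on the same vertex set, which explains the bound on the size of switches.
-/
theorem NoSwitch.sub_eq_sum_of_disjoint (hN : H.NoSwitch c m) (hk : 0 < k) (hm : k + 1 ≤ m)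
    {w : V → Fin r → ℤ} {l : ℕ} (hW : H.WellLinked l) (hl : (k + 3) * k ≤ l)
    (hw : ∀ x y S, S ∈ H.link x → S ∈ H.link y →
      unitVec (c (insert x S)) - unitVec (c (insert y S)) = w x - w y)
    {e f : Finset V} (he : e ∈ H.edges) (hf : f ∈ H.edges) (hef : Disjoint e f) :
    unitVec (c e) - unitVec (c f) = ∑ x ∈ e, w x - ∑ x ∈ f, w x := by
  obtain ⟨L, L', R, hL, hL', hLl, hLl', hLs, hLs', hR, hprof⟩ :=
    hW.exists_transport hk hw e.toList f.toList ∅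
      (by simp [H.uniform e he, H.uniform f hf])
      (by
        refine List.nodup_append.2 ⟨e.nodup_toList, f.nodup_toList, ?_⟩
        intro a ha b hb hab
        subst hab
        exact Finset.disjoint_left.1 hef (by simpa using ha) (by simpa using hb))
      (by simpa [H.uniform e he] using hl)
  simp only [Finset.toList_toFinset, Finset.disjoint_union_right] at hLs hLs' hR
  have := hN (e :: L') (f :: L)
    (hL'.cons he (by simp [hLs', hef, hR.1.1.symm]))
    (hL.cons hf (by simp [hLs, hef.symm, hR.1.2.symm]))
    (by ext v; simp [hLs, hLs']; tauto) (by simp [hLl', H.uniform e he]; omega)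
  simp only [listProfile_cons] at this
  rw [Finset.sum_map_toList, Finset.sum_map_toList] at hprof
  rw [← hprof, sub_eq_sub_iff_add_eq_add, this, add_comm]

/-- Two edges that meet are both compared with an edge disjoint from their union. -/
theorem NoSwitch.sub_eq_sum (hN : H.NoSwitch c m) (hk : 0 < k) (hm : k + 1 ≤ m)
    {w : V → Fin r → ℤ} {l : ℕ} (hW : H.WellLinked l) (hl : (k + 3) * k ≤ l)
    (hV : 2 * k < Fintype.card V)
    (hw : ∀ x y S, S ∈ H.link x → S ∈ H.link y →
      unitVec (c (insert x S)) - unitVec (c (insert y S)) = w x - w y)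
    {e f : Finset V} (he : e ∈ H.edges) (hf : f ∈ H.edges) :
    unitVec (c e) - unitVec (c f) = ∑ x ∈ e, w x - ∑ x ∈ f, w x := by
  have hcard : (e ∪ f).card ≤ 2 * k := by
    have := Finset.card_union_le e f
    rw [H.uniform e he, H.uniform f hf] at this
    omega
  obtain ⟨x, hx⟩ : ∃ x, x ∉ e ∪ f := by
    by_contra hcon
    push Not at hcon
    rw [Finset.eq_univ_iff_forall.2 hcon, Finset.card_univ] at hcard
    omega
  have hkl : 2 * k ≤ l := le_trans (Nat.mul_le_mul_right _ (by omega)) hl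
  obtain ⟨S, hS, hSx, -⟩ := hW x x (e ∪ f) (hcard.trans hkl)
  simp only [Finset.disjoint_union_right, Finset.mem_union, not_or] at hS hx
  have hg := insert_mem_edges hSx
  have h1 := hN.sub_eq_sum_of_disjoint hk hm hW hl hw he hg (by simp [hx.1, hS.1.symm])
  have h2 := hN.sub_eq_sum_of_disjoint hk hm hW hl hw hf hg (by simp [hx.2, hS.2.symm])
  rw [← sub_sub_sub_cancel_right _ _ (unitVec (c (insert x S))), h1, h2, sub_sub_sub_cancel_right]

/-- In the absence of switches, colours are determined by a partition of the vertices. -/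
theorem NoSwitch.exists_structure (hN : H.NoSwitch c m) (hk : 2 ≤ k) (hr : 2 ≤ r)
    (hm : k + 1 ≤ m) {l : ℕ} (hW : H.WellLinked l) (hl : (k + 3) * k ≤ l)
    (hV : 2 * k < Fintype.card V) :
    ∃ (φ : V → Fin r) (A : Fin r → ℤ),
      (∀ e ∈ H.edges, ∀ j, ((e.filter (fun x => φ x = j)).card : ℤ) = A j + unitVec (c e) j) ∨
      (3 ≤ r ∧
        (∀ e ∈ H.edges, ∀ j,
          ((e.filter (fun x => φ x = j)).card : ℤ) = A j - unitVec (c e) j)) := by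
  have hkl : 2 * k ≤ l := le_trans (Nat.mul_le_mul_right _ (by omega)) hl
  obtain ⟨w, hw⟩ := hN.exists_potential (by omega) hW hkl (by omega)
  obtain ⟨u, φ, hφ⟩ := exists_unitVec_of_sub (by omega) w (by
    intro x y
    obtain ⟨S, -, hSx, hSy⟩ := hW x y ∅ (by simp)
    exact ⟨_, _, (hw x y S hSx hSy).symm⟩)
  have hedge := fun e f he hf =>
    hN.sub_eq_sum (by omega) hm hW hl hV hw (e := e) (f := f) he hf
  by_cases hne : H.edges.Nonempty
  swap
  · rw [Finset.not_nonempty_iff_eq_empty] at hne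
    exact ⟨φ, 0, Or.inl (by simp [hne])⟩
  obtain ⟨f, hf⟩ := hne
  -- All edges have `k` vertices, so `u` cancels; $A$ is the type of the reference edge `f` minus
  -- $\delta_{c(f)}$.
  have hpos : ∀ (u : Fin r → ℤ) (φ : V → Fin r), (∀ x, w x = u + unitVec (φ x)) →
      ∀ e ∈ H.edges, ∀ j, ((e.filter (fun x => φ x = j)).card : ℤ) =
        (∑ x ∈ f, unitVec (φ x) - unitVec (c f)) j + unitVec (c e) j := by
    intro u φ hφ e he j
    have h := congrFun (hedge e f he hf) j
    simp only [hφ, Finset.sum_add_distrib, Finset.sum_const, H.uniform e he, H.uniform f hf,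
      Pi.sub_apply, Pi.add_apply] at h
    rw [← sum_unitVec_eq, Pi.sub_apply]
    linarith
  rcases hφ with hφ | hφ
  · exact ⟨φ, _, Or.inl (hpos u φ hφ)⟩
  -- For two classes $-\delta_i=\delta_{1-i}-(1,1)$, so exchanging the class labels turns the sign
  -- into $+$.
  rcases hr.eq_or_lt with rfl | hr3
  · refine ⟨fun x => Equiv.swap 0 1 (φ x), _,
      Or.inl (hpos (u - unitVec 0 - unitVec 1) (fun x => Equiv.swap 0 1 (φ x)) fun x => ?_)⟩
    rw [hφ]
    have h01 : φ x = 0 ∨ φ x = 1 := by omega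
    rcases h01 with h | h
    · simp only [h, Equiv.swap_apply_left]; abel
    · simp only [h, Equiv.swap_apply_right]; abel
  · refine ⟨φ, ∑ x ∈ f, unitVec (φ x) + unitVec (c f), Or.inr ⟨hr3, fun e he j => ?_⟩⟩
    have h := congrFun (hedge e f he hf) j
    simp only [hφ, Finset.sum_sub_distrib, Finset.sum_const, H.uniform e he, H.uniform f hf,
      Pi.sub_apply] at h
    rw [← sum_unitVec_eq, Pi.add_apply]
    linarith

end

end KGraph

/-! ### The trinomial estimate for three classes. -/

/-- Twelve terms of the trinomial expansion. -/
theorem trinomial_partial_sum_le {P Q R : ℝ} (hP : 0 ≤ P) (hQ : 0 ≤ Q) (hR : 0 ≤ R)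
    (x y z : ℕ) (O : Finset (ℕ × ℕ × ℕ)) (hO : ∀ o ∈ O, o.1 + o.2.1 + o.2.2 = 5) :
    ∑ o ∈ O, P ^ (x + o.1) / ((x + o.1).factorial : ℝ) *
      (Q ^ (y + o.2.1) / ((y + o.2.1).factorial : ℝ)) *
      (R ^ (z + o.2.2) / ((z + o.2.2).factorial : ℝ)) ≤
    (P + Q + R) ^ (x + y + z + 5) / ((x + y + z + 5).factorial : ℝ) := by
  have hF : (0 : ℝ) < ((x + y + z + 5).factorial : ℝ) := by
    exact_mod_cast (x + y + z + 5).factorial_pos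
  rw [le_div_iff₀ hF]
  have h := Finset.sum_pow_eq_sum_piAntidiag (Finset.univ : Finset (Fin 3)) ![P, Q, R]
    (x + y + z + 5)
  rw [Fin.sum_univ_three] at h
  simp only [Matrix.cons_val_zero, Matrix.cons_val_one, Matrix.cons_val] at h
  rw [h]
  let F : ℕ × ℕ × ℕ → Fin 3 → ℕ := fun o => ![x + o.1, y + o.2.1, z + o.2.2]
  have hFinj : Function.Injective F := by
    rintro ⟨a, b, c⟩ ⟨a', b', c'⟩ h
    have h0 := congrFun h 0
    have h1 := congrFun h 1
    have h2 := congrFun h 2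
    simp [F] at h0 h1 h2
    simp [h0, h1, h2]
  calc _ = ∑ g ∈ O.image F, (Nat.multinomial Finset.univ g : ℝ) *
        ∏ i, (![P, Q, R] : Fin 3 → ℝ) i ^ g i := by
        rw [Finset.sum_image fun _ _ _ _ h => hFinj h, Finset.sum_mul]
        refine Finset.sum_congr rfl fun o ho => ?_
        have hs : ∑ i, F o i = x + y + z + 5 := by
          rw [Fin.sum_univ_three]
          simp only [F, Matrix.cons_val_zero, Matrix.cons_val_one, Matrix.cons_val]
          have := hO o ho
          omega
        have hm := Nat.multinomial_spec (Finset.univ : Finset (Fin 3)) (F o)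
        rw [hs] at hm
        have hm' : (∏ i, ((F o i).factorial : ℝ)) * (Nat.multinomial Finset.univ (F o) : ℝ) =
            ((x + y + z + 5).factorial : ℝ) := by exact_mod_cast hm
        rw [← hm', Fin.prod_univ_three, Fin.prod_univ_three]
        simp only [F, Matrix.cons_val_zero, Matrix.cons_val_one, Matrix.cons_val]
        have f1 : ((x + o.1).factorial : ℝ) ≠ 0 := by exact_mod_cast Nat.factorial_ne_zero _
        have f2 : ((y + o.2.1).factorial : ℝ) ≠ 0 := by exact_mod_cast Nat.factorial_ne_zero _
        have f3 : ((z + o.2.2).factorial : ℝ) ≠ 0 := by exact_mod_cast Nat.factorial_ne_zero _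
        field_simp
    _ ≤ _ := by
        refine Finset.sum_le_sum_of_subset_of_nonneg ?_ ?_
        · intro g hg
          obtain ⟨o, ho, rfl⟩ := Finset.mem_image.1 hg
          rw [Finset.mem_piAntidiag]
          refine ⟨?_, by simp⟩
          rw [Fin.sum_univ_three]
          simp only [Matrix.cons_val_zero, Matrix.cons_val_one, Matrix.cons_val]
          have := hO o ho
          omega
        · intro g _ _
          refine mul_nonneg (Nat.cast_nonneg _) (Finset.prod_nonneg fun i _ => pow_nonneg ?_ _)
          fin_cases i <;> simpa

theorem pow_succ_div_factorial (P : ℝ) (i : ℕ) :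
    P ^ (i + 1) / ((i + 1).factorial : ℝ) = P / (i + 1) * (P ^ i / (i.factorial : ℝ)) := by
  have f1 : (i.factorial : ℝ) ≠ 0 := by exact_mod_cast Nat.factorial_ne_zero _
  rw [Nat.factorial_succ, pow_succ']
  push_cast
  field_simp

/-- Consecutive terms have ratio $P/(i+1)$; here $P/(x+1)\le5$, $P/(x+2)\le3$ and
$P/(x+3)\ge\frac53$. -/
theorem pow_div_factorial_ratios (x : ℕ) {P : ℝ} (hP : P = 3 * x + 5) :
    0 ≤ P ^ x / (x.factorial : ℝ) ∧
    P ^ (x + 1) / ((x + 1).factorial : ℝ) ≤ 5 * (P ^ x / (x.factorial : ℝ)) ∧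
    P ^ (x + 2) / ((x + 2).factorial : ℝ) ≤ 3 * (P ^ (x + 1) / ((x + 1).factorial : ℝ)) ∧
    5 / 3 * (P ^ (x + 2) / ((x + 2).factorial : ℝ)) ≤ P ^ (x + 3) / ((x + 3).factorial : ℝ) ∧
    0 ≤ P ^ (x + 1) / ((x + 1).factorial : ℝ) ∧ 0 ≤ P ^ (x + 2) / ((x + 2).factorial : ℝ) := by
  have hx : (0 : ℝ) ≤ x := Nat.cast_nonneg x
  have hP0 : 0 < P := by rw [hP]; positivity
  refine ⟨by positivity, ?_, ?_, ?_, by positivity, by positivity⟩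
  · rw [pow_succ_div_factorial]
    refine mul_le_mul_of_nonneg_right ?_ (by positivity)
    rw [div_le_iff₀ (by positivity)]; linarith
  · rw [pow_succ_div_factorial P (x + 1)]
    refine mul_le_mul_of_nonneg_right ?_ (by positivity)
    push_cast
    rw [div_le_iff₀ (by positivity)]; linarith
  · rw [pow_succ_div_factorial P (x + 2)]
    refine mul_le_mul_of_nonneg_right ?_ (by positivity)
    push_cast
    rw [le_div_iff₀ (by positivity)]; linarith

/-- Each of the six terms with indices 0, 2, 3 is at least $\frac13$ of an atom, with two terms for
each atom. Each of the three terms with indices 3, 1, 1 is at least $\frac59$ of either of two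
atoms, hence of their average. Every atom thus receives $\frac23+\frac59=\frac{11}9$. -/
theorem three_atoms_le_of_ratios {u0 u1 u2 u3 v0 v1 v2 v3 w0 w1 w2 w3 : ℝ}
    (hu0 : 0 ≤ u0) (hv0 : 0 ≤ v0) (hw0 : 0 ≤ w0) (hu1 : 0 ≤ u1) (hv1 : 0 ≤ v1) (hw1 : 0 ≤ w1)
    (hu2 : 0 ≤ u2) (hv2 : 0 ≤ v2) (hw2 : 0 ≤ w2)
    (u10 : u1 ≤ 5 * u0) (v10 : v1 ≤ 5 * v0) (w10 : w1 ≤ 5 * w0)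
    (u21 : u2 ≤ 3 * u1) (v21 : v2 ≤ 3 * v1) (w21 : w2 ≤ 3 * w1)
    (u32 : 5 / 3 * u2 ≤ u3) (v32 : 5 / 3 * v2 ≤ v3) (w32 : 5 / 3 * w2 ≤ w3) :
    11 / 9 * (u1 * v2 * w2 + u2 * v1 * w2 + u2 * v2 * w1) ≤
      u0 * v3 * w2 + u0 * v2 * w3 + u3 * v0 * w2 + u2 * v0 * w3 + u3 * v2 * w0 + u2 * v3 * w0 +
        u3 * v1 * w1 + u1 * v3 * w1 + u1 * v1 * w3 := by
  have key : ∀ {a0 a1 b2 b3 d : ℝ}, 0 ≤ a0 → 0 ≤ b2 → 0 ≤ d → a1 ≤ 5 * a0 → 5 / 3 * b2 ≤ b3 →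
      1 / 3 * (a1 * b2 * d) ≤ a0 * b3 * d := by
    intro a0 a1 b2 b3 d ha hb hd h1 h2
    have h3 : 1 / 3 * (a1 * b2) ≤ a0 * b3 := by
      have h4 := mul_le_mul_of_nonneg_right h1 hb
      have h5 := mul_le_mul_of_nonneg_left h2 ha
      linarith
    have := mul_le_mul_of_nonneg_right h3 hd
    linarith
  have key' : ∀ {a1 a2 b2 b3 d : ℝ}, 0 ≤ a1 → 0 ≤ b2 → 0 ≤ d → a2 ≤ 3 * a1 → 5 / 3 * b2 ≤ b3 →
      5 / 9 * (a2 * b2 * d) ≤ a1 * b3 * d := by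
    intro a1 a2 b2 b3 d ha hb hd h1 h2
    have h3 : 5 / 9 * (a2 * b2) ≤ a1 * b3 := by
      have h4 := mul_le_mul_of_nonneg_right h1 hb
      have h5 := mul_le_mul_of_nonneg_left h2 ha
      linarith
    have := mul_le_mul_of_nonneg_right h3 hd
    linarith
  have e1 := key hu0 hv2 hw2 u10 v32
  have e2 := key hu0 hw2 hv2 u10 w32
  have e3 := key hv0 hu2 hw2 v10 u32
  have e4 := key hv0 hw2 hu2 v10 w32
  have e5 := key hw0 hu2 hv2 w10 u32
  have e6 := key hw0 hv2 hu2 w10 v32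
  have a1 := key' hv1 hu2 hw1 v21 u32
  have a2 := key' hw1 hu2 hv1 w21 u32
  have a3 := key' hu1 hv2 hw1 u21 v32
  have a4 := key' hw1 hv2 hu1 w21 v32
  have a5 := key' hu1 hw2 hv1 u21 w32
  have a6 := key' hv1 hw2 hu1 v21 w32
  linarith

/-- The nine neighbouring terms sum to at least $\frac{11}9$ of the three atoms, and all twelve
occur in one trinomial expansion; $1+\frac{11}9=\frac{20}9$. The value must be below $\frac12$ to
leave room for slightly unbalanced class sizes. -/
theorem three_atoms_le (x y z : ℕ) {P Q R : ℝ} (hP : P = 3 * x + 5) (hQ : Q = 3 * y + 5)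
    (hR : R = 3 * z + 5) :
    P ^ (x + 1) / ((x + 1).factorial : ℝ) * (Q ^ (y + 2) / ((y + 2).factorial : ℝ)) *
        (R ^ (z + 2) / ((z + 2).factorial : ℝ)) +
      P ^ (x + 2) / ((x + 2).factorial : ℝ) * (Q ^ (y + 1) / ((y + 1).factorial : ℝ)) *
        (R ^ (z + 2) / ((z + 2).factorial : ℝ)) +
      P ^ (x + 2) / ((x + 2).factorial : ℝ) * (Q ^ (y + 2) / ((y + 2).factorial : ℝ)) *
        (R ^ (z + 1) / ((z + 1).factorial : ℝ)) ≤
    9 / 20 * ((P + Q + R) ^ (x + y + z + 5) / ((x + y + z + 5).factorial : ℝ)) := by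
  have hP0 : 0 ≤ P := by rw [hP]; positivity
  have hQ0 : 0 ≤ Q := by rw [hQ]; positivity
  have hR0 : 0 ≤ R := by rw [hR]; positivity
  have hsum := trinomial_partial_sum_le hP0 hQ0 hR0 x y z
    {(0, 3, 2), (0, 2, 3), (3, 0, 2), (2, 0, 3), (3, 2, 0), (2, 3, 0), (3, 1, 1), (1, 3, 1),
      (1, 1, 3), (1, 2, 2), (2, 1, 2), (2, 2, 1)} (by decide)
  repeat rw [Finset.sum_insert (by decide)] at hsum
  rw [Finset.sum_singleton] at hsum
  simp only [add_zero] at hsum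
  obtain ⟨u0, u10, u21, u32, u1, u2⟩ := pow_div_factorial_ratios x hP
  obtain ⟨v0, v10, v21, v32, v1, v2⟩ := pow_div_factorial_ratios y hQ
  obtain ⟨w0, w10, w21, w32, w1, w2⟩ := pow_div_factorial_ratios z hR
  have := three_atoms_le_of_ratios u0 v0 w0 u1 v1 w1 u2 v2 w2 u10 v10 w10 u21 v21 w21 u32 v32 w32
  linarith

/-- A convex function lies below its chord on $[0,1]$. -/
theorem one_add_pow_le {y : ℝ} (h0 : 0 ≤ y) (h1 : y ≤ 1) (j : ℕ) :
    (1 + y) ^ j ≤ 1 + (2 ^ j - 1) * y := by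
  induction j with
  | zero => simp
  | succ j ih =>
    have h2 : (1 : ℝ) ≤ 2 ^ j := one_le_pow₀ (by norm_num)
    calc (1 + y) ^ (j + 1) ≤ (1 + (2 ^ j - 1) * y) * (1 + y) := by
          rw [pow_succ]; exact mul_le_mul_of_nonneg_right ih (by linarith)
      _ ≤ 1 + (2 ^ (j + 1) - 1) * y := by
          have : (2 ^ j - 1) * (y * y) ≤ (2 ^ j - 1) * (y * 1) :=
            mul_le_mul_of_nonneg_left (mul_le_mul_of_nonneg_left h1 h0) (by linarith)
          rw [pow_succ]
          linarith

/-! ### Colour counts of a perfect matching, well-linkedness and class sizes. -/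

namespace KGraph

variable {V : Type*} {k r : ℕ}

theorem sum_card_colour (M : Finset (Finset V)) (c : Finset V → Fin r) :
    ∑ i, (M.filter (fun e => c e = i)).card = M.card :=
  (Finset.card_eq_sum_card_fiberwise (fun _ _ => by simp)).symm

theorem sum_types {φ : V → Fin r} {c : Finset V → Fin r} {A : Fin r → ℤ} {s : ℤ} {e : Finset V}
    (h : ∀ j, ((e.filter (fun x => φ x = j)).card : ℤ) = A j + s * unitVec (c e) j) :
    (e.card : ℤ) = ∑ j, A j + s := by
  rw [Finset.card_eq_sum_card_fiberwise (f := φ) (t := Finset.univ) (fun _ _ => by simp)]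
  push_cast
  rw [Finset.sum_congr rfl fun j _ => h j, Finset.sum_add_distrib, ← Finset.mul_sum]
  simp [unitVec_apply]

/-- If no colour is much more frequent than the average, none is much less frequent. -/
theorem le_card_colour {M : Finset (Finset V)} {c : Finset V → Fin r} {x : ℝ} (hr : 0 < r)
    (h : ∀ i, ((M.filter (fun e => c e = i)).card : ℝ) ≤ (M.card : ℝ) / r * (1 + x)) (i : Fin r) :
    (M.card : ℝ) / r * (1 - (r - 1) * x) ≤ ((M.filter (fun e => c e = i)).card : ℝ) := by
  have h1 : ∑ j, ((M.filter (fun e => c e = j)).card : ℝ) = M.card := by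
    exact_mod_cast sum_card_colour M c
  rw [← Finset.add_sum_erase _ _ (Finset.mem_univ i)] at h1
  have h2 : ∑ j ∈ Finset.univ.erase i, ((M.filter (fun e => c e = j)).card : ℝ) ≤
      (r - 1 : ℝ) * ((M.card : ℝ) / r * (1 + x)) := by
    refine (Finset.sum_le_card_nsmul _ _ _ fun j _ => h j).trans_eq ?_
    rw [Finset.card_erase_of_mem (Finset.mem_univ i), Finset.card_univ, Fintype.card_fin,
      nsmul_eq_mul, Nat.cast_sub hr, Nat.cast_one]
  have hr0 : (r : ℝ) ≠ 0 := by exact_mod_cast hr.ne'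
  have h3 : (M.card : ℝ) / r * (1 - (r - 1) * x) =
      M.card - (r - 1 : ℝ) * ((M.card : ℝ) / r * (1 + x)) := by
    field_simp; ring
  linarith

/-- If no colour is much more frequent than the average, every colour occurs. -/
theorem exists_mem_colour {M : Finset (Finset V)} {c : Finset V → Fin r} {x : ℝ} (hr : 0 < r)
    (hM : 0 < M.card) (hx : (r - 1) * x < 1)
    (h : ∀ i, ((M.filter (fun e => c e = i)).card : ℝ) ≤ (M.card : ℝ) / r * (1 + x)) (i : Fin r) :
    ∃ e ∈ M, c e = i := by
  have hr0 : (0 : ℝ) < r := by exact_mod_cast hr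
  have hMR : (0 : ℝ) < M.card := by exact_mod_cast hM
  have h1 : (0 : ℝ) < ((M.filter (fun e => c e = i)).card : ℝ) := by
    refine lt_of_lt_of_le ?_ (le_card_colour hr h i)
    have : 0 < 1 - ((r : ℝ) - 1) * x := by linarith
    positivity
  obtain ⟨e, he⟩ := Finset.card_pos.1 (show 0 < (M.filter (fun e => c e = i)).card by
    exact_mod_cast h1)
  exact ⟨e, Finset.mem_filter.1 he⟩

variable [Fintype V] [DecidableEq V]

theorem choose_pred_mul (hk : 2 ≤ k) {n : ℕ} (hn : 2 ≤ n) :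
    (n - 1) * (n - 2).choose (k - 2) = (k - 1) * (n - 1).choose (k - 1) := by
  obtain ⟨m, rfl⟩ : ∃ m, n = m + 2 := ⟨n - 2, by omega⟩
  obtain ⟨j, rfl⟩ : ∃ j, k = j + 2 := ⟨k - 2, by omega⟩
  have := Nat.add_one_mul_choose_eq m j
  simp only [Nat.add_sub_cancel, show m + 2 - 1 = m + 1 by omega, show j + 2 - 1 = j + 1 by omega]
  rw [this, mul_comm]

/-- Since $\binom{n-2}{k-2}=\frac{k-1}{n-1}\binom{n-1}{k-1}$, avoiding boundedly many vertices costs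
a vanishing fraction of each link. -/
theorem exists_forall_wellLinked (hk : 2 ≤ k) {η : ℝ} (hη : 0 < η) (l : ℕ) :
    ∃ N : ℕ, ∀ (V : Type*) [Fintype V] [DecidableEq V], N ≤ Fintype.card V → ∀ H : KGraph V k,
      (1 / 2 + η) * ((Fintype.card V - 1).choose (k - 1) : ℝ) ≤ H.minDegree →
      H.WellLinked l := by
  obtain ⟨N, hN⟩ := exists_nat_gt ((l + 1) * (k - 1 : ℕ) / η)
  refine ⟨max (N + 1) k, fun V _ _ hV H hH x y F hF => H.exists_common_link x y F ?_⟩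
  set n := Fintype.card V
  have hn1 : N + 1 ≤ n := (le_max_left _ _).trans hV
  have hn2 : k ≤ n := (le_max_right _ _).trans hV
  have hC : (0 : ℝ) < ((n - 1).choose (k - 1) : ℝ) := by
    exact_mod_cast Nat.choose_pos (by omega)
  have hid : ((n - 1 : ℕ) : ℝ) * ((n - 2).choose (k - 2) : ℝ) =
      ((k - 1 : ℕ) : ℝ) * ((n - 1).choose (k - 1) : ℝ) := by
    exact_mod_cast choose_pred_mul hk (by omega)
  have hNn : (N : ℝ) ≤ ((n - 1 : ℕ) : ℝ) := by exact_mod_cast (by omega : N ≤ n - 1)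
  have hn0 : (0 : ℝ) < ((n - 1 : ℕ) : ℝ) := by exact_mod_cast (by omega : 0 < n - 1)
  rw [div_lt_iff₀ hη] at hN
  have h1 : ((l : ℝ) + 1) * (k - 1 : ℕ) < ((n - 1 : ℕ) : ℝ) * η :=
    hN.trans_le (mul_le_mul_of_nonneg_right hNn hη.le)
  have h2 : ((l : ℝ) + 1) * ((n - 2).choose (k - 2) : ℝ) < η * ((n - 1).choose (k - 1) : ℝ) := by
    refine lt_of_mul_lt_mul_left ?_ hn0.le
    calc ((n - 1 : ℕ) : ℝ) * (((l : ℝ) + 1) * ((n - 2).choose (k - 2) : ℝ))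
        = (((l : ℝ) + 1) * (k - 1 : ℕ)) * ((n - 1).choose (k - 1) : ℝ) := by
          rw [mul_left_comm, hid]; ring
      _ < ((n - 1 : ℕ) : ℝ) * η * ((n - 1).choose (k - 1) : ℝ) :=
          mul_lt_mul_of_pos_right h1 hC
      _ = _ := by ring
  have h3 : ((F.card : ℝ) + 1) * ((n - 2).choose (k - 2) : ℝ) ≤
      ((l : ℝ) + 1) * ((n - 2).choose (k - 2) : ℝ) := by
    gcongr
  have h4 : ((n - 1).choose (k - 1) : ℝ) + 2 * (F.card + 1) * ((n - 2).choose (k - 2) : ℝ) <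
      2 * H.minDegree := by linarith
  exact_mod_cast h4

/-- A partition with edge types `A ± δ_c` has class sizes given by the colours of a perfect
matching. -/
theorem IsPerfectMatching.card_class {H : KGraph V k} {M : Finset (Finset V)}
    (hM : H.IsPerfectMatching M) (c : Finset V → Fin r) (φ : V → Fin r) (A : Fin r → ℤ) (s : ℤ)
    (h : ∀ e ∈ H.edges, ∀ j,
      ((e.filter (fun x => φ x = j)).card : ℤ) = A j + s * unitVec (c e) j) (j : Fin r) :
    ((Finset.univ.filter (fun v => φ v = j)).card : ℤ) =
      A j * M.card + s * (M.filter (fun e => c e = j)).card := by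
  rw [← sum_unitVec_eq φ, ← hM.sum_sum, Finset.sum_apply,
    Finset.sum_congr rfl (g := fun e => A j + s * unitVec (c e) j)]
  · rw [Finset.sum_add_distrib, ← Finset.mul_sum, ← sum_unitVec_eq c, Finset.sum_apply]
    simp [mul_comm]
  · intro e he
    rw [sum_unitVec_eq, h e (hM.1 he)]

end KGraph

/-! ### Degree bounds from the edge types $A-\delta_c$ and $A+\delta_c$. -/

namespace KGraph

variable {V : Type*} [DecidableEq V] {k r : ℕ}

theorem card_filter_insert {φ : V → Fin r} {v : V} {S : Finset V} (hv : v ∉ S) (j : Fin r) :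
    (((insert v S).filter (fun x => φ x = j)).card : ℤ) =
      unitVec (φ v) j + (S.filter (fun x => φ x = j)).card := by
  rw [Finset.filter_insert, unitVec_apply]
  by_cases h : φ v = j
  · rw [if_pos h, if_pos h.symm, Finset.card_insert_of_notMem (by simp [hv])]
    push_cast; ring
  · rw [if_neg h, if_neg (Ne.symm h), zero_add]

variable [Fintype V]

/-- For $v=x,y,z$ the vector $\delta_{\varphi(v)}+\delta_{c(v\cup S)}$ is the same, namely $A$ minus
the type of `S`. It would be positive in three coordinates, but a sum of two unit vectors has at
most two. -/
theorem link_inter_link_inter_link {H : KGraph V k} {φ : V → Fin r} {c : Finset V → Fin r}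
    {A : Fin r → ℤ}
    (h : ∀ e ∈ H.edges, ∀ j, ((e.filter (fun x => φ x = j)).card : ℤ) = A j - unitVec (c e) j)
    {x y z : V} (hxy : φ x ≠ φ y) (hyz : φ y ≠ φ z) (hxz : φ x ≠ φ z) {S : Finset V}
    (hx : S ∈ H.link x) (hy : S ∈ H.link y) (hz : S ∈ H.link z) : False := by
  have key : ∀ v, S ∈ H.link v → ∀ j, unitVec (φ v) j + unitVec (c (insert v S)) j =
      A j - (S.filter (fun x => φ x = j)).card := by
    intro v hv j
    have := h _ (insert_mem_edges hv) j
    rw [card_filter_insert (notMem_of_mem_link hv)] at this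
    linarith
  have h1 := key x hx
  have h2 := key y hy
  have h3 := key z hz
  have a1 := h1 (φ x)
  have a2 := h2 (φ x)
  have a3 := h3 (φ x)
  have b1 := h1 (φ y)
  have b2 := h2 (φ y)
  have b3 := h3 (φ y)
  simp only [unitVec_apply, if_true] at a1 a2 a3 b1 b2 b3
  grind

/-- With four or more classes and edge types `A - δ_c`, every `(k-1)`-set lies in the links of at
most two classes. -/
theorem four_mul_minDegree_le {H : KGraph V k} {φ : V → Fin r} {c : Finset V → Fin r}
    {A : Fin r → ℤ} (hr : 4 ≤ r)
    (h : ∀ e ∈ H.edges, ∀ j, ((e.filter (fun x => φ x = j)).card : ℤ) = A j - unitVec (c e) j)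
    (hpos : ∀ j, ∃ v, φ v = j) :
    4 * H.minDegree ≤ 2 * (Fintype.card V).choose (k - 1) := by
  choose v hv using hpos
  -- Double count the pairs of a class representative and a $(k-1)$-set in its link.
  have h1 := Finset.sum_card_bipartiteAbove_eq_sum_card_bipartiteBelow
    (s := (Finset.univ : Finset (Fin r))) (t := (Finset.univ : Finset V).powersetCard (k - 1))
    (fun i S => S ∈ H.link (v i))
  have h2 : ∀ i, ((Finset.univ.powersetCard (k - 1)).bipartiteAbove
      (fun i S => S ∈ H.link (v i)) i).card = H.degree (v i) := by
    intro i
    rw [← card_link, Finset.bipartiteAbove]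
    congr 1
    ext S
    simp only [Finset.mem_filter, Finset.mem_powersetCard_univ, and_iff_right_iff_imp]
    exact card_of_mem_link
  have h3 : ∀ S ∈ (Finset.univ : Finset V).powersetCard (k - 1),
      ((Finset.univ : Finset (Fin r)).bipartiteBelow (fun i S => S ∈ H.link (v i)) S).card ≤ 2 := by
    intro S _
    by_contra hlt
    obtain ⟨a, ha, b, hb, d, hd, hab, had, hbd⟩ := Finset.two_lt_card.1 (not_le.1 hlt)
    simp only [Finset.bipartiteBelow, Finset.mem_filter, Finset.mem_univ, true_and] at ha hb hd
    exact link_inter_link_inter_link h (by simpa [hv]) (by simpa [hv]) (by simpa [hv]) ha hb hd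
  calc 4 * H.minDegree ≤ r * H.minDegree := Nat.mul_le_mul_right _ hr
    _ = ∑ i : Fin r, H.minDegree := by simp
    _ ≤ ∑ i, H.degree (v i) := Finset.sum_le_sum fun i _ => H.minDegree_le_degree _
    _ ≤ ∑ S ∈ (Finset.univ : Finset V).powersetCard (k - 1), 2 := by
        rw [Finset.sum_congr rfl fun i _ => (h2 i).symm, h1]
        exact Finset.sum_le_sum h3
    _ = _ := by simp [Finset.card_powersetCard, mul_comm]

/-- An edge through `v` has no second vertex in the class of `v`, so the link of `v` lives outside
that class. -/
theorem degree_le_of_class_one {H : KGraph V k} {φ : V → Fin r} {c : Finset V → Fin r}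
    {A : Fin r → ℤ}
    (h : ∀ e ∈ H.edges, ∀ j, ((e.filter (fun x => φ x = j)).card : ℤ) = A j - unitVec (c e) j)
    {v : V} (hA : A (φ v) = 1) :
    H.degree v ≤
      (Fintype.card V - (Finset.univ.filter (fun u => φ u = φ v)).card).choose (k - 1) := by
  rw [← card_link, ← Finset.card_univ, ← Finset.card_sdiff_of_subset (Finset.filter_subset _ _),
    ← Finset.card_powersetCard]
  refine Finset.card_le_card fun S hS => Finset.mem_powersetCard.2 ⟨?_, card_of_mem_link hS⟩
  intro u hu
  simp only [Finset.mem_sdiff, Finset.mem_univ, Finset.mem_filter, true_and]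
  intro huv
  have h1 := h _ (insert_mem_edges hS) (φ v)
  rw [card_filter_insert (notMem_of_mem_link hS), hA] at h1
  have h2 : 0 < (S.filter (fun x => φ x = φ v)).card :=
    Finset.card_pos.2 ⟨u, Finset.mem_filter.2 ⟨hu, huv⟩⟩
  simp only [unitVec_apply, if_true] at h1
  split_ifs at h1 <;> omega

/-- The edges of colour $i$ have type $A-\delta_i$, and the numbers $3A_j-1$ add up to $3k$. Writing
$A=b+2$, the edge count is at most $\lambda^k$ times the three atoms of `three_atoms_le`. -/
theorem card_edges_le_of_types {H : KGraph V k} {φ : V → Fin 3} {c : Finset V → Fin 3}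
    {A : Fin 3 → ℤ} (hA : ∀ j, 2 ≤ A j) (hAk : ∑ j, A j = k + 1)
    (h : ∀ e ∈ H.edges, ∀ j, ((e.filter (fun x => φ x = j)).card : ℤ) = A j - unitVec (c e) j)
    {lam : ℝ} (hlam : 0 ≤ lam)
    (hN : ∀ j, ((Finset.univ.filter (fun v => φ v = j)).card : ℝ) ≤ lam * (3 * (A j : ℝ) - 1)) :
    (H.edges.card : ℝ) ≤ 9 / 20 * ((lam * (3 * k)) ^ k / (k.factorial : ℝ)) := by
  have hex : ∀ j, ∃ b : ℕ, A j = b + 2 := fun j =>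
    ⟨(A j - 2).toNat, by have := hA j; omega⟩
  choose b hb using hex
  have hk : k = b 0 + b 1 + b 2 + 5 := by
    rw [Fin.sum_univ_three, hb, hb, hb] at hAk
    omega
  let t : Fin 3 → Fin 3 → ℕ := fun i j => if j = i then b j + 1 else b j + 2
  have hsub : H.edges ⊆ Finset.univ.biUnion (fun i => setsOfType φ (t i)) := by
    intro e he
    refine Finset.mem_biUnion.2 ⟨c e, Finset.mem_univ _, mem_setsOfType.2 fun j => ?_⟩
    have := h e he j
    rw [hb, unitVec_apply] at this
    simp only [t]
    split_ifs at this ⊢ <;> omega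
  set N : Fin 3 → ℕ := fun j => (Finset.univ.filter (fun v => φ v = j)).card with hNdef
  have hN' : ∀ j, (N j : ℝ) ≤ lam * (3 * (b j : ℝ) + 5) := by
    intro j
    refine (hN j).trans_eq ?_
    rw [hb j]; push_cast; ring
  have hch : ∀ j s, ((N j).choose s : ℝ) ≤
      lam ^ s * ((3 * (b j : ℝ) + 5) ^ s / (s.factorial : ℝ)) := by
    intro j s
    refine (Nat.choose_le_pow_div (α := ℝ) s (N j)).trans ?_
    rw [← mul_div_assoc, ← mul_pow]
    gcongr
    exact hN' j
  have hcard : (H.edges.card : ℝ) ≤ ∑ i, ∏ j, ((N j).choose (t i j) : ℝ) := by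
    have h1 := (Finset.card_le_card hsub).trans Finset.card_biUnion_le
    simp_rw [card_setsOfType] at h1
    exact_mod_cast h1
  have hprod : ∀ i, ∏ j, ((N j).choose (t i j) : ℝ) ≤
      lam ^ k * ∏ j, ((3 * (b j : ℝ) + 5) ^ (t i j) / ((t i j).factorial : ℝ)) := by
    intro i
    have ht : ∑ j, t i j = k := by
      rw [hk, Fin.sum_univ_three]
      simp only [t]
      fin_cases i <;> simp <;> omega
    calc _ ≤ ∏ j, (lam ^ (t i j) *
          ((3 * (b j : ℝ) + 5) ^ (t i j) / ((t i j).factorial : ℝ))) :=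
          Finset.prod_le_prod (fun _ _ => Nat.cast_nonneg _) fun j _ => hch j _
      _ = _ := by rw [Finset.prod_mul_distrib, Finset.prod_pow_eq_pow_sum, ht]
  have hatoms := three_atoms_le (b 0) (b 1) (b 2) (P := 3 * (b 0 : ℝ) + 5)
    (Q := 3 * (b 1 : ℝ) + 5) (R := 3 * (b 2 : ℝ) + 5) rfl rfl rfl
  rw [← hk] at hatoms
  have hk3 : 3 * (b 0 : ℝ) + 5 + (3 * (b 1 : ℝ) + 5) + (3 * (b 2 : ℝ) + 5) = 3 * (k : ℝ) := by
    rw [hk]; push_cast; ring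
  rw [hk3] at hatoms
  calc (H.edges.card : ℝ) ≤ ∑ i, lam ^ k *
        ∏ j, ((3 * (b j : ℝ) + 5) ^ (t i j) / ((t i j).factorial : ℝ)) :=
        hcard.trans (Finset.sum_le_sum fun i _ => hprod i)
    _ ≤ lam ^ k * (9 / 20 * ((3 * (k : ℝ)) ^ k / (k.factorial : ℝ))) := by
        rw [← Finset.mul_sum]
        refine mul_le_mul_of_nonneg_left (le_trans (le_of_eq ?_) hatoms) (by positivity)
        simp only [Fin.sum_univ_three, Fin.prod_univ_three, t]
        simp
    _ = _ := by rw [mul_pow lam]; ring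

theorem minDegree_le_of_card_edges_le {H : KGraph V k} (hk : 0 < k) (hV : 0 < Fintype.card V)
    (h : (H.edges.card : ℝ) ≤ 1 / 2 * ((Fintype.card V : ℝ) ^ k / (k.factorial : ℝ))) :
    (H.minDegree : ℝ) ≤
      1 / 2 * ((Fintype.card V : ℝ) ^ (k - 1) / ((k - 1).factorial : ℝ)) := by
  have hV' : (0 : ℝ) < Fintype.card V := by exact_mod_cast hV
  have h1 : Fintype.card V * H.minDegree ≤ k * H.edges.card := by
    rw [← sum_degree, ← smul_eq_mul, ← Finset.card_univ]
    exact Finset.card_nsmul_le_sum _ _ _ fun v _ => H.minDegree_le_degree v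
  have h2 : (Fintype.card V : ℝ) * H.minDegree ≤ k * H.edges.card := by exact_mod_cast h1
  refine le_of_mul_le_mul_left (h2.trans ?_) hV'
  refine (mul_le_mul_of_nonneg_left h (Nat.cast_nonneg k)).trans_eq ?_
  obtain ⟨j, rfl⟩ : ∃ j, k = j + 1 := ⟨k - 1, by omega⟩
  have hf : (j.factorial : ℝ) ≠ 0 := by exact_mod_cast j.factorial_ne_zero
  rw [Nat.add_sub_cancel, Nat.factorial_succ, pow_succ]
  push_cast
  field_simp

/-- Three classes and edge types `A - δ_c`. -/
theorem minDegree_le_of_three_classes {H : KGraph V k} (hk : 3 ≤ k) {M : Finset (Finset V)}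
    (hM : H.IsPerfectMatching M) (hV : 0 < Fintype.card V) {φ : V → Fin 3}
    {c : Finset V → Fin 3} {A : Fin 3 → ℤ}
    (h : ∀ e ∈ H.edges, ∀ j, ((e.filter (fun x => φ x = j)).card : ℤ) = A j - unitVec (c e) j)
    {x : ℝ} (hx0 : 0 ≤ x) (hx : 2 * x < 1) (hxk : (1 + 2 * x) ^ k ≤ 10 / 9)
    (hc : ∀ i, ((M.filter (fun e => c e = i)).card : ℝ) ≤ (M.card : ℝ) / (3 : ℕ) * (1 + x))
    {q : ℕ} (hq : (M.card : ℝ) / (3 : ℕ) * (1 + x) ≤ q) :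
    H.minDegree ≤ (extremalGraph 3 k (3 * k * q) ![0, 0, k - 1]).minDegree ∨
    (H.minDegree : ℝ) ≤
      1 / 2 * ((Fintype.card V : ℝ) ^ (k - 1) / ((k - 1).factorial : ℝ)) := by
  have hlow := le_card_colour (by norm_num) hc
  have hMV := hM.mul_card
  have hM0 : 0 < M.card := Nat.pos_of_ne_zero fun h0 => by rw [h0] at hMV; omega
  have hMR : (0 : ℝ) < M.card := by exact_mod_cast hM0
  have hcls : ∀ j, ((Finset.univ.filter (fun v => φ v = j)).card : ℤ) =
      A j * M.card - (M.filter (fun e => c e = j)).card := by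
    intro j
    have := hM.card_class c φ A (-1) (fun e he j => by rw [h e he j]; ring) j
    rw [this]; ring
  have hclsR : ∀ j, ((Finset.univ.filter (fun v => φ v = j)).card : ℝ) =
      A j * M.card - (M.filter (fun e => c e = j)).card := by
    intro j; exact_mod_cast hcls j
  -- Every colour occurs, and an edge of colour `j` has $A_j-1\ge0$ vertices in class `j`.
  have hA1 : ∀ j, 1 ≤ A j := by
    intro j
    obtain ⟨e, heM, hce⟩ := exists_mem_colour (by norm_num) hM0 (by push_cast; linarith) hc j
    have := h e (hM.1 heM) j
    rw [hce, unitVec_apply, if_pos rfl] at this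
    omega
  -- If $A_i=1$, class `i` has $|M|$ minus the number of edges of colour `i` vertices. The rest of
  -- the vertex set has at most $(3(k-1)+1)q$, the size of the large class of $H(\cdot,(0,0,k-1))$.
  by_cases hone : ∃ i, A i = 1
  · left
    obtain ⟨i, hi⟩ := hone
    have hNi := hclsR i
    rw [hi, Int.cast_one, one_mul] at hNi
    have hci := hc i
    push_cast at hci hq
    have hNpos : (0 : ℝ) < ((Finset.univ.filter (fun v => φ v = i)).card : ℝ) := by
      rw [hNi]
      have : (M.card : ℝ) / 3 * (1 + x) < M.card := by
        have : (M.card : ℝ) * x < M.card * 1 := mul_lt_mul_of_pos_left (by linarith) hMR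
        linarith
      linarith
    obtain ⟨v, hv⟩ := Finset.card_pos.1 (show 0 < (Finset.univ.filter (fun v => φ v = i)).card by
      exact_mod_cast hNpos)
    have hv' : φ v = i := (Finset.mem_filter.1 hv).2
    have hq0 : 0 < q := by
      have : (0 : ℝ) < q := lt_of_lt_of_le (by positivity) hq
      exact_mod_cast this
    refine (H.minDegree_le_degree v).trans ((degree_le_of_class_one h (hv' ▸ hi)).trans ?_)
    refine le_trans (Nat.choose_le_choose _ ?_)
      (choose_le_minDegree_extremalGraph_three (by omega) hq0)
    rw [hv', Nat.sub_le_iff_le_add]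
    have hk1 : ((k - 1 : ℕ) : ℝ) = k - 1 := by rw [Nat.cast_sub (by omega)]; simp
    have hqM : (M.card : ℝ) / 3 ≤ q := by
      refine le_trans ?_ hq
      have : 0 ≤ (M.card : ℝ) / 3 * x := by positivity
      linarith
    have : (Fintype.card V : ℝ) ≤ ((3 * (k - 1 : ℕ) + 1 : ℝ)) * q +
        ((Finset.univ.filter (fun v => φ v = i)).card : ℝ) := by
      rw [← hMV, hNi, hk1]
      push_cast
      have hk3 : (1 : ℝ) ≤ k := by exact_mod_cast (by omega : 1 ≤ k)
      have h2 : (3 * ((k : ℝ) - 1)) * (M.card / 3) ≤ (3 * ((k : ℝ) - 1)) * q :=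
        mul_le_mul_of_nonneg_left hqM (by linarith)
      linarith
    exact_mod_cast this
  · right
    push Not at hone
    have hA2 : ∀ j, 2 ≤ A j := fun j => by
      have := hA1 j
      have := hone j
      omega
    obtain ⟨e, he⟩ := Finset.card_pos.1 hM0
    have hAk : ∑ j, A j = k + 1 := by
      have := sum_types (s := -1) (fun j => by rw [h e (hM.1 he) j]; ring) (φ := φ) (c := c) (A := A)
        (e := e)
      rw [H.uniform e (hM.1 he)] at this
      omega
    -- Near balance makes class `j` about $\frac{|M|}3(3A_j-1)$. The error $(1+2x)^k\le\frac{10}9$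
    -- then raises $\frac9{20}$ to at most $\frac12$.
    have hlam : ∀ j, ((Finset.univ.filter (fun v => φ v = j)).card : ℝ) ≤
        ((M.card : ℝ) / 3 * (1 + 2 * x)) * (3 * (A j : ℝ) - 1) := by
      intro j
      rw [hclsR]
      have h1 := hlow j
      push_cast at h1
      have h2 : (2 : ℝ) ≤ A j := by exact_mod_cast hA2 j
      have h3 : 0 ≤ (M.card : ℝ) / 3 * (2 * x) * (3 * (A j : ℝ) - 2) :=
        mul_nonneg (by positivity) (by linarith)
      linarith
    have hedges := card_edges_le_of_types hA2 hAk h (by positivity) hlam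
    refine minDegree_le_of_card_edges_le (by omega) hV (hedges.trans ?_)
    have hn : (M.card : ℝ) / 3 * (1 + 2 * x) * (3 * k) = (Fintype.card V : ℝ) * (1 + 2 * x) := by
      rw [← hMV]; push_cast; ring
    rw [hn, mul_pow]
    have hpos : 0 ≤ (Fintype.card V : ℝ) ^ k / (k.factorial : ℝ) := by positivity
    calc _ = 9 / 20 * (1 + 2 * x) ^ k * ((Fintype.card V : ℝ) ^ k / (k.factorial : ℝ)) := by ring
      _ ≤ _ := mul_le_mul_of_nonneg_right (by linarith) hpos

/-- The edge types `A + δ_c`: comparison with `H(n, a)`. -/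
theorem exists_forall_minDegree_le_of_plus (hr : 2 ≤ r) (hk : 0 < k) {ε : ℝ} (hε : 0 < ε) :
    ∃ Q : ℕ, ∀ q, Q ≤ q → ∀ (V : Type*) [Fintype V] [DecidableEq V] (H : KGraph V k)
      (M : Finset (Finset V)) (φ : V → Fin r) (c : Finset V → Fin r) (A : Fin r → ℤ) (x : ℝ),
      H.IsPerfectMatching M → 0 < M.card →
      (∀ e ∈ H.edges, ∀ j, ((e.filter (fun x => φ x = j)).card : ℤ) = A j + unitVec (c e) j) →
      0 ≤ x → (r - 1) * x < 1 →
      (∀ i, ((M.filter (fun e => c e = i)).card : ℝ) ≤ (M.card : ℝ) / r * (1 + x)) →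
      (M.card : ℝ) / r * (1 + x) ≤ q →
      (H.minDegree : ℝ) ≤
        (extremalThreshold r k + ε) * ((r * k * q - 1).choose (k - 1) : ℝ) := by
  obtain ⟨Q, hQ⟩ := exists_forall_minDegree_le_of_types (by omega : 0 < r) hk hε
  refine ⟨Q, fun q hq V _ _ H M φ c A x hM hM0 h hx0 hx hc hqM => ?_⟩
  have hr0 : (0 : ℝ) < r := by exact_mod_cast (by omega : 0 < r)
  have hcol := exists_mem_colour (by omega) hM0 hx hc
  -- An edge of a colour other than `j` meets class `j` in exactly $A_j$ vertices.
  have hA0 : ∀ j, 0 ≤ A j := by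
    intro j
    have : Nontrivial (Fin r) := Fin.nontrivial_iff_two_le.2 hr
    obtain ⟨i, hi⟩ := exists_ne j
    obtain ⟨e, he, hce⟩ := hcol i
    have := h e (hM.1 he) j
    rw [hce, unitVec_apply, if_neg (Ne.symm hi)] at this
    omega
  have hex : ∀ j, ∃ a : ℕ, A j = a := fun j => ⟨(A j).toNat, by have := hA0 j; omega⟩
  choose a ha using hex
  have hcls : ∀ j, (Finset.univ.filter (fun v => φ v = j)).card =
      a j * M.card + (M.filter (fun e => c e = j)).card := by
    intro j
    have := hM.card_class c φ A 1 (fun e he j => by rw [h e he j]; ring) j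
    rw [ha, one_mul] at this
    exact_mod_cast this
  refine hQ q hq V H φ a ?_ ?_ ?_ ?_
  · obtain ⟨e, he⟩ := Finset.card_pos.1 hM0
    have := sum_types (s := 1) (fun j => by rw [h e (hM.1 he) j]; ring) (φ := φ) (c := c) (A := A)
      (e := e)
    rw [H.uniform e (hM.1 he), Finset.sum_congr rfl fun j _ => ha j] at this
    have h2 : k = ∑ j, a j + 1 := by exact_mod_cast this
    omega
  · intro e he
    refine ⟨c e, mem_setsOfType.2 fun j => ?_⟩
    have := h e he j
    rw [ha, unitVec_apply] at this
    unfold bump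
    split_ifs at this ⊢ <;> omega
  · intro j
    obtain ⟨e, he, hce⟩ := hcol j
    have h1 : 0 < (M.filter (fun e => c e = j)).card :=
      Finset.card_pos.2 ⟨e, Finset.mem_filter.2 ⟨he, hce⟩⟩
    obtain ⟨v, hv⟩ := Finset.card_pos.1
      (show 0 < (Finset.univ.filter (fun v => φ v = j)).card by rw [hcls]; omega)
    exact ⟨v, (Finset.mem_filter.1 hv).2⟩
  · intro j
    have h1 : (M.card : ℝ) / r ≤ q := by
      refine le_trans ?_ hqM
      have : 0 ≤ (M.card : ℝ) / r * x := by positivity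
      linarith
    have h2 : (M.card : ℝ) ≤ r * q := by
      rw [div_le_iff₀ hr0] at h1; linarith
    have h3 : ((a j : ℝ) * M.card + ((M.filter (fun e => c e = j)).card : ℝ)) ≤
        ((r : ℝ) * a j + 1) * q := by
      have h4 := mul_le_mul_of_nonneg_left h2 (Nat.cast_nonneg (α := ℝ) (a j))
      have h5 := (hc j).trans hqM
      linarith
    rw [hcls]
    exact_mod_cast h3

end KGraph

/-! ### Unbalanced perfect matchings in graphs without switches. -/

namespace KGraph

variable {k r : ℕ}

/-- For large `n` the rounding is absorbed, so $rkq\le n(1+2x)$. Passing from $rkq$ back to `n`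
costs two factors $1+\frac\eta8$, and $(G+\frac\eta4)(1+\frac\eta8)^2<G+\eta$ when $G,\eta\le1$. -/
theorem exists_forall_choose_lt (hk : 0 < k) (hr : 0 < r) {G η x : ℝ} (hG0 : 0 ≤ G) (hG1 : G ≤ 1)
    (hη0 : 0 < η) (hη1 : η ≤ 1) (hx0 : 0 < x) (hx : x ≤ η / 2 ^ (k + 3)) :
    ∃ N : ℕ, ∀ n, N ≤ n → ∀ q : ℕ, (q : ℝ) ≤ (n : ℝ) / (r * k) * (1 + x) + 1 →
      (G + η / 4) * ((r * k * q - 1).choose (k - 1) : ℝ) <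
        (G + η) * ((n - 1).choose (k - 1) : ℝ) := by
  have hk0 : (0 : ℝ) < k := by exact_mod_cast hk
  have hr0 : (0 : ℝ) < r := by exact_mod_cast hr
  obtain ⟨N, hN⟩ := eventually_atTop.1
    ((eventually_pow_div_factorial_le (k - 1) (show 0 < η / 8 by linarith)).and
      ((eventually_ge_atTop k).and (tendsto_natCast_atTop_atTop.eventually_ge_atTop
        ((r : ℝ) * k / x))))
  refine ⟨N, fun n hn q hq => ?_⟩
  obtain ⟨hpow, hkn, hnx⟩ := hN n hn
  rw [div_le_iff₀ hx0] at hnx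
  have hC : (0 : ℝ) < ((n - 1).choose (k - 1) : ℝ) := by
    exact_mod_cast Nat.choose_pos (by omega)
  have hq' : ((r * k * q : ℕ) : ℝ) ≤ n * (1 + 2 * x) := by
    have h1 := mul_le_mul_of_nonneg_left hq (by positivity : (0 : ℝ) ≤ r * k)
    have h2 : (r : ℝ) * k * ((n : ℝ) / (r * k) * (1 + x) + 1) = n * (1 + x) + r * k := by
      field_simp
    push_cast
    linarith
  have h2k : (2 : ℝ) ^ (k + 3) = 16 * 2 ^ (k - 1) := by
    rw [show k + 3 = 4 + (k - 1) by omega, pow_add]; norm_num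
  have hxk : (2 ^ (k - 1) : ℝ) * (2 * x) ≤ η / 8 := by
    rw [h2k, le_div_iff₀ (by positivity)] at hx
    linarith
  have h1k : (1 : ℝ) ≤ 2 ^ (k - 1) := one_le_pow₀ (by norm_num)
  have h2x : 2 * x ≤ 1 := by
    have : 1 * (2 * x) ≤ (2 ^ (k - 1) : ℝ) * (2 * x) :=
      mul_le_mul_of_nonneg_right h1k (by linarith)
    linarith
  have hgrow : (1 + 2 * x) ^ (k - 1) ≤ 1 + η / 8 := by
    refine (one_add_pow_le (by linarith) h2x (k - 1)).trans ?_
    linarith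
  have hchoose : ((r * k * q - 1).choose (k - 1) : ℝ) ≤
      (1 + η / 8) * ((1 + η / 8) * ((n - 1).choose (k - 1) : ℝ)) := by
    calc ((r * k * q - 1).choose (k - 1) : ℝ) ≤ ((r * k * q).choose (k - 1) : ℝ) := by
          exact_mod_cast Nat.choose_le_choose _ (Nat.sub_le _ _)
      _ ≤ ((r * k * q : ℕ) : ℝ) ^ (k - 1) / ((k - 1).factorial : ℝ) :=
          Nat.choose_le_pow_div _ _
      _ ≤ (n * (1 + 2 * x)) ^ (k - 1) / ((k - 1).factorial : ℝ) := by gcongr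
      _ = (1 + 2 * x) ^ (k - 1) * ((n : ℝ) ^ (k - 1) / ((k - 1).factorial : ℝ)) := by
          rw [mul_pow]; ring
      _ ≤ _ := by
          refine mul_le_mul hgrow hpow (by positivity) (by linarith)
  calc _ ≤ (G + η / 4) * ((1 + η / 8) * ((1 + η / 8) * ((n - 1).choose (k - 1) : ℝ))) :=
        mul_le_mul_of_nonneg_left hchoose (by linarith)
    _ = (G + η / 4) * ((1 + η / 8) * (1 + η / 8)) * ((n - 1).choose (k - 1) : ℝ) := by ring
    _ < _ := by
        refine mul_lt_mul_of_pos_right ?_ hC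
        have h3 : η * η ≤ η * 1 := mul_le_mul_of_nonneg_left hη1 hη0.le
        have h4 : (1 + η / 8) * (1 + η / 8) ≤ 1 + 3 / 8 * η := by linarith
        have h5 := mul_le_mul_of_nonneg_left h4 (by linarith : 0 ≤ G + η / 4)
        have h6 : G * (3 / 8 * η) ≤ 1 * (3 / 8 * η) :=
          mul_le_mul_of_nonneg_right hG1 (by linarith)
        linarith

/-- Without switches, a large graph beyond both thresholds has an unbalanced perfect matching. -/
theorem exists_forall_of_noSwitch (hk : 3 ≤ k) (hr : 2 ≤ r) {η : ℝ} (hη0 : 0 < η) (hη1 : η ≤ 1) :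
    ∃ N : ℕ, ∀ (V : Type*) [Fintype V] [DecidableEq V], N ≤ Fintype.card V →
      k ∣ Fintype.card V → ∀ H : KGraph V k,
      (max (existenceThreshold k) (extremalThreshold r k) + η) *
        ((Fintype.card V - 1).choose (k - 1) : ℝ) ≤ H.minDegree →
      ∀ c : Finset V → Fin r, H.NoSwitch c (k + 1) →
      ∃ M, H.IsPerfectMatching M ∧ ∃ i : Fin r,
        (Fintype.card V : ℝ) / (r * k) * (1 + η / (r * 2 ^ (k + 5))) ≤
          ((M.filter (fun e => c e = i)).card : ℝ) := by
  set G := max (existenceThreshold k) (extremalThreshold r k) with hG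
  set x := η / (r * 2 ^ (k + 5)) with hx
  have hr1 : (2 : ℝ) ≤ r := by exact_mod_cast hr
  have hk0 : (0 : ℝ) < k := by exact_mod_cast (by omega : 0 < k)
  have hGhalf : 1 / 2 ≤ G := (one_half_le_existenceThreshold (by omega)).trans (le_max_left _ _)
  have hx0 : 0 < x := by positivity
  have h2k : (1 : ℝ) ≤ 2 ^ k := one_le_pow₀ (by norm_num)
  have hxeq : x * (r * (32 * 2 ^ k)) = η := by
    rw [hx, show (32 : ℝ) * 2 ^ k = 2 ^ (k + 5) by rw [pow_add]; ring]
    field_simp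
  have hxr : x * (r * 1) * 32 ≤ η := by
    rw [← hxeq]
    have : x * r * 1 ≤ x * r * 2 ^ k := mul_le_mul_of_nonneg_left h2k (by positivity)
    linarith
  have hx2k : x * (64 * 2 ^ k) ≤ η := by
    rw [← hxeq]
    have : x * (32 * 2 ^ k) * 2 ≤ x * (32 * 2 ^ k) * r :=
      mul_le_mul_of_nonneg_left hr1 (by positivity)
    linarith
  have hx64 : 64 * x ≤ 1 := by
    have : x * 64 * 1 ≤ x * 64 * 2 ^ k := mul_le_mul_of_nonneg_left h2k (by positivity)
    linarith
  -- In this case no graph satisfies the degree hypothesis.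
  by_cases hG1 : 1 < G
  · refine ⟨k, fun V _ _ hV _ H hH => ?_⟩
    exfalso
    have : Nonempty V := Fintype.card_pos_iff.1 (by omega)
    have h1 : (H.minDegree : ℝ) ≤ ((Fintype.card V - 1).choose (k - 1) : ℝ) := by
      exact_mod_cast H.minDegree_le_choose
    have h2 : (0 : ℝ) < ((Fintype.card V - 1).choose (k - 1) : ℝ) := by
      exact_mod_cast Nat.choose_pos (by omega)
    have h3 : 1 * ((Fintype.card V - 1).choose (k - 1) : ℝ) <
        (G + η) * ((Fintype.card V - 1).choose (k - 1) : ℝ) :=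
      mul_lt_mul_of_pos_right (by linarith) h2
    linarith
  rw [not_lt] at hG1
  obtain ⟨N1, hN1⟩ := exists_forall_isPerfectMatching (by omega : 0 < k) hη0
  obtain ⟨N2, hN2⟩ := exists_forall_wellLinked (by omega : 2 ≤ k) hη0 ((k + 3) * k)
  obtain ⟨N3, hN3⟩ := exists_forall_choose_lt (by omega : 0 < k) (by omega : 0 < r)
    (by linarith : 0 ≤ G) hG1 hη0 hη1 hx0 (by
      rw [le_div_iff₀ (by positivity), pow_add]
      have : 0 < x * 2 ^ k := by positivity
      linarith)
  obtain ⟨Q1, hQ1⟩ := exists_forall_minDegree_le_of_plus hr (by omega : 0 < k)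
    (show 0 < η / 4 by linarith)
  obtain ⟨Q2, hQ2⟩ := exists_forall_minDegree_extremalGraph_le (by omega : 0 < r)
    (by omega : 0 < k) (show 0 < η / 4 by linarith)
  obtain ⟨N4, hN4⟩ := eventually_atTop.1 (eventually_pow_div_factorial_le (k - 1) hη0)
  refine ⟨max (max (max N1 N2) (max N3 N4)) (max (2 * k + 1) (r * k * max Q1 Q2)), ?_⟩
  intro V _ _ hV hdvd H hH c hNS
  set n := Fintype.card V with hn
  simp only [max_le_iff] at hV
  obtain ⟨⟨⟨hn1, hn2⟩, hn3, hn4⟩, hnk, hnQ⟩ := hV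
  have hC : (0 : ℝ) < ((n - 1).choose (k - 1) : ℝ) := by
    exact_mod_cast Nat.choose_pos (by omega)
  obtain ⟨M, hM⟩ := hN1 V hn1 hdvd H (by
    refine le_trans (mul_le_mul_of_nonneg_right ?_ hC.le) hH
    have := le_max_left (existenceThreshold k) (extremalThreshold r k)
    linarith)
  refine ⟨M, hM, ?_⟩
  -- Any perfect matching serves: if all its colours were near the average, the class sizes would
  -- force a small minimum degree.
  by_contra hcon
  push Not at hcon
  have hMn := hM.mul_card
  rw [← hn] at hMn
  have hM0 : 0 < M.card := Nat.pos_of_ne_zero fun h0 => by rw [h0] at hMn; omega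
  have hMR : (0 : ℝ) < M.card := by exact_mod_cast hM0
  have hnM : (n : ℝ) / (r * k) = (M.card : ℝ) / r := by
    rw [← hMn]; push_cast; field_simp
  have hc : ∀ i, ((M.filter (fun e => c e = i)).card : ℝ) ≤ (M.card : ℝ) / r * (1 + x) := by
    intro i
    rw [← hnM]; exact (hcon i).le
  have hrx : ((r : ℝ) - 1) * x < 1 := by linarith
  -- Rounded up so that no colour has more than `q` edges; `q` plays the role of $n/(rk)$ in
  -- $H(n,\mathbf a)$.
  set q := ⌈(M.card : ℝ) / r * (1 + x)⌉₊ with hq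
  have hqle : (M.card : ℝ) / r * (1 + x) ≤ q := Nat.le_ceil _
  have hqlt : (q : ℝ) ≤ (n : ℝ) / (r * k) * (1 + x) + 1 := by
    rw [hnM]; exact (Nat.ceil_lt_add_one (by positivity)).le
  have hqQ : max Q1 Q2 ≤ q := by
    have h1 : ((r * k * max Q1 Q2 : ℕ) : ℝ) ≤ n := by exact_mod_cast hnQ
    have h2 : ((max Q1 Q2 : ℕ) : ℝ) ≤ (M.card : ℝ) / r := by
      rw [← hnM, le_div_iff₀ (by positivity)]
      push_cast at h1 ⊢
      linarith
    have h3 : (M.card : ℝ) / r ≤ M.card / r * (1 + x) := by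
      have : 0 ≤ (M.card : ℝ) / r * x := by positivity
      linarith
    exact_mod_cast h2.trans (h3.trans hqle)
  have hfin : ¬ (H.minDegree : ℝ) ≤
      (extremalThreshold r k + η / 4) * ((r * k * q - 1).choose (k - 1) : ℝ) := by
    intro hle
    have h1 := hN3 n hn3 q hqlt
    have h2 : (extremalThreshold r k + η / 4) * ((r * k * q - 1).choose (k - 1) : ℝ) ≤
        (G + η / 4) * ((r * k * q - 1).choose (k - 1) : ℝ) := by
      refine mul_le_mul_of_nonneg_right ?_ (Nat.cast_nonneg _)
      have := le_max_right (existenceThreshold k) (extremalThreshold r k)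
      linarith
    linarith
  have hfin' : ¬ (H.minDegree : ℝ) ≤
      1 / 2 * ((n : ℝ) ^ (k - 1) / ((k - 1).factorial : ℝ)) := by
    intro hle
    have h1 := hN4 n hn4
    have h2 : 0 < (G + η - 1 / 2 * (1 + η)) * ((n - 1).choose (k - 1) : ℝ) :=
      mul_pos (by linarith) hC
    linarith
  have hW := hN2 V hn2 H (by
    refine le_trans (mul_le_mul_of_nonneg_right ?_ hC.le) hH
    linarith)
  obtain ⟨φ, A, hA | ⟨hr3, hA⟩⟩ := hNS.exists_structure (by omega) hr le_rfl hW le_rfl (by omega)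
  · exact hfin (hQ1 q ((le_max_left _ _).trans hqQ) V H M φ c A x hM hM0 hA hx0.le hrx hc hqle)
  rcases hr3.eq_or_lt with hr3 | hr4
  · subst hr3
    have hxk : (1 + 2 * x) ^ k ≤ 10 / 9 := by
      have h1 := one_add_pow_le (by linarith : 0 ≤ 2 * x) (by linarith) k
      linarith
    rcases minDegree_le_of_three_classes hk hM (by omega) hA hx0.le (by linarith) hxk hc hqle
      with h | h
    · refine hfin (le_trans (Nat.cast_le.2 h) (hQ2 q ((le_max_right _ _).trans hqQ) _ ⟨?_, ?_⟩))
      · simp [Fin.sum_univ_three]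
      · intro i j hij
        fin_cases i <;> fin_cases j <;> simp at hij ⊢
    · exact hfin' h
  · refine hfin' ?_
    have hcol := exists_mem_colour (by omega) hM0 hrx hc
    -- Class `j` has $A_j|M|$ minus the number of edges of colour `j` vertices; here $A_j\ge1$, and
    -- some matching edge has another colour.
    have hpos : ∀ j, ∃ v, φ v = j := by
      intro j
      obtain ⟨e, heM, hce⟩ := hcol j
      have h1 := hA e (hM.1 heM) j
      rw [hce, unitVec_apply, if_pos rfl] at h1
      have h2 := hM.card_class c φ A (-1) (fun e he j => by rw [hA e he j]; ring) j
      obtain ⟨i, hij⟩ : ∃ i : Fin r, i ≠ j := by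
        have : Nontrivial (Fin r) := Fin.nontrivial_iff_two_le.2 hr
        exact exists_ne j
      obtain ⟨f, hfM, hcf⟩ := hcol i
      have h3 : (M.filter (fun e => c e = j)).card < M.card :=
        Finset.card_lt_card (Finset.filter_ssubset.2 ⟨f, hfM, by rw [hcf]; exact hij⟩)
      have h4 : (1 : ℤ) * M.card ≤ A j * M.card :=
        mul_le_mul_of_nonneg_right (by omega) (Nat.cast_nonneg _)
      obtain ⟨v, hv⟩ := Finset.card_pos.1
        (show 0 < (Finset.univ.filter (fun v => φ v = j)).card by omega)
      exact ⟨v, (Finset.mem_filter.1 hv).2⟩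
    have h1 := four_mul_minDegree_le hr4 hA hpos
    have h2 : (4 : ℝ) * H.minDegree ≤ 2 * (n.choose (k - 1) : ℝ) := by exact_mod_cast h1
    have h3 := Nat.choose_le_pow_div (α := ℝ) (k - 1) n
    linarith

end KGraph

/-! ### Families of disjoint switches. -/

namespace KGraph

variable {V : Type*} {k r : ℕ}

/-- Two matchings on the same vertex set, with at most `m` edges each, the first of which has more
edges of some colour. -/
structure IsSwitch [DecidableEq V] (H : KGraph V k) (c : Finset V → Fin r) (m : ℕ)
    (p : Finset (Finset V) × Finset (Finset V)) : Prop where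
  subset_fst : p.1 ⊆ H.edges
  subset_snd : p.2 ⊆ H.edges
  disjoint_fst : (p.1 : Set (Finset V)).PairwiseDisjoint id
  disjoint_snd : (p.2 : Set (Finset V)).PairwiseDisjoint id
  support_eq : p.1.biUnion id = p.2.biUnion id
  card_le : p.1.card ≤ m
  exists_colour : ∃ i, (p.2.filter (fun e => c e = i)).card < (p.1.filter (fun e => c e = i)).card

theorem nonempty_of_mem_edges {H : KGraph V k} (hk : 0 < k) {e : Finset V} (he : e ∈ H.edges) :
    e.Nonempty := Finset.card_pos.1 (by rw [H.uniform e he]; exact hk)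

theorem IsMatchingList.nodup {H : KGraph V k} (hk : 0 < k) {L : List (Finset V)}
    (hL : H.IsMatchingList L) : L.Nodup := by
  refine List.Pairwise.imp_of_mem ?_ hL.2
  rintro e f he _ hd rfl
  exact (nonempty_of_mem_edges hk (hL.1 e he)).ne_empty (Finset.disjoint_self_iff_empty e |>.1 hd)

/-- The inclusion of sets avoiding `U` into all sets. -/
def extendSet (U : Finset V) : Finset {v // v ∉ U} ↪ Finset V :=
  (Finset.mapEmbedding (Function.Embedding.subtype _)).toEmbedding

theorem extendSet_apply (U : Finset V) (e : Finset {v // v ∉ U}) :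
    extendSet U e = e.map (Function.Embedding.subtype _) := rfl

theorem disjoint_extendSet (U : Finset V) (e : Finset {v // v ∉ U}) :
    Disjoint (extendSet U e) U := by
  rw [Finset.disjoint_left]
  intro v hv
  rw [extendSet_apply] at hv
  obtain ⟨w, -, rfl⟩ := Finset.mem_map.1 hv
  exact w.2

section

variable [DecidableEq V]

theorem IsMatchingList.pairwiseDisjoint {H : KGraph V k} {L : List (Finset V)}
    (hL : H.IsMatchingList L) : (L.toFinset : Set (Finset V)).PairwiseDisjoint id := by
  intro e he f hf hef
  exact hL.2.forall (by simpa using he) (by simpa using hf) hef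

theorem biUnion_toFinset (L : List (Finset V)) : L.toFinset.biUnion id = listSupport L := by
  induction L with
  | nil => simp
  | cons e L ih =>
    rw [List.toFinset_cons, Finset.biUnion_insert, listSupport_cons, ih]; rfl

theorem card_biUnion_id {H : KGraph V k} {M : Finset (Finset V)} (hM : M ⊆ H.edges)
    (hd : (M : Set (Finset V)).PairwiseDisjoint id) : (M.biUnion id).card = k * M.card := by
  rw [Finset.card_biUnion hd]
  refine (Finset.sum_congr rfl (g := fun _ => k) fun e he => H.uniform e (hM he)).trans ?_
  rw [Finset.sum_const, smul_eq_mul, mul_comm]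

theorem IsMatchingList.profile_apply {H : KGraph V k} (hk : 0 < k) {L : List (Finset V)}
    (hL : H.IsMatchingList L) (c : Finset V → Fin r) (i : Fin r) :
    listProfile c L i = ((L.toFinset.filter (fun e => c e = i)).card : ℤ) := by
  rw [← sum_unitVec_eq c, listProfile, List.sum_toFinset _ (hL.nodup hk)]

/-- The profiles differ in some colour, and the list richer in it is put first. Equal supports force
equal numbers of edges, so the length bound holds for either order. -/
theorem exists_isSwitch_of_lists {H : KGraph V k} (hk : 0 < k) {c : Finset V → Fin r} {m : ℕ}
    {L L' : List (Finset V)} (hL : H.IsMatchingList L) (hL' : H.IsMatchingList L')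
    (hs : listSupport L = listSupport L') (hm : L.length ≤ m)
    (hne : listProfile c L ≠ listProfile c L') :
    ∃ p, H.IsSwitch c m p ∧ p.1.biUnion id = listSupport L := by
  obtain ⟨i, hi⟩ := Function.ne_iff.1 hne
  rw [hL.profile_apply hk, hL'.profile_apply hk] at hi
  have hsub : L.toFinset ⊆ H.edges := fun e he => hL.1 e (by simpa using he)
  have hsub' : L'.toFinset ⊆ H.edges := fun e he => hL'.1 e (by simpa using he)
  have hcard : L.toFinset.card ≤ m := L.toFinset_card_le.trans hm
  have hcard' : L'.toFinset.card = L.toFinset.card := by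
    have h1 := card_biUnion_id hsub hL.pairwiseDisjoint
    have h2 := card_biUnion_id hsub' hL'.pairwiseDisjoint
    rw [biUnion_toFinset, hs, ← biUnion_toFinset, h2] at h1
    exact Nat.eq_of_mul_eq_mul_left hk h1
  have hsupp : L.toFinset.biUnion id = L'.toFinset.biUnion id := by
    rw [biUnion_toFinset, biUnion_toFinset, hs]
  rcases lt_or_gt_of_ne hi with h | h
  · exact ⟨(L'.toFinset, L.toFinset), ⟨hsub', hsub, hL'.pairwiseDisjoint, hL.pairwiseDisjoint,
      hsupp.symm, hcard'.le.trans hcard, i, by exact_mod_cast h⟩, by rw [hs, biUnion_toFinset]⟩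
  · exact ⟨(L.toFinset, L'.toFinset), ⟨hsub, hsub', hL.pairwiseDisjoint, hL'.pairwiseDisjoint,
      hsupp, hcard, i, by exact_mod_cast h⟩, by rw [biUnion_toFinset]⟩

theorem listSupport_map_extendSet (U : Finset V) (L : List (Finset {v // v ∉ U})) :
    listSupport (L.map (extendSet U)) = extendSet U (listSupport L) := by
  induction L with
  | nil => rfl
  | cons e L ih =>
    rw [List.map_cons, listSupport_cons, ih, listSupport_cons]
    simp only [extendSet_apply, Finset.map_union]

theorem exists_isSwitch_disjoint [Fintype V] {H : KGraph V k} (hk : 0 < k)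
    {c : Finset V → Fin r} {m : ℕ} {U : Finset V}
    (h : ¬ (H.avoiding U).NoSwitch (fun e => c (extendSet U e)) m) :
    ∃ p, H.IsSwitch c m p ∧ Disjoint (p.1.biUnion id) U := by
  unfold NoSwitch at h
  push Not at h
  obtain ⟨L, L', hL, hL', hs, hm, hne⟩ := h
  have key : ∀ L : List (Finset {v // v ∉ U}), (H.avoiding U).IsMatchingList L →
      H.IsMatchingList (L.map (extendSet U)) := by
    intro L hL
    refine ⟨fun e he => ?_, ?_⟩
    · obtain ⟨f, hf, rfl⟩ := List.mem_map.1 he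
      exact mem_avoiding.1 (hL.1 f hf)
    · rw [List.pairwise_map]
      exact hL.2.imp fun hd => by simpa [extendSet_apply, Finset.disjoint_map] using hd
  have hprof : ∀ L : List (Finset {v // v ∉ U}),
      listProfile c (L.map (extendSet U)) = listProfile (fun e => c (extendSet U e)) L := by
    intro L
    simp [listProfile, Function.comp_def]
  obtain ⟨p, hp, hps⟩ := exists_isSwitch_of_lists hk (c := c) (m := m) (key L hL) (key L' hL')
    (by rw [listSupport_map_extendSet, hs, listSupport_map_extendSet]) (by simpa using hm)
    (by rwa [hprof, hprof])
  refine ⟨p, hp, ?_⟩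
  rw [hps, listSupport_map_extendSet]
  exact disjoint_extendSet _ _

/-- Vertex-disjoint switches. -/
structure IsSwitchFamily (H : KGraph V k) (c : Finset V → Fin r) (m : ℕ)
    (F : Finset (Finset (Finset V) × Finset (Finset V))) : Prop where
  isSwitch : ∀ p ∈ F, H.IsSwitch c m p
  disjoint : (F : Set (Finset (Finset V) × Finset (Finset V))).PairwiseDisjoint
    (fun p => p.1.biUnion id)

/-- The vertices covered by a family of switches. -/
def familySupport (F : Finset (Finset (Finset V) × Finset (Finset V))) : Finset V :=
  F.biUnion (fun p => p.1.biUnion id)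

theorem IsSwitch.support_nonempty {H : KGraph V k} (hk : 0 < k) {c : Finset V → Fin r} {m : ℕ}
    {p : Finset (Finset V) × Finset (Finset V)} (hp : H.IsSwitch c m p) :
    (p.1.biUnion id).Nonempty := by
  obtain ⟨i, hi⟩ := hp.exists_colour
  obtain ⟨e, he⟩ := Finset.card_pos.1 (Nat.zero_lt_of_lt hi)
  obtain ⟨v, hv⟩ := nonempty_of_mem_edges hk (hp.subset_fst (Finset.mem_filter.1 he).1)
  exact ⟨v, Finset.mem_biUnion.2 ⟨e, (Finset.mem_filter.1 he).1, hv⟩⟩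

/-- Divisibility by `k` is what allows a perfect matching on the remaining vertices. -/
theorem IsSwitchFamily.card_support {H : KGraph V k} {c : Finset V → Fin r} {m : ℕ}
    {F : Finset (Finset (Finset V) × Finset (Finset V))} (hF : H.IsSwitchFamily c m F) :
    k ∣ (familySupport F).card ∧ (familySupport F).card ≤ F.card * (k * m) := by
  rw [familySupport, Finset.card_biUnion hF.disjoint, Finset.sum_congr rfl
    (g := fun p => k * p.1.card)
    (fun p hp => card_biUnion_id (hF.isSwitch p hp).subset_fst (hF.isSwitch p hp).disjoint_fst)]
  refine ⟨Finset.dvd_sum fun p _ => dvd_mul_right _ _, ?_⟩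
  rw [← smul_eq_mul (F.card)]
  exact Finset.sum_le_card_nsmul _ _ _ fun p hp =>
    Nat.mul_le_mul_left _ (hF.isSwitch p hp).card_le

/-- There are `t` disjoint switches, or fewer whose removal leaves no switch. -/
theorem exists_isSwitchFamily [Fintype V] (H : KGraph V k) (hk : 0 < k) (c : Finset V → Fin r)
    (m t : ℕ) :
    ∃ F, H.IsSwitchFamily c m F ∧ F.card ≤ t ∧ (F.card = t ∨
      (H.avoiding (familySupport F)).NoSwitch (fun e => c (extendSet (familySupport F) e)) m) := by
  induction t with
  | zero => exact ⟨∅, ⟨by simp, by simp⟩, le_rfl, Or.inl rfl⟩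
  | succ t ih =>
    obtain ⟨F, hF, hFt, h⟩ := ih
    by_cases hN : (H.avoiding (familySupport F)).NoSwitch
      (fun e => c (extendSet (familySupport F) e)) m
    · exact ⟨F, hF, by omega, Or.inr hN⟩
    · have hFt' := h.resolve_right hN
      obtain ⟨p, hp, hpF⟩ := exists_isSwitch_disjoint hk hN
      have hdisj : ∀ p' ∈ F, Disjoint (p.1.biUnion id) (p'.1.biUnion id) := fun p' hp' =>
        hpF.mono_right (Finset.subset_biUnion_of_mem (fun p => p.1.biUnion id) hp')
      have hpn : p ∉ F := fun hmem =>
        (hp.support_nonempty hk).ne_empty ((Finset.disjoint_self_iff_empty _).1 (hdisj p hmem))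
      refine ⟨insert p F, ⟨?_, ?_⟩, ?_, Or.inl ?_⟩
      · intro p' hp'
        rcases Finset.mem_insert.1 hp' with rfl | h'
        · exact hp
        · exact hF.isSwitch p' h'
      · rw [Finset.coe_insert]
        exact hF.disjoint.insert fun p' hp' _ => hdisj p' hp'
      · rw [Finset.card_insert_of_notMem hpn]; omega
      · rw [Finset.card_insert_of_notMem hpn]; omega

/-- A perfect matching off the switches, together with a choice of a state for each switch, is a
perfect matching. -/
theorem IsSwitchFamily.exists_isPerfectMatching [Fintype V] {H : KGraph V k} (hk : 0 < k)
    {c : Finset V → Fin r} {m : ℕ} {F : Finset (Finset (Finset V) × Finset (Finset V))}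
    (hF : H.IsSwitchFamily c m F) {M : Finset (Finset {v // v ∉ familySupport F})}
    (hM : (H.avoiding (familySupport F)).IsPerfectMatching M)
    (s : Finset (Finset V) × Finset (Finset V) → Finset (Finset V))
    (hs : ∀ p, s p = p.1 ∨ s p = p.2) :
    ∃ M', H.IsPerfectMatching M' ∧ ∀ i, (M'.filter (fun e => c e = i)).card =
      (M.filter (fun e => c (extendSet (familySupport F) e) = i)).card +
        ∑ p ∈ F, ((s p).filter (fun e => c e = i)).card := by
  have hsub : ∀ p ∈ F, s p ⊆ H.edges := by
    intro p hp
    rcases hs p with h | h <;> rw [h]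
    · exact (hF.isSwitch p hp).subset_fst
    · exact (hF.isSwitch p hp).subset_snd
  have hsd : ∀ p ∈ F, (s p : Set (Finset V)).PairwiseDisjoint id := by
    intro p hp
    rcases hs p with h | h <;> rw [h]
    · exact (hF.isSwitch p hp).disjoint_fst
    · exact (hF.isSwitch p hp).disjoint_snd
  have hsupp : ∀ p ∈ F, (s p).biUnion id = p.1.biUnion id := by
    intro p hp
    rcases hs p with h | h <;> rw [h]
    exact (hF.isSwitch p hp).support_eq.symm
  have hmem : ∀ p ∈ F, ∀ e ∈ s p, ∀ v ∈ e, v ∈ p.1.biUnion id := by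
    intro p hp e he v hv
    rw [← hsupp p hp]
    exact Finset.mem_biUnion.2 ⟨e, he, hv⟩
  have hmemU : ∀ p ∈ F, ∀ v ∈ p.1.biUnion id, v ∈ familySupport F := fun p hp v hv =>
    Finset.mem_biUnion.2 ⟨p, hp, hv⟩
  have hext : ∀ e ∈ M.map (extendSet (familySupport F)), ∀ v ∈ e, v ∉ familySupport F := by
    intro e he v hv
    obtain ⟨f, -, rfl⟩ := Finset.mem_map.1 he
    exact Finset.disjoint_left.1 (disjoint_extendSet (familySupport F) f) hv
  refine ⟨M.map (extendSet (familySupport F)) ∪ F.biUnion s, ⟨?_, ?_⟩, ?_⟩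
  · refine Finset.union_subset ?_ (Finset.biUnion_subset.2 hsub)
    intro e he
    obtain ⟨f, hf, rfl⟩ := Finset.mem_map.1 he
    exact mem_avoiding.1 (hM.1 hf)
  · intro v
    by_cases hv : v ∈ familySupport F
    · obtain ⟨p, hp, hvp⟩ := Finset.mem_biUnion.1 hv
      have hvs : v ∈ (s p).biUnion id := by rw [hsupp p hp]; exact hvp
      obtain ⟨e, he, hve⟩ := Finset.mem_biUnion.1 hvs
      refine ⟨e, ⟨Finset.mem_union_right _ (Finset.mem_biUnion.2 ⟨p, hp, he⟩), hve⟩, ?_⟩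
      rintro f ⟨hf, hvf⟩
      rcases Finset.mem_union.1 hf with hf | hf
      · exact absurd hv (hext f hf v hvf)
      · obtain ⟨p', hp', hf'⟩ := Finset.mem_biUnion.1 hf
        have hpp : p' = p := by
          by_contra hne
          exact Finset.disjoint_left.1 (hF.disjoint hp' hp hne) (hmem p' hp' f hf' v hvf) hvp
        subst hpp
        by_contra hne
        exact Finset.disjoint_left.1 (hsd p' hp hf' he hne) hvf hve
    · obtain ⟨e, ⟨he, hve⟩, huniq⟩ := hM.2 ⟨v, hv⟩
      refine ⟨extendSet (familySupport F) e, ⟨Finset.mem_union_left _ (Finset.mem_map_of_mem _ he), ?_⟩, ?_⟩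
      · rw [extendSet_apply]
        exact Finset.mem_map.2 ⟨⟨v, hv⟩, hve, rfl⟩
      · rintro f ⟨hf, hvf⟩
        rcases Finset.mem_union.1 hf with hf | hf
        · obtain ⟨f', hf', rfl⟩ := Finset.mem_map.1 hf
          rw [extendSet_apply] at hvf
          obtain ⟨w, hw, hwv⟩ := Finset.mem_map.1 hvf
          have hwv' : w = ⟨v, hv⟩ := Subtype.ext hwv
          rw [huniq f' ⟨hf', hwv' ▸ hw⟩]
        · obtain ⟨p', hp', hf'⟩ := Finset.mem_biUnion.1 hf
          exact absurd (hmemU p' hp' v (hmem p' hp' f hf' v hvf)) hv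
  · intro i
    rw [Finset.filter_union, Finset.card_union_of_disjoint, Finset.filter_map, Finset.card_map,
      Finset.filter_biUnion, Finset.card_biUnion]
    · rfl
    · intro p hp p' hp' hne
      rw [Function.onFun, Finset.disjoint_left]
      intro e he he'
      have he1 := (Finset.mem_filter.1 he).1
      obtain ⟨v, hv⟩ := nonempty_of_mem_edges hk (hsub p hp he1)
      exact Finset.disjoint_left.1 (hF.disjoint hp hp' hne) (hmem p hp e he1 v hv)
        (hmem p' hp' e (Finset.mem_filter.1 he').1 v hv)
    · rw [Finset.disjoint_left]
      intro e he he'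
      obtain ⟨p, hp, hep⟩ := Finset.mem_biUnion.1 (Finset.mem_filter.1 he').1
      obtain ⟨v, hv⟩ := nonempty_of_mem_edges hk (hsub p hp hep)
      exact hext e (Finset.mem_filter.1 he).1 v hv (hmemU p hp v (hmem p hp e hep v hv))

/-- Many disjoint switches give two perfect matchings with quite different numbers of edges of some
colour. -/
theorem IsSwitchFamily.exists_two_isPerfectMatching [Fintype V] {H : KGraph V k} (hk : 0 < k)
    (hr : 0 < r)
    {c : Finset V → Fin r} {m : ℕ} {F : Finset (Finset (Finset V) × Finset (Finset V))}
    (hF : H.IsSwitchFamily c m F) {M : Finset (Finset {v // v ∉ familySupport F})}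
    (hM : (H.avoiding (familySupport F)).IsPerfectMatching M) :
    ∃ M₁ M₂, H.IsPerfectMatching M₁ ∧ H.IsPerfectMatching M₂ ∧ ∃ i,
      F.card + r * (M₂.filter (fun e => c e = i)).card ≤
        r * (M₁.filter (fun e => c e = i)).card := by
  have : Nonempty (Fin r) := ⟨⟨0, hr⟩⟩
  have hcol : ∀ p : Finset (Finset V) × Finset (Finset V), ∃ i, p ∈ F →
      (p.2.filter (fun e => c e = i)).card < (p.1.filter (fun e => c e = i)).card := by
    intro p
    by_cases hp : p ∈ F
    · obtain ⟨i, hi⟩ := (hF.isSwitch p hp).exists_colour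
      exact ⟨i, fun _ => hi⟩
    · exact ⟨Classical.arbitrary _, fun h => absurd h hp⟩
  choose col hcol using hcol
  -- Pigeonhole: one colour is the gain of at least a $1/r$ fraction of the switches.
  obtain ⟨i, hi⟩ : ∃ i, F.card ≤ r * (F.filter (fun p => col p = i)).card := by
    by_contra hcon
    push Not at hcon
    have h1 : r * F.card = ∑ i, r * (F.filter (fun p => col p = i)).card := by
      rw [← Finset.mul_sum, ← Finset.card_eq_sum_card_fiberwise (fun _ _ => by simp)]
    have h2 : ∑ i, r * (F.filter (fun p => col p = i)).card < ∑ _i : Fin r, F.card :=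
      Finset.sum_lt_sum_of_nonempty Finset.univ_nonempty fun i _ => hcon i
    simp only [Finset.sum_const, Finset.card_univ, Fintype.card_fin, smul_eq_mul] at h2
    omega
  obtain ⟨M₁, hM₁, hc₁⟩ := hF.exists_isPerfectMatching hk hM (fun p => p.1) (fun p => Or.inl rfl)
  -- Only the switches assigned to colour `i` are flipped, so each changes the count of `i` in the
  -- same direction.
  obtain ⟨M₂, hM₂, hc₂⟩ := hF.exists_isPerfectMatching hk hM
    (fun p => if col p = i then p.2 else p.1) (fun p => by
      by_cases h : col p = i <;> simp [h])
  refine ⟨M₁, M₂, hM₁, hM₂, i, ?_⟩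
  have hsum : (F.filter (fun p => col p = i)).card +
      ∑ p ∈ F, ((if col p = i then p.2 else p.1).filter (fun e => c e = i)).card ≤
      ∑ p ∈ F, (p.1.filter (fun e => c e = i)).card := by
    rw [Finset.card_filter, ← Finset.sum_add_distrib]
    refine Finset.sum_le_sum fun p hp => ?_
    split_ifs with h
    · have := hcol p hp
      rw [h] at this
      omega
    · omega
  rw [hc₁, hc₂]
  have := Nat.mul_le_mul_left r hsum
  linarith

end

end KGraph

/-! ### Combination of the cases of many and of few switches. -/

namespace KGraph

variable {k r : ℕ}

theorem card_subtype_notMem {V : Type*} [Fintype V] [DecidableEq V] (U : Finset V) :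
    Fintype.card {v // v ∉ U} = Fintype.card V - U.card := by
  rw [Fintype.card_subtype_compl, Fintype.card_coe]

/-- Deleting $\beta\eta n$ vertices costs at most $\beta\eta n\binom{n-2}{k-2}\le2\beta\eta
k\binom{n-1}{k-1}$, which is at most half of the excess. -/
theorem minDegree_avoiding_ge {V : Type*} [Fintype V] [DecidableEq V] {H : KGraph V k}
    (hk : 2 ≤ k) {U : Finset V} {G η β : ℝ} (hG : 0 ≤ G) (hη : 0 < η) (hβ : 0 < β)
    (hβk : 4 * (β * k) ≤ 1) (hn : 2 ≤ Fintype.card V)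
    (hU : (U.card : ℝ) ≤ β * η * Fintype.card V) (hUn : U.card < Fintype.card V)
    (hH : (G + η) * ((Fintype.card V - 1).choose (k - 1) : ℝ) ≤ H.minDegree) :
    (G + η / 2) * ((Fintype.card {v // v ∉ U} - 1).choose (k - 1) : ℝ) ≤
      (H.avoiding U).minDegree := by
  set n := Fintype.card V with hnd
  have hne : Nonempty {v // v ∉ U} := by
    rw [← Fintype.card_pos_iff, card_subtype_notMem]; omega
  have h1 : (H.minDegree : ℝ) ≤ (H.avoiding U).minDegree + U.card * ((n - 2).choose (k - 2) : ℝ) := by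
    exact_mod_cast H.minDegree_le_minDegree_avoiding_add U hne
  have hC' : ((Fintype.card {v // v ∉ U} - 1).choose (k - 1) : ℝ) ≤ ((n - 1).choose (k - 1) : ℝ) := by
    rw [card_subtype_notMem]
    exact_mod_cast Nat.choose_le_choose _ (by omega)
  have hid : ((n - 1 : ℕ) : ℝ) * ((n - 2).choose (k - 2) : ℝ) =
      ((k - 1 : ℕ) : ℝ) * ((n - 1).choose (k - 1) : ℝ) := by
    exact_mod_cast choose_pred_mul hk hn
  have hn0 : (0 : ℝ) < ((n - 1 : ℕ) : ℝ) := by exact_mod_cast (by omega : 0 < n - 1)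
  have hn2 : (n : ℝ) ≤ 2 * ((n - 1 : ℕ) : ℝ) := by exact_mod_cast (by omega : n ≤ 2 * (n - 1))
  have hkk : ((k - 1 : ℕ) : ℝ) ≤ k := by exact_mod_cast Nat.sub_le _ _
  have h2 : (U.card : ℝ) * ((n - 2).choose (k - 2) : ℝ) ≤
      η / 2 * ((n - 1).choose (k - 1) : ℝ) := by
    refine le_of_mul_le_mul_left ?_ hn0
    calc ((n - 1 : ℕ) : ℝ) * ((U.card : ℝ) * ((n - 2).choose (k - 2) : ℝ))
        = U.card * ((k - 1 : ℕ) : ℝ) * ((n - 1).choose (k - 1) : ℝ) := by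
          rw [mul_left_comm, hid]; ring
      _ ≤ (((n - 1 : ℕ) : ℝ) * (η / 2)) * ((n - 1).choose (k - 1) : ℝ) := by
          refine mul_le_mul_of_nonneg_right ?_ (Nat.cast_nonneg _)
          calc (U.card : ℝ) * ((k - 1 : ℕ) : ℝ) ≤ (β * η * n) * k :=
                mul_le_mul hU hkk (Nat.cast_nonneg _) (by positivity)
            _ ≤ (β * η * (2 * ((n - 1 : ℕ) : ℝ))) * k := by gcongr
            _ = (4 * (β * k)) * (((n - 1 : ℕ) : ℝ) * (η / 2)) := by ring
            _ ≤ 1 * (((n - 1 : ℕ) : ℝ) * (η / 2)) :=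
                mul_le_mul_of_nonneg_right hβk (by positivity)
            _ = _ := one_mul _
      _ = _ := by ring
  have h3 := mul_le_mul_of_nonneg_left hC' (by linarith : 0 ≤ G + η / 2)
  linarith

/-- The quantitative form of the theorem, for `η ≤ 1`. -/
theorem exists_forall_unbalanced (hk : 3 ≤ k) (hr : 2 ≤ r) {η : ℝ} (hη0 : 0 < η) (hη1 : η ≤ 1) :
    ∃ N : ℕ, ∀ (V : Type*) [Fintype V] [DecidableEq V], N ≤ Fintype.card V →
      k ∣ Fintype.card V → ∀ H : KGraph V k,
      (max (existenceThreshold k) (extremalThreshold r k) + η) *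
        ((Fintype.card V - 1).choose (k - 1) : ℝ) ≤ H.minDegree →
      ∀ c : Finset V → Fin r, ∃ M, H.IsPerfectMatching M ∧ ∃ i : Fin r,
        (Fintype.card V : ℝ) / (r * k) * (1 + 1 / (r * 2 ^ (k + 8)) / (4 * (k + 1) * r) * η) ≤
          ((M.filter (fun e => c e = i)).card : ℝ) := by
  set G := max (existenceThreshold k) (extremalThreshold r k) with hG
  -- At most $\beta\eta n$ vertices are covered by switches. The constant makes the gain of
  -- `exists_forall_of_noSwitch` at excess $\eta/2$ equal to $4\beta\eta$, more than the deletion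
  -- loses.
  set β : ℝ := 1 / (r * 2 ^ (k + 8)) with hβ
  set γ : ℝ := β / (4 * (k + 1) * r) with hγ
  have hr1 : (2 : ℝ) ≤ r := by exact_mod_cast hr
  have hk1 : (3 : ℝ) ≤ k := by exact_mod_cast hk
  have hGhalf : 1 / 2 ≤ G := (one_half_le_existenceThreshold (by omega)).trans (le_max_left _ _)
  have hβ0 : 0 < β := by positivity
  have hγ0 : 0 < γ := by positivity
  have hβ8 : η / 2 / (r * 2 ^ (k + 5)) = 4 * β * η := by
    rw [hβ, show k + 8 = (k + 5) + 3 by ring, pow_add _ (k + 5) 3]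
    field_simp
    norm_num
  have hβeq : β * (r * (256 * 2 ^ k)) = 1 := by
    rw [hβ, pow_add]
    field_simp
    norm_num
  have h2k : (k : ℝ) ≤ 2 ^ k := by exact_mod_cast Nat.lt_two_pow_self.le
  have hβk : 512 * (β * k) ≤ 1 := by
    rw [← hβeq]
    have h1 : β * k * (256 * 2) ≤ β * 2 ^ k * (256 * r) := by gcongr
    linarith
  have hβ1 : 512 * β ≤ 1 := by
    have : β * 1 ≤ β * k := mul_le_mul_of_nonneg_left (by linarith) hβ0.le
    linarith
  have hγeq : γ * (4 * (k + 1) * r) = β := by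
    rw [hγ]; field_simp
  have hγβ : γ ≤ β := by
    rw [← hγeq]
    refine le_mul_of_one_le_right hγ0.le ?_
    have : 1 * 1 ≤ (4 * ((k : ℝ) + 1)) * r := by gcongr <;> linarith
    linarith
  clear_value γ β
  have hη2 : 0 < η / 2 := by linarith
  obtain ⟨N1, hN1⟩ := exists_forall_isPerfectMatching (by omega : 0 < k) hη2
  obtain ⟨N2, hN2⟩ := exists_forall_of_noSwitch hk hr hη2 (by linarith)
  obtain ⟨N3, hN3⟩ := exists_nat_gt (2 * (k * (k + 1)) / (β * η))
  refine ⟨max (2 * max N1 N2) (max N3 (2 * k)), fun V _ _ hV hdvd H hH c => ?_⟩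
  set n := Fintype.card V with hn
  simp only [max_le_iff] at hV
  obtain ⟨hn12, hn3, hnk⟩ := hV
  have hn0 : (0 : ℝ) < n := by exact_mod_cast (by omega : 0 < n)
  have hβη : 0 < β * η := by positivity
  have hβη1 : 512 * (β * η) ≤ 1 := by
    have : β * η ≤ β * 1 := mul_le_mul_of_nonneg_left hη1 hβ0.le
    linarith
  -- A switch covers at most $k(k+1)$ vertices, whence the target number.
  obtain ⟨F, hF, hFt, hFor⟩ := H.exists_isSwitchFamily (by omega) c (k + 1)
    ⌊β * η * n / (k * (k + 1))⌋₊
  set t := ⌊β * η * n / (k * (k + 1))⌋₊ with ht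
  obtain ⟨hUd, hUc⟩ := hF.card_support
  have htle : (t : ℝ) ≤ β * η * n / (k * (k + 1)) := Nat.floor_le (by positivity)
  have hU : ((familySupport F).card : ℝ) ≤ β * η * n := by
    have h1 : ((familySupport F).card : ℝ) ≤ t * (k * (k + 1)) := by
      exact_mod_cast hUc.trans (Nat.mul_le_mul_right _ hFt)
    rw [le_div_iff₀ (by positivity)] at htle
    exact h1.trans htle
  have hU2 : 2 * (familySupport F).card ≤ n := by
    have : (2 : ℝ) * (familySupport F).card ≤ n := by
      have : 512 * (β * η) * n ≤ 1 * n := mul_le_mul_of_nonneg_right hβη1 hn0.le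
      linarith
    exact_mod_cast this
  have hn' := card_subtype_notMem (familySupport F)
  rw [← hn] at hn'
  have hdvd' : k ∣ Fintype.card {v // v ∉ familySupport F} := by
    rw [hn']; exact Nat.dvd_sub hdvd hUd
  have hmin := minDegree_avoiding_ge (H := H) (by omega) (by linarith : 0 ≤ G) hη0 hβ0
    (by linarith) (by omega) hU (by omega) hH
  rcases hFor with hFt' | hNS
  · obtain ⟨M, hM⟩ := hN1 {v // v ∉ familySupport F} (by omega) hdvd' _ (by
      refine le_trans (mul_le_mul_of_nonneg_right ?_ (Nat.cast_nonneg _)) hmin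
      have := le_max_left (existenceThreshold k) (extremalThreshold r k)
      linarith)
    obtain ⟨M₁, M₂, hM₁, hM₂, i, hi⟩ :=
      hF.exists_two_isPerfectMatching (by omega) (by omega : 0 < r) hM
    by_contra hcon
    push Not at hcon
    have h1 := hcon M₁ hM₁ i
    have hcard := hM₂.mul_card
    rw [← hn] at hcard
    have hnM : (n : ℝ) / (r * k) = (M₂.card : ℝ) / r := by
      rw [← hcard]; push_cast; field_simp
    have h2 := le_card_colour (c := c) (x := γ * η) (by omega) (fun j => by
      rw [← hnM]; exact (hcon M₂ hM₂ j).le) i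
    have h3 : (F.card : ℝ) + r * ((M₂.filter (fun e => c e = i)).card : ℝ) ≤
        r * ((M₁.filter (fun e => c e = i)).card : ℝ) := by exact_mod_cast hi
    rw [hFt'] at h3
    rw [hnM] at h1
    have h4 := mul_le_mul_of_nonneg_left h2 (by linarith : (0 : ℝ) ≤ r)
    have h5 := mul_lt_mul_of_pos_left h1 (show (0 : ℝ) < r by linarith)
    -- If all perfect matchings were balanced, `M₁` would have at most slightly more and `M₂` at
    -- least slightly less than the average in colour `i`. By the choice of `γ` the resulting bound
    -- is a quarter of the number whose floor is `t`.
    have h6 : (t : ℝ) < (M₂.card : ℝ) * (r * (γ * η)) := by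
      have e1 : (r : ℝ) * ((M₂.card : ℝ) / r * (1 - (r - 1) * (γ * η))) =
        M₂.card * (1 - (r - 1) * (γ * η)) := by field_simp
      have e2 : (r : ℝ) * ((M₂.card : ℝ) / r * (1 + γ * η)) = M₂.card * (1 + γ * η) := by
        field_simp
      rw [e1] at h4
      rw [e2] at h5
      linarith
    have h7 : β * η * n / (k * (k + 1)) < t + 1 := Nat.lt_floor_add_one _
    have h8 : β * η * n / (k * (k + 1)) = M₂.card * (4 * (r * (γ * η))) := by
      rw [← hγeq, ← hcard]; push_cast; field_simp
    -- Then taking the floor loses at most half, which contradicts the factor 4.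
    have h9 : 2 ≤ β * η * n / (k * (k + 1)) := by
      have h10 : (N3 : ℝ) ≤ n := by exact_mod_cast hn3
      have h11 := hN3.trans_le h10
      rw [div_lt_iff₀ hβη] at h11
      rw [le_div_iff₀ (by positivity)]
      linarith
    rw [h8] at h7 h9
    linarith
  · obtain ⟨M, hM, i, hi⟩ := hN2 {v // v ∉ familySupport F} (by omega) hdvd' _ hmin _ hNS
    obtain ⟨M', hM', hc⟩ := hF.exists_isPerfectMatching (by omega) hM (fun p => p.1)
      (fun p => Or.inl rfl)
    refine ⟨M', hM', i, ?_⟩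
    have h1 : ((M.filter (fun e => c (extendSet (familySupport F) e) = i)).card : ℝ) ≤
        ((M'.filter (fun e => c e = i)).card : ℝ) := by
      rw [hc]; exact_mod_cast Nat.le_add_right _ _
    refine le_trans ?_ (hi.trans h1)
    rw [hβ8, hn', Nat.cast_sub (by omega), div_mul_eq_mul_div, div_mul_eq_mul_div]
    refine div_le_div_of_nonneg_right (c := (r : ℝ) * k) ?_ (by positivity)
    -- The gain on the remaining vertices outweighs the loss of the deleted ones:
    -- $(1-y)(1+4y)\ge1+y$ for $y=\beta\eta$, and $\gamma\le\beta$.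
    calc (n : ℝ) * (1 + γ * η) ≤ n * ((1 - β * η) * (1 + 4 * β * η)) := by
          refine mul_le_mul_of_nonneg_left ?_ hn0.le
          have h2 : γ * η ≤ β * η := mul_le_mul_of_nonneg_right hγβ hη0.le
          have h3 : (β * η) * (512 * (β * η)) ≤ (β * η) * 1 :=
            mul_le_mul_of_nonneg_left hβη1 hβη.le
          linarith
      _ = (n - β * η * n) * (1 + 4 * β * η) := by ring
      _ ≤ (n - (familySupport F).card) * (1 + 4 * β * η) :=
          mul_le_mul_of_nonneg_right (by linarith) (by positivity)

/-- Above both thresholds, perfect matchings are unbalanced linearly in the excess `η`. -/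
theorem exists_unbalanced (hk : 3 ≤ k) (hr : 2 ≤ r) :
    ∃ γ : ℝ, 0 < γ ∧ ∀ η : ℝ, 0 < η → ∃ n₀ : ℕ,
      ∀ (V : Type*) [Fintype V] [DecidableEq V], n₀ ≤ Fintype.card V → k ∣ Fintype.card V →
      ∀ H : KGraph V k,
        (max (existenceThreshold k) (extremalThreshold r k) + η) *
            ((Fintype.card V - 1).choose (k - 1) : ℝ) < (H.minDegree : ℝ) →
        ∀ c : Finset V → Fin r, ∃ M : Finset (Finset V), H.IsPerfectMatching M ∧
          ∃ i : Fin r, (Fintype.card V : ℝ) / ((r : ℝ) * k) * (1 + γ * η) ≤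
            ((M.filter (fun e => c e = i)).card : ℝ) := by
  have hr0 : (0 : ℝ) < r := by exact_mod_cast (by omega : 0 < r)
  refine ⟨1 / (r * 2 ^ (k + 8)) / (4 * (k + 1) * r), by positivity, fun η hη => ?_⟩
  rcases le_or_gt η 1 with hη1 | hη1
  · obtain ⟨N, hN⟩ := exists_forall_unbalanced hk hr hη hη1
    exact ⟨N, fun V _ _ hV hd H hH => hN V hV hd H hH.le⟩
  -- As $f(k)\ge\frac12$, an excess above 1 exceeds every possible degree.
  · refine ⟨1, fun V _ _ hV _ H hH => ?_⟩
    have : Nonempty V := Fintype.card_pos_iff.1 hV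
    have h1 : (H.minDegree : ℝ) ≤ ((Fintype.card V - 1).choose (k - 1) : ℝ) := by
      exact_mod_cast H.minDegree_le_choose
    have h2 := (one_half_le_existenceThreshold (by omega : 2 ≤ k)).trans
      (le_max_left _ (extremalThreshold r k))
    have h3 : 1 * ((Fintype.card V - 1).choose (k - 1) : ℝ) ≤
        (max (existenceThreshold k) (extremalThreshold r k) + η) *
          ((Fintype.card V - 1).choose (k - 1) : ℝ) :=
      mul_le_mul_of_nonneg_right (by linarith) (Nat.cast_nonneg _)
    linarith

end KGraph

theorem discrepancyThreshold_le {k r : ℕ} (hk : 3 ≤ k) (hr : 2 ≤ r) :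
    discrepancyThreshold r k ≤ max (existenceThreshold k) (extremalThreshold r k) := by
  refine csInf_le ⟨0, fun h hh => hh.1.le⟩ ⟨?_, fun ε hε => ?_⟩
  · have := (one_half_le_existenceThreshold (by omega : 2 ≤ k)).trans
      (le_max_left _ (extremalThreshold r k))
    linarith
  · obtain ⟨γ, hγ, h⟩ := KGraph.exists_unbalanced hk hr
    -- Half of `ε` turns the non-strict degree condition into the strict one.
    obtain ⟨n₀, hn₀⟩ := h (ε / 2) (by linarith)
    have hr0 : (0 : ℝ) < r := by exact_mod_cast (by omega : 0 < r)
    have hk0 : (0 : ℝ) < k := by exact_mod_cast (by omega : 0 < k)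
    refine ⟨γ * (ε / 2) / (r * k), by positivity, max n₀ k, fun n hn hd H hH c => ?_⟩
    have hC : (0 : ℝ) < ((n - 1).choose (k - 1) : ℝ) := by
      have := (le_max_right n₀ k).trans hn
      exact_mod_cast Nat.choose_pos (by omega)
    have hn₀' := hn₀ (Fin n)
    simp only [Fintype.card_fin] at hn₀'
    obtain ⟨M, hM, i, hi⟩ := hn₀' ((le_max_left _ _).trans hn) hd H (by
      refine lt_of_lt_of_le (mul_lt_mul_of_pos_right ?_ hC) hH
      linarith) c
    refine ⟨M, hM, i, le_trans (le_of_eq ?_) hi⟩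
    ring

theorem mainTheorem1 (k r : ℕ) (hk : 3 ≤ k) (hr : 2 ≤ r) :
    (∃ γ : ℝ, 0 < γ ∧ ∀ η : ℝ, 0 < η → ∃ n₀ : ℕ,
      ∀ (V : Type*) [Fintype V] [DecidableEq V], n₀ ≤ Fintype.card V → k ∣ Fintype.card V →
      ∀ H : KGraph V k,
        (max (existenceThreshold k) (extremalThreshold r k) + η) *
            ((Fintype.card V - 1).choose (k - 1) : ℝ) < (H.minDegree : ℝ) →
        ∀ c : Finset V → Fin r, ∃ M : Finset (Finset V), H.IsPerfectMatching M ∧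
          ∃ i : Fin r, (Fintype.card V : ℝ) / ((r : ℝ) * k) * (1 + γ * η) ≤
            ((M.filter (fun e => c e = i)).card : ℝ)) ∧
    discrepancyThreshold r k ≤ max (existenceThreshold k) (extremalThreshold r k) :=
  ⟨KGraph.exists_unbalanced hk hr, discrepancyThreshold_le hk hr⟩
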